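/- Let $d_x,d_u\ge 1$, let $R_x\in\mathbb R^{d_x\times d_x}$, $R_u\in\mathbb R^{d_u\times d_u}$ be symmetric, and let $\sigma_w>0$. For a system $\theta=(A,B)$ with $A\in\mathbb R^{d_x\times d_x}$, $B\in\mathbb R^{d_x\times d_u}$ and a controller $K\in\mathbb R^{d_u\times d_x}$ put $$\mathcal J_\theta(K)=\lim_{T\to\infty}\mathbb E\Big[\tfrac1T\sum_{t=1}^T x_t^\top R_x x_t+u_t^\top R_u u_t\Big]\in[0,\infty],\qquad x_{t+1}=Ax_t+Bu_t+w_t,\ u_t=Kx_t,\ x_0=0,$$ with $w_t\sim\mathcal N(0,\sigma_w^2I)$ i.i.d., let $\mathcal R(K;\theta)=\mathcal J_\theta(K)-\inf_{K'}\mathcal J_\theta(K')$ be the excess risk and $K_{\rm opt}(\theta)$ the minimizer of $\mathcal R(\cdot\,;\theta)$. Systems $\theta=[A\ B]$ and controllers $K$ are regarded as vectors with the Euclidean ($=$ Frobenius) norm $\|\cdot\|_2$, and $\|\cdot\|_{\rm op}$ of a derivative is its operator norm as a (multi)linear map for these norms; $\|\cdot\|_{\rm op}$ of a matrix is the spectral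 norm. There are universal constants $c_1,c_2,c_3,c_4>0$ and universal real polynomials $p_2$ (one variable), $p_3$ (two variables), $p_h$ (four variables), independent of all other data including the dimensions, such that the following holds. Let $R_x\succeq I$, $R_u\succeq I$, and let $\theta_\star=(A_\star,B_\star)$ be stabilizable (some $K$ makes all eigenvalues of $A_\star+B_\star K$ lie in the open unit disc) with $B_\star\ne0$. Let $P_\star\succeq0$ be the solution of $P=A_\star^\top PA_\star-A_\star^\top PB_\star(R_u+B_\star^\top PB_\star)^{-1}B_\star^\top PA_\star+R_x$, and $\Psi_P=\|P_\star\|_{\rm op}$, $\Psi_B=\|B_\star\|_{\rm op}$, $\Psi_R=\|R_u\|_{\rm op}$. Set $$r=\min\Big\{\tfrac1{150\Psi_P^5},\tfrac1{240\Psi_B\Psi_P^5},\tfrac{\Psi_B}2\Big\},\qquad \mu=2\sigma_w^2,$$ $$L_{\mathcal R1}=\sigma_w^2\Big(c_1d_x\Psi_B\sqrt{\Psi_P}+\frac{c_2d_x\Psi_R(1+1/\Psi_B)}{\sqrt{\Psi_P}}\Big),\quad L_{\mathcal R2}=\sigma_w^2c_3d_x\big(\Psi_B^2\Psi_P^2+\Psi_R(1+\Psi_B)\Psi_P\big),$$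 $$L_{\mathcal R3}=\sigma_w^2c_4d_x\big(\Psi_B^3\Psi_P^{7/2}+\Psi_R\Psi_B(1+\Psi_B)\Psi_P^{5/2}\big),$$ $$L_{a1}=8\Psi_P^{7/2},\quad L_{a2}=p_2(\Psi_P),\quad L_{a3}=p_3(\Psi_P,\Psi_B),$$ $$L_{\rm hess}=\sigma_w^2\Big(d_x\,p_h(\Psi_P,\Psi_R,\Psi_B,1/\Psi_B)+d_x^2\Big(\Psi_B^2\Psi_P^4+(1+\Psi_B)\Psi_R\Psi_P^3+\frac{\Psi_R\Psi_P}{\Psi_B}\Big)\Big).$$ (For $\sigma_w=1$ all factors $\sigma_w^2$ disappear and $\mu=2$.) Then $r>0$, and for all $\theta$ with $\|\theta-\theta_\star\|_2\le r$ and all $K$ with $\|K-K_{\rm opt}(\theta_\star)\|_2\le L_{a1}r$: 1. the minimizer $K_{\rm opt}(\theta)$ of $\mathcal R(\cdot\,;\theta)$ exists and is unique, and $\mathcal R(K';\theta)\ge\frac\mu2\|K'-K_{\rm opt}(\theta)\|_2^2$ for every $K'\in\mathbb R^{d_u\times d_x}$; 2. $\mathcal R(\cdot\,;\theta)$ is finite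 and three times continuously differentiable near $K$, with $\|\nabla_K\mathcal R(K;\theta)\|_{\rm op}\le L_{\mathcal R1}$, $\|\nabla_K^2\mathcal R(K;\theta)\|_{\rm op}\le L_{\mathcal R2}$, $\|\nabla_K^3\mathcal R(K;\theta)\|_{\rm op}\le L_{\mathcal R3}$; 3. $K_{\rm opt}$ is three times continuously differentiable near $\theta$, with $\|\nabla_\theta K_{\rm opt}(\theta)\|_{\rm op}\le L_{a1}$, $\|\nabla_\theta^2K_{\rm opt}(\theta)\|_{\rm op}\le L_{a2}$, and $\|\nabla_\theta^3K_{\rm opt}(\theta)[\delta,\delta,\delta]\|_2\le L_{a3}$ whenever $\|\delta\|_2=1$; 4. $\|\nabla_K^2\mathcal R(K;\theta)-\nabla_K^2\mathcal R(K;\theta')\|_{\rm op}\le L_{\rm hess}\|\theta-\theta'\|_2$ for every $\theta'$ with $\|\theta'-\theta_\star\|_2\le r$. -/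

import Mathlib

open MeasureTheory ProbabilityTheory Filter Topology
open scoped ENNReal NNReal Matrix

noncomputable section

/-! ### Smooth decision making -/

/-- Excess risk `R(a; θ) = J_θ(a) - inf_{a'} J_θ(a')` of a loss with values in `[0, ∞]`. -/
def excessRisk {Θ E : Type*} (J : Θ → E → ℝ≥0∞) (a : E) (θ : Θ) : ℝ≥0∞ :=
  J θ a - ⨅ a' : E, J θ a'

/-- The plug-in optimal decision: a minimizer of `R(·; θ)` (arbitrary if there is none). -/
def optDecision {Θ E : Type*} [Nonempty E] (R : E → Θ → ℝ≥0∞) (θ : Θ) : E :=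
  Classical.epsilon fun a => IsMinOn (fun a' => R a' θ) Set.univ a

/-- The smooth decision-making assumption at `θs`, with radius `r`, curvature `μ` and smoothness
constants `LR1, LR2, LR3, La1, La2, La3, Lhess`. The risk may take the value `∞`; its
derivatives are those of the real-valued function that it defines near a point at which it is
locally finite. -/
structure SmoothDecisionMaking {Θ E : Type*}
    [NormedAddCommGroup Θ] [NormedSpace ℝ Θ] [NormedAddCommGroup E] [NormedSpace ℝ E]
    (R : E → Θ → ℝ≥0∞) (θs : Θ) (r μ LR1 LR2 LR3 La1 La2 La3 Lhess : ℝ) : Prop where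
  radius_pos : 0 < r
  curvature_pos : 0 < μ
  isMin_opt : ∀ θ, ‖θ - θs‖ ≤ r → IsMinOn (fun a => R a θ) Set.univ (optDecision R θ)
  unique_opt : ∀ θ, ‖θ - θs‖ ≤ r → ∀ a, IsMinOn (fun a' => R a' θ) Set.univ a →
    a = optDecision R θ
  quadratic_growth : ∀ θ, ‖θ - θs‖ ≤ r → ∀ a,
    ENNReal.ofReal (μ / 2 * ‖a - optDecision R θ‖ ^ 2) ≤ R a θ
  risk_finite : ∀ θ a, ‖θ - θs‖ ≤ r → ‖a - optDecision R θs‖ ≤ La1 * r →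
    ∀ᶠ a' in 𝓝 a, R a' θ ≠ ∞
  risk_contDiff : ∀ θ a, ‖θ - θs‖ ≤ r → ‖a - optDecision R θs‖ ≤ La1 * r →
    ContDiffAt ℝ 3 (fun a' => (R a' θ).toReal) a
  risk_deriv_one : ∀ θ a, ‖θ - θs‖ ≤ r → ‖a - optDecision R θs‖ ≤ La1 * r →
    ‖fderiv ℝ (fun a' => (R a' θ).toReal) a‖ ≤ LR1
  risk_deriv_two : ∀ θ a, ‖θ - θs‖ ≤ r → ‖a - optDecision R θs‖ ≤ La1 * r →
    ‖iteratedFDeriv ℝ 2 (fun a' => (R a' θ).toReal) a‖ ≤ LR2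
  risk_deriv_three : ∀ θ a, ‖θ - θs‖ ≤ r → ‖a - optDecision R θs‖ ≤ La1 * r →
    ‖iteratedFDeriv ℝ 3 (fun a' => (R a' θ).toReal) a‖ ≤ LR3
  opt_contDiff : ∀ θ, ‖θ - θs‖ ≤ r → ContDiffAt ℝ 3 (optDecision R) θ
  opt_deriv_one : ∀ θ, ‖θ - θs‖ ≤ r → ‖fderiv ℝ (optDecision R) θ‖ ≤ La1
  opt_deriv_two : ∀ θ, ‖θ - θs‖ ≤ r → ‖iteratedFDeriv ℝ 2 (optDecision R) θ‖ ≤ La2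
  opt_deriv_three : ∀ θ, ‖θ - θs‖ ≤ r → ∀ δ : Θ, ‖δ‖ = 1 →
    ‖iteratedFDeriv ℝ 3 (optDecision R) θ (fun _ => δ)‖ ≤ La3
  hess_lipschitz : ∀ θ θ' a, ‖θ - θs‖ ≤ r → ‖θ' - θs‖ ≤ r →
    ‖a - optDecision R θs‖ ≤ La1 * r →
    ‖iteratedFDeriv ℝ 2 (fun a' => (R a' θ).toReal) a
      - iteratedFDeriv ℝ 2 (fun a' => (R a' θ').toReal) a‖ ≤ Lhess * ‖θ - θ'‖

/-! ### Linear systems and the LQR problem -/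

/-- A system `θ = [A B]`, stored as one `dx × (dx + du)` matrix. -/
abbrev LinSystem (dx du : ℕ) := Matrix (Fin dx) (Fin dx ⊕ Fin du) ℝ

/-- A linear state-feedback controller `u = K x`. -/
abbrev Controller (dx du : ℕ) := Matrix (Fin du) (Fin dx) ℝ

variable {dx du : ℕ}

/-- The state matrix `A` of `θ = [A B]`. -/
def LinSystem.A (θ : LinSystem dx du) : Matrix (Fin dx) (Fin dx) ℝ := Matrix.toCols₁ θ

/-- The input matrix `B` of `θ = [A B]`. -/
def LinSystem.B (θ : LinSystem dx du) : Matrix (Fin dx) (Fin du) ℝ := Matrix.toCols₂ θ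

/-- Some linear feedback makes the closed loop Schur stable (all eigenvalues in the open unit
disc). -/
def Stabilizable (θ : LinSystem dx du) : Prop :=
  ∃ K : Controller dx du,
    spectralRadius ℂ ((LinSystem.A θ + LinSystem.B θ * K).map (algebraMap ℝ ℂ)) < 1

/-- The closed-loop trajectory `x_{t+1} = A x_t + B u_t + w_t`, `u_t = K x_t`, `x_0 = 0`,
driven by the noise sequence `w`. -/
def lqrState (θ : LinSystem dx du) (K : Controller dx du) (w : ℕ → Fin dx → ℝ) :
    ℕ → Fin dx → ℝ
  | 0 => 0
  | t + 1 => LinSystem.A θ *ᵥ lqrState θ K w t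
      + LinSystem.B θ *ᵥ (K *ᵥ lqrState θ K w t) + w t

/-- The law of the noise sequence: independent `w_t ∼ N(0, σ² I)`. -/
def noiseLaw (dx : ℕ) (σ : ℝ≥0) : Measure (ℕ → Fin dx → ℝ) :=
  Measure.infinitePi fun _ : ℕ => Measure.pi fun _ : Fin dx => gaussianReal 0 (σ ^ 2)

/-- The stage cost `xᵀ Rx x + uᵀ Ru u`. -/
def stageCost (Rx : Matrix (Fin dx) (Fin dx) ℝ) (Ru : Matrix (Fin du) (Fin du) ℝ)
    (x : Fin dx → ℝ) (u : Fin du → ℝ) : ℝ :=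
  x ⬝ᵥ (Rx *ᵥ x) + u ⬝ᵥ (Ru *ᵥ u)

/-- The LQR cost `lim_{T → ∞} E[(1/T) ∑_{t=1}^T (x_tᵀ Rx x_t + u_tᵀ Ru u_t)] ∈ [0, ∞]` of the
policy `u_t = K x_t`. -/
def lqrCost (σ : ℝ≥0) (Rx : Matrix (Fin dx) (Fin dx) ℝ) (Ru : Matrix (Fin du) (Fin du) ℝ)
    (θ : LinSystem dx du) (K : Controller dx du) : ℝ≥0∞ :=
  limUnder atTop fun T : ℕ => ∫⁻ w, ENNReal.ofReal
    ((1 / (T : ℝ)) * ∑ t ∈ Finset.Icc 1 T,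
      stageCost Rx Ru (lqrState θ K w t) (K *ᵥ lqrState θ K w t)) ∂(noiseLaw dx σ)

/-- The LQR excess risk `J_θ(K) - inf_{K'} J_θ(K')`. -/
def lqrRisk (σ : ℝ≥0) (Rx : Matrix (Fin dx) (Fin dx) ℝ) (Ru : Matrix (Fin du) (Fin du) ℝ) :
    Controller dx du → LinSystem dx du → ℝ≥0∞ :=
  excessRisk (lqrCost σ Rx Ru)

/-- The positive semidefinite solution of the discrete algebraic Riccati equation
`P = Aᵀ P A - Aᵀ P B (Ru + Bᵀ P B)⁻¹ Bᵀ P A + Rx`; it exists and is unique if `θ` is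
stabilizable and `Rx, Ru` are positive definite. -/
def riccati (Rx : Matrix (Fin dx) (Fin dx) ℝ) (Ru : Matrix (Fin du) (Fin du) ℝ)
    (θ : LinSystem dx du) : Matrix (Fin dx) (Fin dx) ℝ :=
  Classical.epsilon fun P => P.PosSemidef ∧
    P = (LinSystem.A θ)ᵀ * P * LinSystem.A θ
      - (LinSystem.A θ)ᵀ * P * LinSystem.B θ
          * (Ru + (LinSystem.B θ)ᵀ * P * LinSystem.B θ)⁻¹
          * (LinSystem.B θ)ᵀ * P * LinSystem.A θ
      + Rx

section OpNorm

open scoped Matrix.Norms.L2Operator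

/-- The spectral norm of a matrix (operator norm for the Euclidean norms). -/
def opNorm {m n : ℕ} (M : Matrix (Fin m) (Fin n) ℝ) : ℝ := ‖M‖

end OpNorm

end

-- From here on systems and controllers carry the Frobenius norm, i.e. the Euclidean norm of
-- their vectorizations.
open scoped Matrix.Norms.Frobenius

open scoped ContDiff

/-! ### Frobenius and spectral norms, quadratic forms -/

section MatrixNorms

variable {l m n : ℕ}

/-! The cost of a gain is governed by a discrete Lyapunov equation. With W = A + BK the state
covariance obeys Σ_{t+1} = W Σ_t Wᵀ + σ² I. So the average cost tends to σ² tr X with X = WᵀXW + Rx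
+ KᵀRuK when the powers of W tend to zero, and it is infinite otherwise, because Rx ⪰ I. Completing
the square around the Riccati solution P with its gain K₀ shows that a stabilizing L has excess risk
σ² tr Y, where Y = WᵀYW + (L - K₀)ᵀ G (L - K₀), now with W = A + BL, and G = Ru + BᵀPB ⪰ I. A
Lyapunov solution dominates its source, so the risk is at least σ² ‖L - K₀‖². This gives existence,
uniqueness and curvature at once (`RiccatiPair.dlyap_eq`, `RiccatiPair.norm_sq_le`).

The optimal gain is a zero of the residual Ru K + Bᵀ X_K (A + BK). At an optimum the derivative of
X_K in K vanishes, so the residual has derivative V ↦ GV, which is invertible, and the implicit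
function theorem applies. To bound three derivatives, the optimality equations are differentiated
along θ + tδ (`riccati_curve_jet`). By stationarity the j-th derivative of P involves those of K
only below order j, so the system is triangular. It is estimated in coordinates where P and G become
identities: there the closed loop w satisfies ‖w‖² ≤ 1 - 1/Ψ, the input matrix is a contraction, and
each Lyapunov solve costs one factor Ψ (`normalized_jet_bounds`, `RiccatiPair.gain_jet_bounds`).

Uniformity over the two balls comes from a single Lyapunov function. The radius is so small that the
nominal P decreases along every closed loop formed from a system and a gain in the balls
(`LocalRegion.lyapunov`). All these loops are therefore stable. Using the nominal gain as a
competitor at a nearby system bounds the value matrix there by 50/49 of the nominal one, so the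
derivative bounds hold throughout the ball, and the mean value inequality keeps the optimal gains in
the ball of gains.

For the risk, the derivatives of a Lyapunov solution along K + tδ again solve Lyapunov equations,
with sources built from lower derivatives. Each is measured by the least b with |X| ≤ bP as
quadratic forms; a solve costs a factor 5/4, and the trace costs dx ‖P‖
(`LocalRegion.jetBound_risk`). For the dependence of the Hessian on θ, the risk equals σ² tr X_K up
to a constant in K, so two Lyapunov equations with the same cost data are compared
(`LocalRegion.hessian_lipschitz`). Bounds along lines become operator norms by polarization, with
factors 2 and 5. -/

theorem frobenius_sq_eq_sum {ι κ : Type*} [Fintype ι] [Fintype κ] (M : Matrix ι κ ℝ) :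
    ‖M‖ ^ 2 = ∑ i, ∑ j, M i j ^ 2 := by
  have h0 : 0 ≤ ∑ i, ∑ j, M i j ^ 2 :=
    Finset.sum_nonneg fun i _ => Finset.sum_nonneg fun j _ => sq_nonneg _
  have : ‖M‖ = √(∑ i, ∑ j, M i j ^ 2) := by
    rw [Matrix.frobenius_norm_def, Real.sqrt_eq_rpow]
    simp
  rw [this, Real.sq_sqrt h0]

theorem dotProduct_self_nonneg' {ι : Type*} [Fintype ι] (x : ι → ℝ) : 0 ≤ x ⬝ᵥ x :=
  Finset.sum_nonneg fun i _ => mul_self_nonneg (x i)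

theorem dotProduct_sq_le {ι : Type*} [Fintype ι] (x y : ι → ℝ) :
    (x ⬝ᵥ y) ^ 2 ≤ (x ⬝ᵥ x) * (y ⬝ᵥ y) := by
  have := Finset.sum_mul_sq_le_sq_mul_sq Finset.univ x y
  simpa [dotProduct, sq] using this

theorem frobenius_sq_eq_trace (M : Matrix (Fin m) (Fin n) ℝ) :
    ‖M‖ ^ 2 = (Mᵀ * M).trace := by
  rw [frobenius_sq_eq_sum, Finset.sum_comm]
  simp [Matrix.trace, Matrix.mul_apply, sq]

theorem opNorm_nonneg (M : Matrix (Fin m) (Fin n) ℝ) : 0 ≤ opNorm M := by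
  unfold opNorm
  exact @norm_nonneg _ Matrix.instL2OpNormedAddCommGroup.toSeminormedAddCommGroup.toSeminormedAddGroup M

theorem euclidean_norm_sq (x : Fin n → ℝ) : ‖WithLp.toLp 2 x‖ ^ 2 = x ⬝ᵥ x := by
  rw [EuclideanSpace.norm_sq_eq]
  simp [dotProduct, sq]

theorem mulVec_dotProduct_self_le (M : Matrix (Fin m) (Fin n) ℝ) (x : Fin n → ℝ) :
    (M *ᵥ x) ⬝ᵥ (M *ᵥ x) ≤ opNorm M ^ 2 * (x ⬝ᵥ x) := by
  have h := Matrix.l2_opNorm_mulVec M (WithLp.toLp 2 x)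
  have h2 := pow_le_pow_left₀ (norm_nonneg _) h 2
  rw [mul_pow, euclidean_norm_sq x] at h2
  rw [← euclidean_norm_sq (M *ᵥ x)]
  exact h2

theorem opNorm_le_of_mulVec {M : Matrix (Fin m) (Fin n) ℝ} {c : ℝ} (hc : 0 ≤ c)
    (h : ∀ x, (M *ᵥ x) ⬝ᵥ (M *ᵥ x) ≤ c ^ 2 * (x ⬝ᵥ x)) : opNorm M ≤ c := by
  unfold opNorm
  rw [Matrix.l2_opNorm_def]
  refine ContinuousLinearMap.opNorm_le_bound _ hc fun x => ?_
  refine le_of_sq_le_sq ?_ (by positivity)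
  have := h (WithLp.ofLp x)
  rw [mul_pow]
  rw [← euclidean_norm_sq, ← euclidean_norm_sq] at this
  exact this

theorem opNorm_mul_le (M : Matrix (Fin l) (Fin m) ℝ) (N : Matrix (Fin m) (Fin n) ℝ) :
    opNorm (M * N) ≤ opNorm M * opNorm N := Matrix.l2_opNorm_mul M N

theorem opNorm_add_le (M N : Matrix (Fin m) (Fin n) ℝ) : opNorm (M + N) ≤ opNorm M + opNorm N := by
  unfold opNorm
  exact @norm_add_le _ Matrix.instL2OpNormedAddCommGroup.toSeminormedAddCommGroup.toSeminormedAddGroup M N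

theorem opNorm_transpose (M : Matrix (Fin m) (Fin n) ℝ) : opNorm Mᵀ = opNorm M := by
  have := Matrix.l2_opNorm_conjTranspose M
  rwa [Matrix.conjTranspose_eq_transpose_of_trivial] at this

theorem norm_mul_le_opNorm_left (M : Matrix (Fin l) (Fin m) ℝ) (N : Matrix (Fin m) (Fin n) ℝ) :
    ‖M * N‖ ≤ opNorm M * ‖N‖ := by
  refine le_of_sq_le_sq ?_ (mul_nonneg (opNorm_nonneg _) (norm_nonneg _))
  rw [mul_pow, frobenius_sq_eq_sum, frobenius_sq_eq_sum, Finset.sum_comm,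
    Finset.sum_comm (f := fun i j => N i j ^ 2), Finset.mul_sum]
  refine Finset.sum_le_sum fun j _ => ?_
  have := mulVec_dotProduct_self_le M (fun i => N i j)
  simpa [dotProduct, Matrix.mulVec, Matrix.mul_apply, sq] using this

theorem norm_mul_le_opNorm_right (M : Matrix (Fin l) (Fin m) ℝ) (N : Matrix (Fin m) (Fin n) ℝ) :
    ‖M * N‖ ≤ ‖M‖ * opNorm N := by
  have := norm_mul_le_opNorm_left Nᵀ Mᵀ
  rwa [← Matrix.transpose_mul, Matrix.frobenius_norm_transpose, Matrix.frobenius_norm_transpose,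
    opNorm_transpose, mul_comm] at this

theorem opNorm_le_norm (M : Matrix (Fin m) (Fin n) ℝ) : opNorm M ≤ ‖M‖ := by
  refine opNorm_le_of_mulVec (norm_nonneg _) fun x => ?_
  rw [frobenius_sq_eq_sum, Finset.sum_mul]
  refine Finset.sum_le_sum fun i _ => ?_
  have := dotProduct_sq_le (M i) x
  simpa [dotProduct, Matrix.mulVec, sq] using this

theorem opNorm_pos_of_ne_zero {M : Matrix (Fin m) (Fin n) ℝ} (h : M ≠ 0) : 0 < opNorm M := by
  unfold opNorm
  exact (@norm_pos_iff _ Matrix.instL2OpNormedAddCommGroup.toNormedAddGroup M).2 h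

/-- The quadratic form `xᵀ M x`. -/
def qf (M : Matrix (Fin n) (Fin n) ℝ) (x : Fin n → ℝ) : ℝ := x ⬝ᵥ (M *ᵥ x)

theorem qf_add (M N : Matrix (Fin n) (Fin n) ℝ) (x : Fin n → ℝ) :
    qf (M + N) x = qf M x + qf N x := by
  simp [qf, Matrix.add_mulVec, dotProduct_add]

theorem qf_sub (M N : Matrix (Fin n) (Fin n) ℝ) (x : Fin n → ℝ) :
    qf (M - N) x = qf M x - qf N x := by
  simp [qf, Matrix.sub_mulVec, dotProduct_sub]

theorem qf_smul (c : ℝ) (M : Matrix (Fin n) (Fin n) ℝ) (x : Fin n → ℝ) :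
    qf (c • M) x = c * qf M x := by
  simp [qf, Matrix.smul_mulVec, dotProduct_smul]

theorem qf_one (x : Fin n → ℝ) : qf 1 x = x ⬝ᵥ x := by simp [qf]

theorem qf_zero (x : Fin n → ℝ) : qf 0 x = 0 := by simp [qf]

/-- Moving a matrix across the dot product. -/
theorem dotProduct_transpose_mulVec (M : Matrix (Fin m) (Fin n) ℝ) (x : Fin n → ℝ) (y : Fin m → ℝ) :
    x ⬝ᵥ (Mᵀ *ᵥ y) = (M *ᵥ x) ⬝ᵥ y := by
  rw [Matrix.dotProduct_mulVec, Matrix.vecMul_transpose]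

theorem qf_transpose_mul_mul (N L : Matrix (Fin m) (Fin n) ℝ) (M : Matrix (Fin m) (Fin m) ℝ)
    (x : Fin n → ℝ) : qf (Nᵀ * M * L) x = (N *ᵥ x) ⬝ᵥ (M *ᵥ (L *ᵥ x)) := by
  rw [qf, ← Matrix.mulVec_mulVec, ← Matrix.mulVec_mulVec, dotProduct_transpose_mulVec]

theorem qf_conj (N : Matrix (Fin m) (Fin n) ℝ) (M : Matrix (Fin m) (Fin m) ℝ)
    (x : Fin n → ℝ) : qf (Nᵀ * M * N) x = qf M (N *ᵥ x) := qf_transpose_mul_mul N N M x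

theorem qf_transpose (M : Matrix (Fin n) (Fin n) ℝ) (x : Fin n → ℝ) : qf Mᵀ x = qf M x := by
  rw [qf, dotProduct_transpose_mulVec, dotProduct_comm, qf]

theorem trace_eq_sum_qf (M : Matrix (Fin n) (Fin n) ℝ) :
    M.trace = ∑ i, qf M (Pi.single i 1) := by
  simp [Matrix.trace, qf]

theorem abs_qf_le (M : Matrix (Fin n) (Fin n) ℝ) (x : Fin n → ℝ) :
    |qf M x| ≤ opNorm M * (x ⬝ᵥ x) := by
  refine abs_le_of_sq_le_sq ?_ (mul_nonneg (opNorm_nonneg _) (dotProduct_self_nonneg' _))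
  calc qf M x ^ 2 ≤ (x ⬝ᵥ x) * ((M *ᵥ x) ⬝ᵥ (M *ᵥ x)) := dotProduct_sq_le _ _
    _ ≤ (x ⬝ᵥ x) * (opNorm M ^ 2 * (x ⬝ᵥ x)) :=
      mul_le_mul_of_nonneg_left (mulVec_dotProduct_self_le _ _) (dotProduct_self_nonneg' _)
    _ = _ := by ring

theorem posSemidef_iff_qf (M : Matrix (Fin n) (Fin n) ℝ) :
    M.PosSemidef ↔ Mᵀ = M ∧ ∀ x, 0 ≤ qf M x := by
  rw [Matrix.posSemidef_iff_dotProduct_mulVec]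
  simp [Matrix.IsHermitian, Matrix.conjTranspose_eq_transpose_of_trivial, qf]

theorem qf_le_of_posSemidef_sub {M N : Matrix (Fin n) (Fin n) ℝ} (h : (M - N).PosSemidef)
    (x : Fin n → ℝ) : qf N x ≤ qf M x := by
  have := ((posSemidef_iff_qf _).1 h).2 x
  rw [qf_sub] at this
  linarith

/-- A positive semidefinite matrix is a Gram matrix. -/
theorem exists_eq_transpose_mul_self {M : Matrix (Fin n) (Fin n) ℝ} (h : M.PosSemidef) :
    ∃ S : Matrix (Fin n) (Fin n) ℝ, M = Sᵀ * S := by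
  open scoped MatrixOrder in
  have h0 : 0 ≤ M := Matrix.nonneg_iff_posSemidef.2 h
  obtain ⟨b, hb⟩ := CStarAlgebra.nonneg_iff_eq_star_mul_self.1 h0
  exact ⟨b, by rw [hb, Matrix.star_eq_conjTranspose, Matrix.conjTranspose_eq_transpose_of_trivial]⟩

theorem trace_le_of_qf_le {M N : Matrix (Fin n) (Fin n) ℝ} (h : ∀ x, qf M x ≤ qf N x) :
    M.trace ≤ N.trace := by
  rw [trace_eq_sum_qf, trace_eq_sum_qf]
  exact Finset.sum_le_sum fun i _ => h _

theorem abs_trace_le_of_qf_le {M N : Matrix (Fin n) (Fin n) ℝ} (h : ∀ x, |qf M x| ≤ qf N x) :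
    |M.trace| ≤ N.trace := by
  rw [trace_eq_sum_qf, trace_eq_sum_qf]
  exact (Finset.abs_sum_le_sum_abs _ _).trans (Finset.sum_le_sum fun i _ => h _)

end MatrixNorms

/-! ### Calculus of matrix-valued maps -/

section MatrixCalculus

variable {l m n : ℕ}

theorem isBoundedBilinearMap_matMul :
    IsBoundedBilinearMap ℝ
      (fun p : Matrix (Fin l) (Fin m) ℝ × Matrix (Fin m) (Fin n) ℝ => p.1 * p.2) where
  add_left := fun _ _ _ => Matrix.add_mul _ _ _
  smul_left := fun _ _ _ => Matrix.smul_mul _ _ _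
  add_right := fun _ _ _ => Matrix.mul_add _ _ _
  smul_right := fun _ _ _ => Matrix.mul_smul _ _ _
  bound := ⟨1, one_pos, fun x y => by simpa using Matrix.frobenius_norm_mul x y⟩

variable {E : Type*} [NormedAddCommGroup E] [NormedSpace ℝ E]

theorem ContDiffAt.matMul {k : ℕ∞ω} {x : E} {f : E → Matrix (Fin l) (Fin m) ℝ}
    {g : E → Matrix (Fin m) (Fin n) ℝ} (hf : ContDiffAt ℝ k f x) (hg : ContDiffAt ℝ k g x) :
    ContDiffAt ℝ k (fun y => f y * g y) x :=
  isBoundedBilinearMap_matMul.contDiff.contDiffAt.comp x (hf.prodMk hg)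

theorem HasDerivAt.matMul {t : ℝ} {f : ℝ → Matrix (Fin l) (Fin m) ℝ}
    {g : ℝ → Matrix (Fin m) (Fin n) ℝ} {f' g'} (hf : HasDerivAt f f' t) (hg : HasDerivAt g g' t) :
    HasDerivAt (fun s => f s * g s) (f' * g t + f t * g') t := by
  have := (isBoundedBilinearMap_matMul.hasFDerivAt (f t, g t)).comp_hasDerivAt t
    (hf.prodMk hg)
  convert! this using 1
  simp [add_comm]

/-- Transposition as a continuous linear map. -/
noncomputable def transposeCLM (m n : ℕ) :
    Matrix (Fin m) (Fin n) ℝ →L[ℝ] Matrix (Fin n) (Fin m) ℝ :=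
  LinearMap.toContinuousLinearMap (Matrix.transposeLinearEquiv (Fin m) (Fin n) ℝ ℝ).toLinearMap

theorem ContDiffAt.matTranspose {k : ℕ∞ω} {x : E} {f : E → Matrix (Fin l) (Fin m) ℝ}
    (hf : ContDiffAt ℝ k f x) : ContDiffAt ℝ k (fun y => (f y)ᵀ) x :=
  (transposeCLM l m).contDiff.contDiffAt.comp x hf

theorem HasDerivAt.matTranspose {t : ℝ} {f : ℝ → Matrix (Fin l) (Fin m) ℝ} {f'}
    (hf : HasDerivAt f f' t) : HasDerivAt (fun s => (f s)ᵀ) f'ᵀ t :=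
  (transposeCLM l m).hasFDerivAt.comp_hasDerivAt t hf

/-- The trace as a continuous linear map. -/
noncomputable def traceCLM (n : ℕ) : Matrix (Fin n) (Fin n) ℝ →L[ℝ] ℝ :=
  LinearMap.toContinuousLinearMap (Matrix.traceLinearMap (Fin n) ℝ ℝ)

theorem traceCLM_apply (M : Matrix (Fin n) (Fin n) ℝ) : traceCLM n M = M.trace := rfl

theorem HasDerivAt.matTrace {t : ℝ} {f : ℝ → Matrix (Fin m) (Fin m) ℝ} {f'}
    (hf : HasDerivAt f f' t) : HasDerivAt (fun s => (f s).trace) f'.trace t :=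
  (traceCLM m).hasFDerivAt.comp_hasDerivAt t hf

theorem ContDiffAt.matTrace {k : ℕ∞ω} {x : E} {f : E → Matrix (Fin m) (Fin m) ℝ}
    (hf : ContDiffAt ℝ k f x) : ContDiffAt ℝ k (fun y => (f y).trace) x :=
  (traceCLM m).contDiff.contDiffAt.comp x hf

end MatrixCalculus

/-! ### Discrete Lyapunov equations -/

section Lyapunov

variable {n : ℕ}

/-- Schur stability: the powers tend to zero. -/
def Stable (W : Matrix (Fin n) (Fin n) ℝ) : Prop :=
  Tendsto (fun k : ℕ => W ^ k) atTop (𝓝 0)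

/-- Continuous linear endomorphisms, for the topology of the ambient norm. -/
abbrev NormedEnd (E : Type*) [NormedAddCommGroup E] [NormedSpace ℝ E] := E →L[ℝ] E

/-- The Lyapunov operator `X ↦ X - Wᵀ X W`. -/
noncomputable def lyapCLM (W : Matrix (Fin n) (Fin n) ℝ) : NormedEnd (Matrix (Fin n) (Fin n) ℝ) :=
  ContinuousLinearMap.id ℝ _ - ContinuousLinearMap.mulLeftRight ℝ (Matrix (Fin n) (Fin n) ℝ) Wᵀ W

theorem lyapCLM_apply (W X : Matrix (Fin n) (Fin n) ℝ) : lyapCLM W X = X - Wᵀ * X * W := rfl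

/-- The solution `X` of `X = Wᵀ X W + M` (for stable `W`). -/
noncomputable def dlyap (W M : Matrix (Fin n) (Fin n) ℝ) : Matrix (Fin n) (Fin n) ℝ :=
  (lyapCLM W).inverse M

/-- Substituting the equation into itself T times. For stable W the first term dies out, which
yields both uniqueness and the series for the solution. -/
theorem lyap_iterate {W X M : Matrix (Fin n) (Fin n) ℝ} (h : X = Wᵀ * X * W + M) (T : ℕ) :
    X = (W ^ T)ᵀ * X * W ^ T + ∑ k ∈ Finset.range T, (W ^ k)ᵀ * M * W ^ k := by
  induction T with
  | zero => simp
  | succ T ih =>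
    rw [Finset.sum_range_succ]
    conv_lhs => rw [ih]
    conv_lhs => enter [1, 1, 2]; rw [h]
    rw [pow_succ' W T, Matrix.transpose_mul]
    simp only [Matrix.mul_add, Matrix.add_mul, Matrix.mul_assoc]
    abel

theorem Stable.tendsto_conj {W : Matrix (Fin n) (Fin n) ℝ} (hW : Stable W)
    (X : Matrix (Fin n) (Fin n) ℝ) :
    Tendsto (fun k : ℕ => (W ^ k)ᵀ * X * W ^ k) atTop (𝓝 0) := by
  have hc : Continuous fun V : Matrix (Fin n) (Fin n) ℝ => Vᵀ * X * V := by fun_prop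
  simpa [Function.comp_def] using (hc.tendsto 0).comp hW

/-- A solution of the homogeneous equation satisfies X = (Wᵏ)ᵀ X Wᵏ for all k, hence X = 0; in
finite dimension injectivity suffices. -/
theorem Stable.isInvertible {W : Matrix (Fin n) (Fin n) ℝ} (hW : Stable W) :
    (lyapCLM W).IsInvertible := by
  have hinj : Function.Injective (lyapCLM W).toLinearMap := by
    rw [← LinearMap.ker_eq_bot, LinearMap.ker_eq_bot']
    intro X hX
    have hX' : X = Wᵀ * X * W + 0 := by
      have : X - Wᵀ * X * W = 0 := by rw [← lyapCLM_apply]; exact hX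
      rw [add_zero]; exact sub_eq_zero.1 this
    have h1 : ∀ k : ℕ, (W ^ k)ᵀ * X * W ^ k = X := fun k => by
      have := lyap_iterate hX' k
      simp only [Matrix.mul_zero, Matrix.zero_mul, Finset.sum_const_zero, add_zero] at this
      exact this.symm
    have h2 := hW.tendsto_conj X
    simp only [h1] at h2
    exact tendsto_nhds_unique tendsto_const_nhds h2
  let e := (LinearEquiv.ofInjectiveEndo (lyapCLM W).toLinearMap hinj).toContinuousLinearEquiv
  exact ⟨e, by ext1 X; rfl⟩

theorem dlyap_eq {W : Matrix (Fin n) (Fin n) ℝ} (hW : Stable W) (M : Matrix (Fin n) (Fin n) ℝ) :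
    dlyap W M = Wᵀ * dlyap W M * W + M := by
  have h : lyapCLM W (dlyap W M) = M := by
    obtain ⟨e, he⟩ := hW.isInvertible
    rw [dlyap, ← he, ContinuousLinearMap.inverse_equiv]
    simp
  rw [lyapCLM_apply] at h
  rw [← sub_eq_iff_eq_add']
  exact h

/-- Uniqueness. Identities between Lyapunov solutions are proved below by checking the equation and
appealing to this. -/
theorem eq_dlyap {W X M : Matrix (Fin n) (Fin n) ℝ} (hW : Stable W)
    (h : X = Wᵀ * X * W + M) : X = dlyap W M := by
  have h' : lyapCLM W X = M := by
    rw [lyapCLM_apply]; exact sub_eq_iff_eq_add'.2 h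
  obtain ⟨e, he⟩ := hW.isInvertible
  rw [dlyap, ← h', ← he, ContinuousLinearMap.inverse_equiv]
  simp

theorem dlyap_transpose {W M : Matrix (Fin n) (Fin n) ℝ} (hW : Stable W) (hM : Mᵀ = M) :
    (dlyap W M)ᵀ = dlyap W M := by
  refine eq_dlyap hW ?_
  conv_lhs => rw [dlyap_eq hW M]
  simp only [Matrix.transpose_add, Matrix.transpose_mul, Matrix.transpose_transpose, hM,
    Matrix.mul_assoc]

theorem dlyap_zero {W : Matrix (Fin n) (Fin n) ℝ} (hW : Stable W) : dlyap W 0 = 0 :=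
  (eq_dlyap hW (by simp)).symm

theorem hasSum_dlyap_tendsto {W : Matrix (Fin n) (Fin n) ℝ} (hW : Stable W)
    (M : Matrix (Fin n) (Fin n) ℝ) :
    Tendsto (fun T : ℕ => ∑ k ∈ Finset.range T, (W ^ k)ᵀ * M * W ^ k) atTop
      (𝓝 (dlyap W M)) := by
  have h : ∀ T : ℕ, ∑ k ∈ Finset.range T, (W ^ k)ᵀ * M * W ^ k
      = dlyap W M - (W ^ T)ᵀ * dlyap W M * W ^ T := fun T => by
    conv_rhs => enter [1]; rw [lyap_iterate (dlyap_eq hW M) T]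
    abel
  simp only [h]
  simpa using (tendsto_const_nhds (x := dlyap W M)).sub (hW.tendsto_conj (dlyap W M))

theorem continuous_qf (x : Fin n → ℝ) :
    Continuous fun M : Matrix (Fin n) (Fin n) ℝ => qf M x := by
  unfold qf
  exact continuous_const.dotProduct (continuous_id.matrix_mulVec continuous_const)

theorem continuous_qf_vec (M : Matrix (Fin n) (Fin n) ℝ) : Continuous (qf M) := by
  unfold qf
  exact continuous_id.dotProduct (continuous_const.matrix_mulVec continuous_id)

theorem qf_vec_zero (M : Matrix (Fin n) (Fin n) ℝ) : qf M 0 = 0 := by simp [qf]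

theorem Stable.tendsto_mulVec {W : Matrix (Fin n) (Fin n) ℝ} (hW : Stable W) (x : Fin n → ℝ) :
    Tendsto (fun k : ℕ => W ^ k *ᵥ x) atTop (𝓝 0) := by
  have hc : Continuous fun V : Matrix (Fin n) (Fin n) ℝ => V *ᵥ x :=
    continuous_id.matrix_mulVec continuous_const
  simpa [Function.comp_def] using (hc.tendsto 0).comp hW

/-- A form that does not increase along a stable recursion is nonnegative. -/
theorem qf_nonneg_of_le_comp {W Z : Matrix (Fin n) (Fin n) ℝ} (hW : Stable W)
    (h : ∀ x, qf Z (W *ᵥ x) ≤ qf Z x) (x : Fin n → ℝ) : 0 ≤ qf Z x := by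
  have h1 : ∀ k : ℕ, qf Z (W ^ k *ᵥ x) ≤ qf Z x := fun k => by
    induction k with
    | zero => simp
    | succ k ih =>
      rw [pow_succ', ← Matrix.mulVec_mulVec]
      exact (h _).trans ih
  have h2 := ((continuous_qf_vec Z).tendsto 0).comp (hW.tendsto_mulVec x)
  rw [qf_vec_zero] at h2
  exact le_of_tendsto h2 (Eventually.of_forall h1)

theorem qf_dlyap {W : Matrix (Fin n) (Fin n) ℝ} (hW : Stable W)
    (M : Matrix (Fin n) (Fin n) ℝ) (x : Fin n → ℝ) :
    qf (dlyap W M) x = qf (dlyap W M) (W *ᵥ x) + qf M x := by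
  conv_lhs => rw [dlyap_eq hW M, qf_add, qf_conj]

theorem qf_dlyap_nonneg {W M : Matrix (Fin n) (Fin n) ℝ} (hW : Stable W)
    (hM : ∀ x, 0 ≤ qf M x) (x : Fin n → ℝ) : 0 ≤ qf (dlyap W M) x :=
  qf_nonneg_of_le_comp hW (fun y => by rw [qf_dlyap hW M y]; linarith [hM y]) x

/-- Comparison of a Lyapunov solution with a Lyapunov function. -/
theorem abs_qf_dlyap_le {W M P : Matrix (Fin n) (Fin n) ℝ} (hW : Stable W) {b c : ℝ} (hc : 0 < c)
    (hP : ∀ x, c * (x ⬝ᵥ x) + qf P (W *ᵥ x) ≤ qf P x) (hb : 0 ≤ b)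
    (hM : ∀ x, |qf M x| ≤ b * (x ⬝ᵥ x)) (x : Fin n → ℝ) :
    |qf (dlyap W M) x| ≤ b / c * qf P x := by
  -- Both signs at once: along W the form (b/c) P drops by at least b |y|², which pays for the
  -- change ± qf M of the other summand.
  have key : ∀ s : ℝ, |s| ≤ 1 → ∀ y, 0 ≤ qf ((b / c) • P + s • dlyap W M) y := by
    intro s hs
    refine qf_nonneg_of_le_comp hW fun y => ?_
    rw [qf_add, qf_add, qf_smul, qf_smul, qf_smul, qf_smul, qf_dlyap hW M y]
    have h1 : b / c * (c * (y ⬝ᵥ y) + qf P (W *ᵥ y)) ≤ b / c * qf P y :=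
      mul_le_mul_of_nonneg_left (hP y) (by positivity)
    have h2 : b / c * (c * (y ⬝ᵥ y)) = b * (y ⬝ᵥ y) := by field_simp
    have h3 : |s * qf M y| ≤ b * (y ⬝ᵥ y) := by
      rw [abs_mul]
      calc |s| * |qf M y| ≤ 1 * (b * (y ⬝ᵥ y)) :=
            mul_le_mul hs (hM y) (abs_nonneg _) zero_le_one
        _ = _ := one_mul _
    have h4 := (abs_le.1 h3).1
    nlinarith
  have h1 := key 1 (by simp) x
  have h2 := key (-1) (by simp) x
  rw [qf_add, qf_smul, qf_smul] at h1 h2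
  rw [abs_le]
  constructor <;> linarith

theorem stable_of_tendsto_mulVec {W : Matrix (Fin n) (Fin n) ℝ}
    (h : ∀ x : Fin n → ℝ, Tendsto (fun k : ℕ => (W ^ k *ᵥ x) ⬝ᵥ (W ^ k *ᵥ x)) atTop (𝓝 0)) :
    Stable W := by
  refine tendsto_pi_nhds.2 fun i => tendsto_pi_nhds.2 fun j => ?_
  have h1 := h (Pi.single j 1)
  refine squeeze_zero_norm (a := fun k : ℕ =>
    √((W ^ k *ᵥ Pi.single j 1) ⬝ᵥ (W ^ k *ᵥ Pi.single j 1))) (fun k => ?_) ?_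
  · refine Real.le_sqrt_of_sq_le ?_
    have := Finset.single_le_sum (f := fun i => (W ^ k) i j * (W ^ k) i j)
      (fun i _ => mul_self_nonneg _) (Finset.mem_univ i)
    simpa [dotProduct, sq] using this
  · simpa [Function.comp_def] using (Real.continuous_sqrt.tendsto 0).comp h1

/-- Adding up the decrease along an orbit bounds c ∑ |Wᵏx|² by P(x), so the terms of the series tend
to zero. -/
theorem stable_of_lyapunov {W P : Matrix (Fin n) (Fin n) ℝ} {c : ℝ} (hc : 0 < c)
    (hP0 : ∀ x, 0 ≤ qf P x) (hP : ∀ x, c * (x ⬝ᵥ x) + qf P (W *ᵥ x) ≤ qf P x) : Stable W := by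
  refine stable_of_tendsto_mulVec fun x => ?_
  have hsum : ∀ T : ℕ, ∑ k ∈ Finset.range T, c * ((W ^ k *ᵥ x) ⬝ᵥ (W ^ k *ᵥ x))
      + qf P (W ^ T *ᵥ x) ≤ qf P x := fun T => by
    induction T with
    | zero => simp
    | succ T ih =>
      rw [Finset.sum_range_succ, pow_succ', ← Matrix.mulVec_mulVec]
      have := hP (W ^ T *ᵥ x)
      linarith
  have hs : Summable fun k : ℕ => c * ((W ^ k *ᵥ x) ⬝ᵥ (W ^ k *ᵥ x)) :=
    summable_of_sum_range_le (c := qf P x)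
      (fun k => mul_nonneg hc.le (dotProduct_self_nonneg' _))
      fun T => by linarith [hsum T, hP0 (W ^ T *ᵥ x)]
  have := hs.tendsto_atTop_zero.const_mul c⁻¹
  simpa [← mul_assoc, inv_mul_cancel₀ hc.ne'] using this

/-- A matrix one of whose powers is a strict contraction admits a quadratic Lyapunov function. -/
theorem exists_lyapunov_of_norm_pow_lt {W : Matrix (Fin n) (Fin n) ℝ} {k : ℕ} (h : ‖W ^ k‖ < 1) :
    ∃ (P : Matrix (Fin n) (Fin n) ℝ) (c : ℝ), 0 < c ∧ Pᵀ = P ∧ (∀ x, 0 ≤ qf P x) ∧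
      ∀ x, c * (x ⬝ᵥ x) + qf P (W *ᵥ x) ≤ qf P x := by
  have hq : ∀ (j : ℕ) (x : Fin n → ℝ), qf ((W ^ j)ᵀ * W ^ j) x = (W ^ j *ᵥ x) ⬝ᵥ (W ^ j *ᵥ x) := by
    intro j x
    have := qf_conj (W ^ j) 1 x
    rwa [Matrix.mul_one, qf_one] at this
  have hsum : ∀ (k : ℕ) (x : Fin n → ℝ), qf (∑ j ∈ Finset.range k, (W ^ j)ᵀ * W ^ j) x
      = ∑ j ∈ Finset.range k, (W ^ j *ᵥ x) ⬝ᵥ (W ^ j *ᵥ x) := by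
    intro k x
    induction k with
    | zero => simp [qf_zero]
    | succ k ih => rw [Finset.sum_range_succ, Finset.sum_range_succ, qf_add, ih, hq]
  -- This form telescopes along W: its value at Wx minus its value at x is |Wᵏx|² - |x|².
  refine ⟨∑ j ∈ Finset.range k, (W ^ j)ᵀ * W ^ j, 1 - ‖W ^ k‖ ^ 2, ?_, ?_, ?_, ?_⟩
  · have := norm_nonneg (W ^ k)
    nlinarith
  · simp [Matrix.transpose_sum]
  · intro x
    rw [hsum]
    exact Finset.sum_nonneg fun j _ => dotProduct_self_nonneg' _
  · intro x
    rw [hsum, hsum]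
    have h1 : ∀ j : ℕ, W ^ j *ᵥ (W *ᵥ x) = W ^ (j + 1) *ᵥ x := fun j => by
      rw [Matrix.mulVec_mulVec, pow_succ]
    simp only [h1]
    have h2 := Finset.sum_range_succ (fun j => (W ^ j *ᵥ x) ⬝ᵥ (W ^ j *ᵥ x)) k
    have h3 := Finset.sum_range_succ' (fun j => (W ^ j *ᵥ x) ⬝ᵥ (W ^ j *ᵥ x)) k
    rw [h2] at h3
    simp only [pow_zero, Matrix.one_mulVec] at h3
    have h4 := mulVec_dotProduct_self_le (W ^ k) x
    have h5 : opNorm (W ^ k) ^ 2 * (x ⬝ᵥ x) ≤ ‖W ^ k‖ ^ 2 * (x ⬝ᵥ x) :=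
      mul_le_mul_of_nonneg_right
        (pow_le_pow_left₀ (opNorm_nonneg _) (opNorm_le_norm _) 2) (dotProduct_self_nonneg' _)
    linarith

theorem stable_of_norm_pow_lt {W : Matrix (Fin n) (Fin n) ℝ} {k : ℕ} (h : ‖W ^ k‖ < 1) :
    Stable W := by
  obtain ⟨P, c, hc, -, h0, h1⟩ := exists_lyapunov_of_norm_pow_lt h
  exact stable_of_lyapunov hc h0 h1

theorem Stable.exists_norm_pow_lt {W : Matrix (Fin n) (Fin n) ℝ} (hW : Stable W) :
    ∃ k : ℕ, ‖W ^ k‖ < 1 := by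
  have h := hW.norm
  rw [norm_zero] at h
  exact (h.eventually (gt_mem_nhds one_pos)).exists

/-- Stability is witnessed by one power of norm below 1, which is an open condition. -/
theorem Stable.eventually {W : Matrix (Fin n) (Fin n) ℝ} (hW : Stable W) :
    ∀ᶠ V in 𝓝 W, Stable V := by
  obtain ⟨k, hk⟩ := hW.exists_norm_pow_lt
  have hc : Continuous fun V : Matrix (Fin n) (Fin n) ℝ => ‖V ^ k‖ := by fun_prop
  filter_upwards [hc.continuousAt.eventually (gt_mem_nhds hk)] with V hV
  exact stable_of_norm_pow_lt hV

variable {E : Type*} [NormedAddCommGroup E] [NormedSpace ℝ E]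

theorem ContDiffAt.clm_inverse_apply {F : Type*} [NormedAddCommGroup F] [NormedSpace ℝ F]
    [CompleteSpace F] {k : ℕ∞ω} {x : E} {L : E → NormedEnd F} {M : E → F}
    (hL : ContDiffAt ℝ k L x) (hM : ContDiffAt ℝ k M x) (hi : (L x).IsInvertible) :
    ContDiffAt ℝ k (fun y => (L y).inverse (M y)) x :=
  (hi.contDiffAt_map_inverse.comp x hL).clm_apply hM

theorem ContDiffAt.dlyap {k : ℕ∞ω} {x : E} {W M : E → Matrix (Fin n) (Fin n) ℝ}
    (hW : ContDiffAt ℝ k W x) (hM : ContDiffAt ℝ k M x) (hs : Stable (W x)) :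
    ContDiffAt ℝ k (fun y => dlyap (W y) (M y)) x := by
  have h1 : ContDiffAt ℝ k (fun y => lyapCLM (W y)) x := by
    unfold lyapCLM
    refine contDiffAt_const.sub ?_
    exact ((ContinuousLinearMap.contDiff _).contDiffAt.comp x hW.matTranspose).clm_apply hW
  exact h1.clm_inverse_apply hM hs.isInvertible

/-- Differentiability is known from invertibility of the Lyapunov operator. Differentiating the
equation, which holds near t, gives a Lyapunov equation for the derivative, and uniqueness
identifies it. -/
theorem hasDerivAt_dlyap {t : ℝ} {W M : ℝ → Matrix (Fin n) (Fin n) ℝ} {W' M'}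
    (hW : HasDerivAt W W' t) (hM : HasDerivAt M M' t) (hs : Stable (W t)) :
    HasDerivAt (fun s => dlyap (W s) (M s))
      (dlyap (W t) (W'ᵀ * dlyap (W t) (M t) * W t + (W t)ᵀ * dlyap (W t) (M t) * W' + M')) t := by
  have hdiff : DifferentiableAt ℝ (fun s => dlyap (W s) (M s)) t := by
    have h := ContDiffAt.dlyap (k := 1) (x := (W t, M t))
      (contDiffAt_fst (E := Matrix (Fin n) (Fin n) ℝ) (F := Matrix (Fin n) (Fin n) ℝ) (𝕜 := ℝ))
      contDiffAt_snd hs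
    exact (h.differentiableAt one_ne_zero).comp t
      (hW.differentiableAt.prodMk hM.differentiableAt)
  obtain ⟨X', hX⟩ : ∃ X', HasDerivAt (fun s => dlyap (W s) (M s)) X' t := ⟨_, hdiff.hasDerivAt⟩
  have hev : ∀ᶠ s in 𝓝 t, dlyap (W s) (M s) = (W s)ᵀ * dlyap (W s) (M s) * W s + M s := by
    filter_upwards [hW.continuousAt.eventually hs.eventually] with s h
    exact dlyap_eq h _
  have h2 := (((hW.matTranspose.matMul hX).matMul hW).add hM).congr_of_eventuallyEq hev
  have h3 := hX.unique h2
  rw [← eq_dlyap hs (X := X')]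
  · exact hX
  · conv_lhs => rw [h3]
    simp only [Matrix.add_mul]
    abel

end Lyapunov

/-! ### The cost of a linear controller -/

section Cost

variable {dx du : ℕ}

/-- The closed-loop matrix `A + B K`. -/
def closedLoop (θ : LinSystem dx du) (K : Controller dx du) : Matrix (Fin dx) (Fin dx) ℝ :=
  LinSystem.A θ + LinSystem.B θ * K

/-- The matrix of the stage cost under the feedback `u = K x`. -/
def costMatrix (Rx : Matrix (Fin dx) (Fin dx) ℝ) (Ru : Matrix (Fin du) (Fin du) ℝ)
    (K : Controller dx du) : Matrix (Fin dx) (Fin dx) ℝ :=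
  Rx + Kᵀ * Ru * K

theorem qf_costMatrix (Rx : Matrix (Fin dx) (Fin dx) ℝ) (Ru : Matrix (Fin du) (Fin du) ℝ)
    (K : Controller dx du) (x : Fin dx → ℝ) :
    qf (costMatrix Rx Ru K) x = qf Rx x + qf Ru (K *ᵥ x) := by
  rw [costMatrix, qf_add, qf_conj]

theorem dotProduct_self_le_qf {n : ℕ} {M : Matrix (Fin n) (Fin n) ℝ} (h : (M - 1).PosSemidef)
    (x : Fin n → ℝ) : x ⬝ᵥ x ≤ qf M x := by
  have := qf_le_of_posSemidef_sub h x
  rwa [qf_one] at this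

theorem transpose_eq_of_posSemidef_sub_one {n : ℕ} {M : Matrix (Fin n) (Fin n) ℝ}
    (h : (M - 1).PosSemidef) : Mᵀ = M := by
  have := ((posSemidef_iff_qf _).1 h).1
  rwa [Matrix.transpose_sub, Matrix.transpose_one, sub_left_inj] at this

theorem costMatrix_transpose {Rx : Matrix (Fin dx) (Fin dx) ℝ} {Ru : Matrix (Fin du) (Fin du) ℝ}
    (hRx : Rxᵀ = Rx) (hRu : Ruᵀ = Ru) (K : Controller dx du) :
    (costMatrix Rx Ru K)ᵀ = costMatrix Rx Ru K := by
  simp [costMatrix, Matrix.transpose_mul, hRx, hRu, Matrix.mul_assoc]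

theorem lqrState_succ (θ : LinSystem dx du) (K : Controller dx du) (w : ℕ → Fin dx → ℝ) (t : ℕ) :
    lqrState θ K w (t + 1) = closedLoop θ K *ᵥ lqrState θ K w t + w t := by
  rw [lqrState, closedLoop, Matrix.add_mulVec, Matrix.mulVec_mulVec]

/-! ### Second moments of the noise and of the state -/

instance isProbabilityMeasure_noiseLaw (σ : ℝ≥0) : IsProbabilityMeasure (noiseLaw dx σ) := by
  unfold noiseLaw
  infer_instance

theorem measurable_noise (t : ℕ) (i : Fin dx) :
    Measurable fun w : ℕ → Fin dx → ℝ => w t i :=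
  (measurable_pi_apply i).comp (measurable_pi_apply t)

theorem integrable_mul_of_memLp {Ω : Type*} [MeasurableSpace Ω] {μ : Measure Ω} {f g : Ω → ℝ}
    (hf : MemLp f 2 μ) (hg : MemLp g 2 μ) : Integrable (fun a => f a * g a) μ :=
  hf.integrable_mul hg

theorem noiseLaw_map_eval (σ : ℝ≥0) (t : ℕ) (i : Fin dx) :
    (noiseLaw dx σ).map (fun w => w t i) = gaussianReal 0 (σ ^ 2) := by
  have h1 : (noiseLaw dx σ).map (fun w => w t) = Measure.pi fun _ => gaussianReal 0 (σ ^ 2) :=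
    Measure.infinitePi_map_eval _ t
  have h2 := (measurePreserving_eval (fun _ : Fin dx => gaussianReal 0 (σ ^ 2)) i).map_eq
  have h3 := Measure.map_map (μ := noiseLaw dx σ) (f := fun w => w t)
    (g := fun v : Fin dx → ℝ => v i) (by fun_prop) (by fun_prop)
  rw [h1] at h3
  exact h3.symm.trans h2

theorem noise_memLp (σ : ℝ≥0) (t : ℕ) (i : Fin dx) :
    MemLp (fun w : ℕ → Fin dx → ℝ => w t i) 2 (noiseLaw dx σ) := by
  have h := memLp_id_gaussianReal' (μ := 0) (v := σ ^ 2) 2 (by simp)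
  rw [← noiseLaw_map_eval σ t i, memLp_map_measure_iff (by fun_prop) (measurable_noise t i).aemeasurable] at h
  exact h

theorem noise_integral (σ : ℝ≥0) (t : ℕ) (i : Fin dx) :
    ∫ w, w t i ∂(noiseLaw dx σ) = 0 := by
  have h := integral_id_gaussianReal (μ := 0) (v := σ ^ 2)
  rw [← noiseLaw_map_eval σ t i, integral_map (measurable_noise t i).aemeasurable (by fun_prop)] at h
  exact h

theorem noise_integral_sq (σ : ℝ≥0) (t : ℕ) (i : Fin dx) :
    ∫ w, w t i * w t i ∂(noiseLaw dx σ) = (σ : ℝ) ^ 2 := by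
  have h := variance_id_gaussianReal (μ := 0) (v := σ ^ 2)
  rw [variance_of_integral_eq_zero aemeasurable_id
      (by simp [integral_id_gaussianReal]),
    ← noiseLaw_map_eval σ t i, integral_map (measurable_noise t i).aemeasurable (by fun_prop)] at h
  simpa [sq] using h

theorem noise_indepFun (σ : ℝ≥0) {s t : ℕ} {i j : Fin dx} (h : (s, i) ≠ (t, j)) :
    IndepFun (fun w : ℕ → Fin dx → ℝ => w s i) (fun w => w t j) (noiseLaw dx σ) := by
  by_cases hst : s = t
  · subst hst
    have hij : i ≠ j := fun hij => h (by rw [hij])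
    have h1 : (noiseLaw dx σ).map (fun w => w s) = Measure.pi fun _ => gaussianReal 0 (σ ^ 2) :=
      Measure.infinitePi_map_eval _ s
    have h2 : IndepFun (fun v : Fin dx → ℝ => v i) (fun v => v j)
        (Measure.pi fun _ => gaussianReal 0 (σ ^ 2)) :=
      (iIndepFun_pi (μ := fun _ : Fin dx => gaussianReal 0 (σ ^ 2)) (X := fun _ x => x)
        (fun _ => by fun_prop)).indepFun hij
    have hm : ∀ i : Fin dx, Measurable fun v : Fin dx → ℝ => v i := measurable_pi_apply
    have hs : Measurable fun w : ℕ → Fin dx → ℝ => w s := measurable_pi_apply s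
    rw [← h1, indepFun_iff_map_prod_eq_prod_map_map (hm i).aemeasurable (hm j).aemeasurable,
      Measure.map_map ((hm i).prodMk (hm j)) hs, Measure.map_map (hm i) hs,
      Measure.map_map (hm j) hs] at h2
    rw [indepFun_iff_map_prod_eq_prod_map_map (measurable_noise s i).aemeasurable
      (measurable_noise s j).aemeasurable]
    exact h2
  · have h1 : IndepFun (fun w : ℕ → Fin dx → ℝ => w s) (fun w => w t) (noiseLaw dx σ) :=
      (iIndepFun_infinitePi (P := fun _ : ℕ => Measure.pi fun _ : Fin dx => gaussianReal 0 (σ ^ 2))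
        (X := fun _ x => x) (fun _ => by fun_prop)).indepFun hst
    exact h1.comp (φ := fun v : Fin dx → ℝ => v i) (ψ := fun v : Fin dx → ℝ => v j)
      (measurable_pi_apply i) (measurable_pi_apply j)

theorem noise_integral_mul (σ : ℝ≥0) (s t : ℕ) (i j : Fin dx) :
    ∫ w, w s i * w t j ∂(noiseLaw dx σ) = if (s, i) = (t, j) then (σ : ℝ) ^ 2 else 0 := by
  split_ifs with h
  · obtain ⟨rfl, rfl⟩ := Prod.ext_iff.1 h
    exact noise_integral_sq σ s i
  · rw [(noise_indepFun σ h).integral_fun_mul_eq_mul_integral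
      (measurable_noise s i).aestronglyMeasurable (measurable_noise t j).aestronglyMeasurable,
      noise_integral, zero_mul]

theorem state_memLp (σ : ℝ≥0) (θ : LinSystem dx du) (K : Controller dx du) (t : ℕ) (i : Fin dx) :
    MemLp (fun w => lqrState θ K w t i) 2 (noiseLaw dx σ) := by
  induction t generalizing i with
  | zero => simp [lqrState]
  | succ t ih =>
    simp only [lqrState_succ, Pi.add_apply, Matrix.mulVec, dotProduct]
    refine MemLp.add (memLp_finsetSum _ fun j _ => (ih j).const_mul _) (noise_memLp σ t i)

/-- The state at time t is a linear function of the noise before time t, so it is uncorrelated with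
centred noise at any time s ≥ t. -/
theorem state_noise_integral (σ : ℝ≥0) (θ : LinSystem dx du) (K : Controller dx du) (s t : ℕ)
    (hst : t ≤ s) (i j : Fin dx) :
    ∫ w, lqrState θ K w t i * w s j ∂(noiseLaw dx σ) = 0 := by
  induction t generalizing i with
  | zero => simp [lqrState]
  | succ t ih =>
    simp only [lqrState_succ, Pi.add_apply, Matrix.mulVec, dotProduct, add_mul, Finset.sum_mul,
      mul_assoc]
    have hInt : ∀ k, Integrable (fun w => closedLoop θ K i k * (lqrState θ K w t k * w s j))
        (noiseLaw dx σ) := fun k =>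
      (integrable_mul_of_memLp (state_memLp σ θ K t k) (noise_memLp σ s j)).const_mul _
    rw [integral_add (integrable_finsetSum _ fun k _ => hInt k)
      (integrable_mul_of_memLp (noise_memLp σ t i) (noise_memLp σ s j)),
      integral_finsetSum _ fun k _ => hInt k, noise_integral_mul, if_neg]
    · simp only [integral_const_mul, ih (by lia), mul_zero, Finset.sum_const_zero, add_zero]
    · intro h
      have := (Prod.ext_iff.1 h).1
      simp only at this
      lia

/-- The recursion Σ ↦ W Σ Wᵀ + σ² I, started at 0; the mixed terms vanish by `state_noise_integral`.
-/
theorem state_covariance (σ : ℝ≥0) (θ : LinSystem dx du) (K : Controller dx du) (t : ℕ)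
    (i j : Fin dx) :
    ∫ w, lqrState θ K w t i * lqrState θ K w t j ∂(noiseLaw dx σ)
      = (σ : ℝ) ^ 2 * (∑ k ∈ Finset.range t,
          closedLoop θ K ^ k * (closedLoop θ K ^ k)ᵀ : Matrix (Fin dx) (Fin dx) ℝ) i j := by
  induction t generalizing i j with
  | zero => simp [lqrState]
  | succ t ih =>
    set W := closedLoop θ K with hW
    set μ := noiseLaw dx σ
    have hx := state_memLp σ θ K t
    have hw := noise_memLp (dx := dx) σ t
    have hy : ∀ a, MemLp (fun w => (W *ᵥ lqrState θ K w t) a) 2 μ := fun a => by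
      simp only [Matrix.mulVec, dotProduct]
      exact memLp_finsetSum _ fun j _ => (hx j).const_mul _
    have hyw : ∀ a b, ∫ w, (W *ᵥ lqrState θ K w t) a * w t b ∂μ = 0 := fun a b => by
      simp only [Matrix.mulVec, dotProduct, Finset.sum_mul, mul_assoc]
      rw [integral_finsetSum _ fun k _ => (integrable_mul_of_memLp (hx k) (hw b)).const_mul _]
      simp only [integral_const_mul]
      exact Finset.sum_eq_zero fun k _ => by
        rw [state_noise_integral σ θ K t t le_rfl, mul_zero]
    have hyy : ∫ w, (W *ᵥ lqrState θ K w t) i * (W *ᵥ lqrState θ K w t) j ∂μ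
        = (σ : ℝ) ^ 2 * (W * (∑ k ∈ Finset.range t, W ^ k * (W ^ k)ᵀ) * Wᵀ) i j := by
      have hS : ∀ S : Matrix (Fin dx) (Fin dx) ℝ, (W * S * Wᵀ) i j
          = ∑ a, ∑ b, W i b * S b a * W j a := fun S => by
        simp [Matrix.mul_apply, Finset.sum_mul]
      have hxx : ∀ w, (W *ᵥ lqrState θ K w t) i * (W *ᵥ lqrState θ K w t) j
          = ∑ a, ∑ b, W i b * W j a * (lqrState θ K w t b * lqrState θ K w t a) := fun w => by
        simp only [Matrix.mulVec, dotProduct, Finset.sum_mul, Finset.mul_sum]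
        exact Finset.sum_congr rfl fun a _ => Finset.sum_congr rfl fun b _ => by ring
      have hInt : ∀ a b, Integrable
          (fun w => W i b * W j a * (lqrState θ K w t b * lqrState θ K w t a)) μ :=
        fun a b => (integrable_mul_of_memLp (hx b) (hx a)).const_mul _
      rw [hS]
      simp only [hxx]
      rw [integral_finsetSum _ fun a _ => integrable_finsetSum _ fun b _ => hInt a b,
        Finset.mul_sum]
      refine Finset.sum_congr rfl fun a _ => ?_
      rw [integral_finsetSum _ fun b _ => hInt a b, Finset.mul_sum]
      refine Finset.sum_congr rfl fun b _ => ?_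
      rw [integral_const_mul, ih]
      ring
    simp only [lqrState_succ, Pi.add_apply, ← hW]
    have hexp : ∀ w : ℕ → Fin dx → ℝ,
        ((W *ᵥ lqrState θ K w t) i + w t i) * ((W *ᵥ lqrState θ K w t) j + w t j)
        = ((W *ᵥ lqrState θ K w t) i * (W *ᵥ lqrState θ K w t) j
          + (W *ᵥ lqrState θ K w t) i * w t j)
          + ((W *ᵥ lqrState θ K w t) j * w t i + w t i * w t j) := fun w => by ring
    simp only [hexp]
    have h1 : Integrable (fun w => (W *ᵥ lqrState θ K w t) i * (W *ᵥ lqrState θ K w t) j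
        + (W *ᵥ lqrState θ K w t) i * w t j) μ :=
      (integrable_mul_of_memLp (hy i) (hy j)).add (integrable_mul_of_memLp (hy i) (hw j))
    have h2 : Integrable (fun w => (W *ᵥ lqrState θ K w t) j * w t i + w t i * w t j) μ :=
      (integrable_mul_of_memLp (hy j) (hw i)).add (integrable_mul_of_memLp (hw i) (hw j))
    rw [integral_add h1 h2,
      integral_add (integrable_mul_of_memLp (hy i) (hy j)) (integrable_mul_of_memLp (hy i) (hw j)),
      integral_add (integrable_mul_of_memLp (hy j) (hw i)) (integrable_mul_of_memLp (hw i) (hw j)),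
      hyw, hyw, hyy, noise_integral_mul, Finset.sum_range_succ']
    have hconj : W * (∑ k ∈ Finset.range t, W ^ k * (W ^ k)ᵀ) * Wᵀ
        = ∑ k ∈ Finset.range t, W ^ (k + 1) * (W ^ (k + 1))ᵀ := by
      rw [Finset.mul_sum, Finset.sum_mul]
      refine Finset.sum_congr rfl fun k _ => ?_
      rw [pow_succ', Matrix.transpose_mul]
      simp only [Matrix.mul_assoc]
    rw [hconj, Matrix.add_apply, mul_add]
    simp [Matrix.one_apply]

theorem integrable_qf_state (σ : ℝ≥0) (θ : LinSystem dx du) (K : Controller dx du)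
    (Q : Matrix (Fin dx) (Fin dx) ℝ) (t : ℕ) :
    Integrable (fun w => qf Q (lqrState θ K w t)) (noiseLaw dx σ) := by
  have hx := state_memLp σ θ K t
  simp only [qf, Matrix.mulVec, dotProduct]
  exact integrable_finsetSum _ fun i _ =>
    integrable_mul_of_memLp (hx i) (memLp_finsetSum _ fun j _ => (hx j).const_mul _)

theorem integral_qf_state (σ : ℝ≥0) (θ : LinSystem dx du) (K : Controller dx du)
    (Q : Matrix (Fin dx) (Fin dx) ℝ) (t : ℕ) :
    ∫ w, qf Q (lqrState θ K w t) ∂(noiseLaw dx σ)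
      = (σ : ℝ) ^ 2 * ∑ k ∈ Finset.range t,
          ((closedLoop θ K ^ k)ᵀ * Q * closedLoop θ K ^ k).trace := by
  have hx := state_memLp σ θ K t
  have h1 : ∀ w, qf Q (lqrState θ K w t)
      = ∑ i, ∑ j, Q i j * (lqrState θ K w t j * lqrState θ K w t i) := fun w => by
    simp only [qf, Matrix.mulVec, dotProduct, Finset.mul_sum]
    exact Finset.sum_congr rfl fun i _ => Finset.sum_congr rfl fun j _ => by ring
  simp only [h1]
  have hInt : ∀ i j, Integrable
      (fun w => Q i j * (lqrState θ K w t j * lqrState θ K w t i)) (noiseLaw dx σ) :=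
    fun i j => (integrable_mul_of_memLp (hx j) (hx i)).const_mul _
  rw [integral_finsetSum _ fun i _ => integrable_finsetSum _ fun j _ => hInt i j]
  have h2 : ∀ i, ∫ w, ∑ j, Q i j * (lqrState θ K w t j * lqrState θ K w t i) ∂(noiseLaw dx σ)
      = ∑ j, Q i j * ((σ : ℝ) ^ 2 * (∑ k ∈ Finset.range t,
          closedLoop θ K ^ k * (closedLoop θ K ^ k)ᵀ : Matrix (Fin dx) (Fin dx) ℝ) j i) := by
    intro i
    rw [integral_finsetSum _ fun j _ => hInt i j]
    simp only [integral_const_mul, state_covariance]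
  simp only [h2]
  have h3 : ∀ V : Matrix (Fin dx) (Fin dx) ℝ, (Vᵀ * Q * V).trace = (Q * (V * Vᵀ)).trace :=
    fun V => by rw [Matrix.mul_assoc, Matrix.trace_mul_comm, Matrix.mul_assoc]
  simp only [h3, ← Matrix.trace_sum, ← Finset.mul_sum]
  simp only [Matrix.trace, Matrix.diag, Matrix.mul_apply (M := Q), Finset.mul_sum]
  exact Finset.sum_congr rfl fun i _ => Finset.sum_congr rfl fun j _ => by ring

theorem stageCost_eq_qf (Rx : Matrix (Fin dx) (Fin dx) ℝ) (Ru : Matrix (Fin du) (Fin du) ℝ)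
    (K : Controller dx du) (x : Fin dx → ℝ) :
    stageCost Rx Ru x (K *ᵥ x) = qf (costMatrix Rx Ru K) x := by
  rw [qf_costMatrix]; rfl

/-- The expected stage cost (for unit noise) after `t` steps. -/
noncomputable def meanCost (W Q : Matrix (Fin dx) (Fin dx) ℝ) (t : ℕ) : ℝ :=
  ∑ k ∈ Finset.range t, ((W ^ k)ᵀ * Q * W ^ k).trace

theorem trace_conj_nonneg {W Q : Matrix (Fin dx) (Fin dx) ℝ} (hQ : ∀ x, 0 ≤ qf Q x) :
    0 ≤ (Wᵀ * Q * W).trace := by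
  rw [trace_eq_sum_qf]
  exact Finset.sum_nonneg fun i _ => by rw [qf_conj]; exact hQ _

theorem lintegral_average_cost (σ : ℝ≥0) {Rx : Matrix (Fin dx) (Fin dx) ℝ}
    {Ru : Matrix (Fin du) (Fin du) ℝ} (θ : LinSystem dx du) (K : Controller dx du)
    (hQ : ∀ x, 0 ≤ qf (costMatrix Rx Ru K) x) (T : ℕ) :
    ∫⁻ w, ENNReal.ofReal ((1 / (T : ℝ)) * ∑ t ∈ Finset.Icc 1 T,
        stageCost Rx Ru (lqrState θ K w t) (K *ᵥ lqrState θ K w t)) ∂(noiseLaw dx σ)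
      = ENNReal.ofReal ((σ : ℝ) ^ 2 * ((T : ℝ)⁻¹ * ∑ t ∈ Finset.range T,
          meanCost (closedLoop θ K) (costMatrix Rx Ru K) (t + 1))) := by
  simp only [stageCost_eq_qf]
  have hInt := fun t => integrable_qf_state σ θ K (costMatrix Rx Ru K) t
  rw [← ofReal_integral_eq_lintegral_ofReal
    ((integrable_finsetSum _ fun t _ => hInt t).const_mul _)]
  · congr 1
    rw [integral_const_mul, integral_finsetSum _ fun t _ => hInt t]
    simp only [integral_qf_state]
    -- The cost is averaged over t = 1, …, T; the shift to 0, …, T - 1 puts the sum in the form of a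
    -- Cesàro mean.
    rw [← Finset.mul_sum, Finset.range_eq_Ico, Finset.sum_Ico_add' _ 0 T 1]
    simp only [meanCost, one_div, zero_add]
    rw [← Finset.Ico_add_one_right_eq_Icc]
    ring
  · refine Eventually.of_forall fun w => ?_
    exact mul_nonneg (by positivity) (Finset.sum_nonneg fun t _ => hQ _)

theorem qf_costMatrix_ge {Rx : Matrix (Fin dx) (Fin dx) ℝ} {Ru : Matrix (Fin du) (Fin du) ℝ}
    (hRx : (Rx - 1).PosSemidef) (hRu : (Ru - 1).PosSemidef) (K : Controller dx du)
    (x : Fin dx → ℝ) : x ⬝ᵥ x ≤ qf (costMatrix Rx Ru K) x := by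
  rw [qf_costMatrix]
  have h1 := dotProduct_self_le_qf hRx x
  have h2 := dotProduct_self_le_qf hRu (K *ᵥ x)
  have h3 := dotProduct_self_nonneg' (K *ᵥ x)
  linarith

/-- The expected stage costs are partial sums of the Lyapunov series, so they converge, and their
Cesàro means have the same limit. -/
theorem lqrCost_of_stable {σ : ℝ≥0} {Rx : Matrix (Fin dx) (Fin dx) ℝ}
    {Ru : Matrix (Fin du) (Fin du) ℝ} (hRx : (Rx - 1).PosSemidef) (hRu : (Ru - 1).PosSemidef)
    {θ : LinSystem dx du} {K : Controller dx du} (h : Stable (closedLoop θ K)) :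
    lqrCost σ Rx Ru θ K = ENNReal.ofReal
      ((σ : ℝ) ^ 2 * (dlyap (closedLoop θ K) (costMatrix Rx Ru K)).trace) := by
  have hQ : ∀ x, 0 ≤ qf (costMatrix Rx Ru K) x := fun x =>
    (dotProduct_self_nonneg' x).trans (qf_costMatrix_ge hRx hRu K x)
  unfold lqrCost
  refine Tendsto.limUnder_eq ?_
  simp only [lintegral_average_cost σ θ K hQ]
  refine (ENNReal.continuous_ofReal.tendsto _).comp (Tendsto.const_mul _ ?_)
  refine Tendsto.cesaro (u := fun t =>
    meanCost (closedLoop θ K) (costMatrix Rx Ru K) (t + 1)) ?_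
  rw [tendsto_add_atTop_iff_nat (f := meanCost (closedLoop θ K) (costMatrix Rx Ru K)) 1]
  have := ((traceCLM dx).continuous.tendsto _).comp
    (hasSum_dlyap_tendsto h (costMatrix Rx Ru K))
  simp only [Function.comp_def, map_sum, traceCLM_apply] at this
  exact this

/-- Since Q ⪰ I, the k-th term is at least the squared Frobenius norm of Wᵏ; summability would force
Wᵏ → 0. -/
theorem not_summable_of_not_stable {W Q : Matrix (Fin dx) (Fin dx) ℝ}
    (hQ : ∀ x, x ⬝ᵥ x ≤ qf Q x) (h : ¬ Stable W) :
    ¬ Summable fun k : ℕ => ((W ^ k)ᵀ * Q * W ^ k).trace := by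
  intro hs
  refine h (stable_of_tendsto_mulVec fun x => ?_)
  have h0 := hs.tendsto_atTop_zero
  refine squeeze_zero (fun k => dotProduct_self_nonneg' _) (fun k => ?_)
    (by rw [← zero_mul (x ⬝ᵥ x)]; exact h0.mul_const (x ⬝ᵥ x))
  calc (W ^ k *ᵥ x) ⬝ᵥ (W ^ k *ᵥ x) ≤ opNorm (W ^ k) ^ 2 * (x ⬝ᵥ x) :=
        mulVec_dotProduct_self_le _ _
    _ ≤ ‖W ^ k‖ ^ 2 * (x ⬝ᵥ x) := mul_le_mul_of_nonneg_right
        (pow_le_pow_left₀ (opNorm_nonneg _) (opNorm_le_norm _) 2) (dotProduct_self_nonneg' _)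
    _ ≤ ((W ^ k)ᵀ * Q * W ^ k).trace * (x ⬝ᵥ x) := by
        refine mul_le_mul_of_nonneg_right ?_ (dotProduct_self_nonneg' _)
        rw [frobenius_sq_eq_trace]
        refine trace_le_of_qf_le fun y => ?_
        rw [qf_conj]
        refine le_trans (le_of_eq ?_) (hQ _)
        have := qf_conj (W ^ k) 1 y
        rwa [Matrix.mul_one, qf_one] at this

theorem tendsto_cesaro_atTop {u : ℕ → ℝ} (hu : Tendsto u atTop atTop) (h0 : ∀ t, 0 ≤ u t) :
    Tendsto (fun T : ℕ => (T : ℝ)⁻¹ * ∑ t ∈ Finset.range T, u t) atTop atTop := by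
  refine tendsto_atTop.2 fun b => ?_
  -- Beyond N the terms exceed 2|b|, and for T > 2N more than half of the indices lie beyond N.
  obtain ⟨N, hN⟩ := eventually_atTop.1 (tendsto_atTop.1 hu (2 * |b|))
  filter_upwards [eventually_ge_atTop (2 * N + 1)] with T hT
  have hT0 : (0 : ℝ) < T := by exact_mod_cast (by lia : 0 < T)
  rw [← div_eq_inv_mul, le_div_iff₀ hT0]
  have h1 : ∑ t ∈ Finset.Ico N T, u t ≤ ∑ t ∈ Finset.range T, u t :=
    Finset.sum_le_sum_of_subset_of_nonneg (fun t ht => by simp at ht ⊢; lia) fun t _ _ => h0 t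
  have h2 : ∑ t ∈ Finset.Ico N T, 2 * |b| ≤ ∑ t ∈ Finset.Ico N T, u t :=
    Finset.sum_le_sum fun t ht => hN t (Finset.mem_Ico.1 ht).1
  rw [Finset.sum_const, Nat.card_Ico, nsmul_eq_mul, Nat.cast_sub (by lia)] at h2
  have h3 : (2 * N + 1 : ℝ) ≤ T := by exact_mod_cast hT
  have h4 := le_abs_self b
  have h5 := abs_nonneg b
  nlinarith

/-- The expected stage costs are partial sums of a divergent nonnegative series; they and their
averages tend to infinity. -/
theorem lqrCost_of_not_stable {σ : ℝ≥0} (hσ : 0 < σ) {Rx : Matrix (Fin dx) (Fin dx) ℝ}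
    {Ru : Matrix (Fin du) (Fin du) ℝ} (hRx : (Rx - 1).PosSemidef) (hRu : (Ru - 1).PosSemidef)
    {θ : LinSystem dx du} {K : Controller dx du} (h : ¬ Stable (closedLoop θ K)) :
    lqrCost σ Rx Ru θ K = (⊤ : ℝ≥0∞) := by
  have hQ1 := qf_costMatrix_ge hRx hRu K
  have hQ : ∀ x, 0 ≤ qf (costMatrix Rx Ru K) x := fun x =>
    (dotProduct_self_nonneg' x).trans (hQ1 x)
  unfold lqrCost
  refine Tendsto.limUnder_eq ?_
  simp only [lintegral_average_cost σ θ K hQ]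
  refine ENNReal.tendsto_ofReal_atTop.comp ?_
  refine Tendsto.const_mul_atTop (by positivity) (tendsto_cesaro_atTop ?_ fun t =>
    Finset.sum_nonneg fun k _ => trace_conj_nonneg hQ)
  have h1 := (not_summable_iff_tendsto_nat_atTop_of_nonneg fun k => trace_conj_nonneg hQ).1
    (not_summable_of_not_stable hQ1 h)
  exact (tendsto_add_atTop_iff_nat (f := meanCost (closedLoop θ K) (costMatrix Rx Ru K)) 1).2 h1

end Cost

/-! ### Riccati equation and optimality -/

section Riccati

variable {dx du : ℕ}

/-- The curvature `Ru + Bᵀ P B` of the one-step problem. -/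
def inputGram (Ru : Matrix (Fin du) (Fin du) ℝ) (θ : LinSystem dx du)
    (P : Matrix (Fin dx) (Fin dx) ℝ) : Matrix (Fin du) (Fin du) ℝ :=
  Ru + (LinSystem.B θ)ᵀ * P * LinSystem.B θ

/-- A controller `K` together with its value matrix `P` satisfying the optimality equations. -/
structure RiccatiPair (Rx : Matrix (Fin dx) (Fin dx) ℝ) (Ru : Matrix (Fin du) (Fin du) ℝ)
    (θ : LinSystem dx du) (K : Controller dx du) (P : Matrix (Fin dx) (Fin dx) ℝ) : Prop where
  symm : Pᵀ = P
  nonneg : ∀ x, 0 ≤ qf P x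
  lyap : P = (closedLoop θ K)ᵀ * P * closedLoop θ K + costMatrix Rx Ru K
  stationary : Ru * K + (LinSystem.B θ)ᵀ * P * closedLoop θ K = 0

theorem qf_inputGram_ge {Ru : Matrix (Fin du) (Fin du) ℝ} (hRu : (Ru - 1).PosSemidef)
    {θ : LinSystem dx du} {P : Matrix (Fin dx) (Fin dx) ℝ} (hP : ∀ x, 0 ≤ qf P x)
    (u : Fin du → ℝ) : u ⬝ᵥ u ≤ qf (inputGram Ru θ P) u := by
  rw [inputGram, qf_add, qf_conj]
  linarith [dotProduct_self_le_qf hRu u, hP (LinSystem.B θ *ᵥ u)]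

theorem isUnit_of_qf_ge {n : ℕ} {M : Matrix (Fin n) (Fin n) ℝ} (h : ∀ x, x ⬝ᵥ x ≤ qf M x) :
    IsUnit M := by
  rw [← Matrix.mulVec_injective_iff_isUnit]
  intro x y hxy
  have h0 : M *ᵥ (x - y) = 0 := by rw [Matrix.mulVec_sub, hxy, sub_self]
  have h1 := h (x - y)
  rw [qf, h0, dotProduct_zero] at h1
  have h2 := dotProduct_self_eq_zero.1 (le_antisymm h1 (dotProduct_self_nonneg' _))
  exact sub_eq_zero.1 h2

theorem inputGram_transpose {Ru : Matrix (Fin du) (Fin du) ℝ} (hRu : Ruᵀ = Ru)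
    {θ : LinSystem dx du} {P : Matrix (Fin dx) (Fin dx) ℝ} (hP : Pᵀ = P) :
    (inputGram Ru θ P)ᵀ = inputGram Ru θ P := by
  simp [inputGram, Matrix.transpose_mul, hRu, hP, Matrix.mul_assoc]

/-- Completion of the square in the one-step problem. -/
theorem complete_square {Rx : Matrix (Fin dx) (Fin dx) ℝ} {Ru : Matrix (Fin du) (Fin du) ℝ}
    (hRu : Ruᵀ = Ru) {θ : LinSystem dx du} {P : Matrix (Fin dx) (Fin dx) ℝ} (hP : Pᵀ = P)
    {K : Controller dx du}
    (hK : inputGram Ru θ P * K = -((LinSystem.B θ)ᵀ * P * LinSystem.A θ)) (L : Controller dx du) :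
    (closedLoop θ L)ᵀ * P * closedLoop θ L + costMatrix Rx Ru L
      = (LinSystem.A θ)ᵀ * P * LinSystem.A θ + (LinSystem.A θ)ᵀ * P * LinSystem.B θ * K + Rx
        + (L - K)ᵀ * inputGram Ru θ P * (L - K) := by
  have hG := inputGram_transpose (θ := θ) hRu hP
  have hK' : Kᵀ * inputGram Ru θ P = -((LinSystem.A θ)ᵀ * P * LinSystem.B θ) := by
    have := congrArg Matrix.transpose hK
    rw [Matrix.transpose_mul, hG] at this
    rw [this]
    simp [Matrix.transpose_mul, hP, Matrix.mul_assoc]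
  have h1 : (L - K)ᵀ * inputGram Ru θ P * (L - K)
      = Lᵀ * inputGram Ru θ P * L + Lᵀ * ((LinSystem.B θ)ᵀ * P * LinSystem.A θ)
        + (LinSystem.A θ)ᵀ * P * LinSystem.B θ * L
        - (LinSystem.A θ)ᵀ * P * LinSystem.B θ * K := by
    rw [Matrix.transpose_sub, Matrix.sub_mul, hK', Matrix.mul_sub, Matrix.sub_mul,
      Matrix.sub_mul, Matrix.mul_assoc Lᵀ _ K, hK]
    simp only [Matrix.mul_neg, Matrix.neg_mul]
    abel
  rw [h1, closedLoop, costMatrix, inputGram]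
  simp only [Matrix.transpose_add, Matrix.transpose_mul, Matrix.mul_add, Matrix.add_mul,
    Matrix.mul_assoc]
  abel

theorem RiccatiPair.gram_mul {Rx : Matrix (Fin dx) (Fin dx) ℝ} {Ru : Matrix (Fin du) (Fin du) ℝ}
    {θ : LinSystem dx du} {K : Controller dx du} {P : Matrix (Fin dx) (Fin dx) ℝ}
    (h : RiccatiPair Rx Ru θ K P) :
    inputGram Ru θ P * K = -((LinSystem.B θ)ᵀ * P * LinSystem.A θ) := by
  have := h.stationary
  rw [closedLoop, Matrix.mul_add, ← add_assoc, add_right_comm, ← Matrix.mul_assoc,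
    ← Matrix.add_mul] at this
  exact eq_neg_of_add_eq_zero_left this

theorem RiccatiPair.complete_square {Rx : Matrix (Fin dx) (Fin dx) ℝ}
    {Ru : Matrix (Fin du) (Fin du) ℝ} (hRu : Ruᵀ = Ru)
    {θ : LinSystem dx du} {K : Controller dx du} {P : Matrix (Fin dx) (Fin dx) ℝ}
    (h : RiccatiPair Rx Ru θ K P) (L : Controller dx du) :
    (closedLoop θ L)ᵀ * P * closedLoop θ L + costMatrix Rx Ru L
      = P + (L - K)ᵀ * inputGram Ru θ P * (L - K) := by
  -- At L = K the square vanishes, which identifies the constant term of the completed square with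
  -- P.
  have h1 := _root_.complete_square (Rx := Rx) hRu h.symm h.gram_mul K
  rw [← h.lyap, sub_self, Matrix.mul_zero, add_zero] at h1
  rw [_root_.complete_square (Rx := Rx) hRu h.symm h.gram_mul L, ← h1]

/-- The right-hand side of the Riccati equation. -/
noncomputable def riccatiMap (Rx : Matrix (Fin dx) (Fin dx) ℝ) (Ru : Matrix (Fin du) (Fin du) ℝ)
    (θ : LinSystem dx du) (P : Matrix (Fin dx) (Fin dx) ℝ) : Matrix (Fin dx) (Fin dx) ℝ :=
  (LinSystem.A θ)ᵀ * P * LinSystem.A θ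
    - (LinSystem.A θ)ᵀ * P * LinSystem.B θ
        * (Ru + (LinSystem.B θ)ᵀ * P * LinSystem.B θ)⁻¹
        * (LinSystem.B θ)ᵀ * P * LinSystem.A θ
    + Rx

/-- The minimizing controller of the one-step problem with terminal cost `P`. -/
noncomputable def greedyGain (Ru : Matrix (Fin du) (Fin du) ℝ) (θ : LinSystem dx du)
    (P : Matrix (Fin dx) (Fin dx) ℝ) : Controller dx du :=
  -((inputGram Ru θ P)⁻¹ * ((LinSystem.B θ)ᵀ * P * LinSystem.A θ))

theorem inputGram_mul_greedyGain {Ru : Matrix (Fin du) (Fin du) ℝ} (hRu : (Ru - 1).PosSemidef)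
    {θ : LinSystem dx du} {P : Matrix (Fin dx) (Fin dx) ℝ} (hP : ∀ x, 0 ≤ qf P x) :
    inputGram Ru θ P * greedyGain Ru θ P = -((LinSystem.B θ)ᵀ * P * LinSystem.A θ) := by
  have hu := (Matrix.isUnit_iff_isUnit_det _).1
    (isUnit_of_qf_ge (qf_inputGram_ge (θ := θ) hRu hP))
  rw [greedyGain, Matrix.mul_neg, Matrix.mul_nonsing_inv_cancel_left _ _ hu]

theorem riccatiMap_eq (Rx : Matrix (Fin dx) (Fin dx) ℝ) (Ru : Matrix (Fin du) (Fin du) ℝ)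
    (θ : LinSystem dx du) (P : Matrix (Fin dx) (Fin dx) ℝ) :
    riccatiMap Rx Ru θ P = (LinSystem.A θ)ᵀ * P * LinSystem.A θ
      + (LinSystem.A θ)ᵀ * P * LinSystem.B θ * greedyGain Ru θ P + Rx := by
  simp only [riccatiMap, greedyGain, inputGram, Matrix.mul_neg, Matrix.mul_assoc, sub_eq_add_neg]

theorem riccatiMap_square {Rx : Matrix (Fin dx) (Fin dx) ℝ} {Ru : Matrix (Fin du) (Fin du) ℝ}
    (hRu : (Ru - 1).PosSemidef)
    {θ : LinSystem dx du} {P : Matrix (Fin dx) (Fin dx) ℝ} (hP : Pᵀ = P) (hP0 : ∀ x, 0 ≤ qf P x)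
    (L : Controller dx du) :
    (closedLoop θ L)ᵀ * P * closedLoop θ L + costMatrix Rx Ru L
      = riccatiMap Rx Ru θ P
        + (L - greedyGain Ru θ P)ᵀ * inputGram Ru θ P * (L - greedyGain Ru θ P) := by
  rw [riccatiMap_eq]
  exact complete_square (transpose_eq_of_posSemidef_sub_one hRu) hP
    (inputGram_mul_greedyGain hRu hP0) L

theorem riccatiMap_greedy {Rx : Matrix (Fin dx) (Fin dx) ℝ} {Ru : Matrix (Fin du) (Fin du) ℝ}
    (hRu : (Ru - 1).PosSemidef)
    {θ : LinSystem dx du} {P : Matrix (Fin dx) (Fin dx) ℝ} (hP : Pᵀ = P)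
    (hP0 : ∀ x, 0 ≤ qf P x) :
    riccatiMap Rx Ru θ P = (closedLoop θ (greedyGain Ru θ P))ᵀ * P
      * closedLoop θ (greedyGain Ru θ P) + costMatrix Rx Ru (greedyGain Ru θ P) := by
  rw [riccatiMap_square hRu hP hP0, sub_self, Matrix.mul_zero, add_zero]

/-- The Riccati map is the one-step dynamic programming operator: its value is attained by the
greedy gain, and every other gain adds a nonnegative square. -/
theorem qf_riccatiMap_le {Rx : Matrix (Fin dx) (Fin dx) ℝ} {Ru : Matrix (Fin du) (Fin du) ℝ}
    (hRu : (Ru - 1).PosSemidef)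
    {θ : LinSystem dx du} {P : Matrix (Fin dx) (Fin dx) ℝ} (hP : Pᵀ = P) (hP0 : ∀ x, 0 ≤ qf P x)
    (L : Controller dx du) (x : Fin dx → ℝ) :
    qf (riccatiMap Rx Ru θ P) x
      ≤ qf P (closedLoop θ L *ᵥ x) + qf (costMatrix Rx Ru L) x := by
  rw [← qf_conj, ← qf_add, riccatiMap_square hRu hP hP0 L, qf_add _ ((L - _)ᵀ * _ * _), qf_conj]
  have := qf_inputGram_ge (θ := θ) hRu hP0 ((L - greedyGain Ru θ P) *ᵥ x)
  linarith [dotProduct_self_nonneg' ((L - greedyGain Ru θ P) *ᵥ x)]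

/-- A fixed point of the Riccati map yields a Riccati pair. -/
theorem riccatiPair_of_fixed {Rx : Matrix (Fin dx) (Fin dx) ℝ} {Ru : Matrix (Fin du) (Fin du) ℝ}
    (hRu : (Ru - 1).PosSemidef) {θ : LinSystem dx du} {P : Matrix (Fin dx) (Fin dx) ℝ}
    (hP : P.PosSemidef) (hfix : P = riccatiMap Rx Ru θ P) :
    RiccatiPair Rx Ru θ (greedyGain Ru θ P) P := by
  obtain ⟨hs, h0⟩ := (posSemidef_iff_qf P).1 hP
  refine ⟨hs, h0, hfix.trans (riccatiMap_greedy hRu hs h0), ?_⟩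
  have := inputGram_mul_greedyGain (θ := θ) hRu h0
  rw [closedLoop, Matrix.mul_add, ← add_assoc, add_right_comm, ← Matrix.mul_assoc,
    ← Matrix.add_mul]
  rw [inputGram] at this
  rw [this, neg_add_cancel]

theorem continuousAt_riccatiMap (Rx : Matrix (Fin dx) (Fin dx) ℝ)
    {Ru : Matrix (Fin du) (Fin du) ℝ} (hRu : (Ru - 1).PosSemidef) (θ : LinSystem dx du)
    {P : Matrix (Fin dx) (Fin dx) ℝ} (hP : ∀ x, 0 ≤ qf P x) :
    ContinuousAt (riccatiMap Rx Ru θ) P := by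
  have hG : ContinuousAt (fun P : Matrix (Fin dx) (Fin dx) ℝ =>
      (Ru + (LinSystem.B θ)ᵀ * P * LinSystem.B θ)⁻¹) P := by
    obtain ⟨u, hu⟩ := isUnit_of_qf_ge (qf_inputGram_ge (θ := θ) hRu hP)
    have h1 : ContinuousAt Ring.inverse (inputGram Ru θ P) := by
      rw [← hu]
      exact NormedRing.inverse_continuousAt u
    have h2 : ContinuousAt (fun P => inputGram Ru θ P) P := by
      unfold inputGram
      fun_prop
    have h3 := ContinuousAt.comp (f := fun P => inputGram Ru θ P) (x := P) h1 h2
    simp only [Function.comp_def, ← Matrix.nonsing_inv_eq_ringInverse] at h3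
    exact h3
  unfold riccatiMap
  fun_prop

theorem riccatiMap_transpose {Rx : Matrix (Fin dx) (Fin dx) ℝ} {Ru : Matrix (Fin du) (Fin du) ℝ}
    (hRx : Rxᵀ = Rx) (hRu : (Ru - 1).PosSemidef)
    {θ : LinSystem dx du} {P : Matrix (Fin dx) (Fin dx) ℝ} (hP : Pᵀ = P)
    (hP0 : ∀ x, 0 ≤ qf P x) : (riccatiMap Rx Ru θ P)ᵀ = riccatiMap Rx Ru θ P := by
  have hc := costMatrix_transpose hRx (transpose_eq_of_posSemidef_sub_one hRu)
    (greedyGain Ru θ P)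
  rw [riccatiMap_greedy hRu hP hP0]
  simp [Matrix.transpose_mul, hP, Matrix.mul_assoc, hc]

/-- A monotone bounded sequence of symmetric matrices converges. -/
theorem exists_tendsto_of_monotone {n : ℕ} {P : ℕ → Matrix (Fin n) (Fin n) ℝ}
    (hs : ∀ k, (P k)ᵀ = P k) (hmono : ∀ k x, qf (P k) x ≤ qf (P (k + 1)) x)
    {b : (Fin n → ℝ) → ℝ} (hb : ∀ k x, qf (P k) x ≤ b x) :
    ∃ Q, Tendsto P atTop (𝓝 Q) := by
  have h1 : ∀ x, ∃ l, Tendsto (fun k => qf (P k) x) atTop (𝓝 l) := fun x =>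
    ⟨_, tendsto_atTop_ciSup (monotone_nat_of_le_succ fun k => hmono k x)
      ⟨b x, by rintro _ ⟨k, rfl⟩; exact hb k x⟩⟩
  choose l hl using h1
  -- Polarization recovers the entries of a symmetric matrix from its quadratic form, so convergence
  -- of the forms at each vector gives convergence of the matrices.
  have key : ∀ (L : Matrix (Fin n) (Fin n) ℝ), Lᵀ = L → ∀ i j,
      L i j = (qf L (Pi.single i 1 + Pi.single j 1) - qf L (Pi.single i 1)
        - qf L (Pi.single j 1)) / 2 := by
    intro L hL i j
    have hs : L j i = L i j := congrFun (congrFun hL i) j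
    simp [qf, Matrix.mulVec_add, add_dotProduct, hs]
    ring
  refine ⟨Matrix.of fun i j => (l (Pi.single i 1 + Pi.single j 1) - l (Pi.single i 1)
        - l (Pi.single j 1)) / 2, tendsto_pi_nhds.2 fun i => tendsto_pi_nhds.2 fun j => ?_⟩
  have h2 := (((hl (Pi.single i 1 + Pi.single j 1)).sub (hl (Pi.single i 1))).sub
    (hl (Pi.single j 1))).div_const 2
  refine h2.congr fun k => ?_
  rw [key (P k) (hs k) i j]

/-- Stabilizable systems have a positive semidefinite solution of the Riccati equation, by value
iteration. -/
theorem exists_riccati_solution {Rx : Matrix (Fin dx) (Fin dx) ℝ}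
    {Ru : Matrix (Fin du) (Fin du) ℝ} (hRx : (Rx - 1).PosSemidef) (hRu : (Ru - 1).PosSemidef)
    {θ : LinSystem dx du} {L : Controller dx du} (hL : Stable (closedLoop θ L)) :
    ∃ P : Matrix (Fin dx) (Fin dx) ℝ, P.PosSemidef ∧ P = riccatiMap Rx Ru θ P := by
  have hRxs := transpose_eq_of_posSemidef_sub_one hRx
  have hQ0 : ∀ (K : Controller dx du) x, 0 ≤ qf (costMatrix Rx Ru K) x := fun K x =>
    (dotProduct_self_nonneg' x).trans (qf_costMatrix_ge hRx hRu K x)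
  set P : ℕ → Matrix (Fin dx) (Fin dx) ℝ := fun k => (riccatiMap Rx Ru θ)^[k] 0 with hPdef
  have hP1 : ∀ k, P (k + 1) = riccatiMap Rx Ru θ (P k) := fun k =>
    Function.iterate_succ_apply' _ _ _
  have hbasic : ∀ k, (P k)ᵀ = P k ∧ ∀ x, 0 ≤ qf (P k) x := fun k => by
    induction k with
    | zero => exact ⟨by simp [hPdef], fun x => by simp [hPdef, qf_zero]⟩
    | succ k ih =>
      rw [hP1]
      refine ⟨riccatiMap_transpose hRxs hRu ih.1 ih.2, fun x => ?_⟩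
      rw [riccatiMap_greedy hRu ih.1 ih.2, qf_add, qf_conj]
      exact add_nonneg (ih.2 _) (hQ0 _ _)
  -- In the induction step the greedy gain for P (k + 1) competes in the minimum that defines P (k +
  -- 1) from P k.
  have hmono : ∀ k x, qf (P k) x ≤ qf (P (k + 1)) x := fun k => by
    induction k with
    | zero =>
      intro x
      have : P 0 = 0 := rfl
      rw [this, qf_zero]
      exact (hbasic 1).2 x
    | succ k ih =>
      intro x
      rw [hP1 k, hP1 (k + 1), riccatiMap_greedy hRu (hbasic (k + 1)).1 (hbasic (k + 1)).2,
        qf_add, qf_conj]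
      exact (qf_riccatiMap_le hRu (hbasic k).1 (hbasic k).2 _ x).trans
        (add_le_add_left (ih _) _)
  -- The stabilizing gain L competes at every stage, so its infinite-horizon cost bounds all
  -- iterates.
  have hbd : ∀ k x, qf (P k) x ≤ qf (dlyap (closedLoop θ L) (costMatrix Rx Ru L)) x := fun k => by
    induction k with
    | zero =>
      intro x
      have : P 0 = 0 := rfl
      rw [this, qf_zero]
      exact qf_dlyap_nonneg hL (hQ0 L) x
    | succ k ih =>
      intro x
      rw [hP1 k, qf_dlyap hL]
      exact (qf_riccatiMap_le hRu (hbasic k).1 (hbasic k).2 L x).trans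
        (add_le_add_left (ih _) _)
  obtain ⟨Q, hQ⟩ := exists_tendsto_of_monotone (fun k => (hbasic k).1) hmono hbd
  have hQs : Qᵀ = Q := by
    have h1 := ((continuous_id.matrix_transpose).tendsto Q).comp hQ
    simp only [Function.comp_def, id, (hbasic _).1] at h1
    exact tendsto_nhds_unique h1 hQ
  have hQn : ∀ x, 0 ≤ qf Q x := fun x =>
    ge_of_tendsto (((continuous_qf x).tendsto Q).comp hQ)
      (Eventually.of_forall fun k => (hbasic k).2 x)
  refine ⟨Q, (posSemidef_iff_qf Q).2 ⟨hQs, hQn⟩, ?_⟩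
  have h1 := (continuousAt_riccatiMap Rx hRu θ hQn).tendsto.comp hQ
  have h2 := (tendsto_add_atTop_iff_nat (f := P) 1).2 hQ
  exact tendsto_nhds_unique h2 (by simpa only [Function.comp_def, ← hP1] using h1)

/-- The matrix chosen by `riccati` does satisfy its equation, since value iteration produces a
solution; no uniqueness is needed for this. -/
theorem riccatiPair_of_stable {Rx : Matrix (Fin dx) (Fin dx) ℝ}
    {Ru : Matrix (Fin du) (Fin du) ℝ} (hRx : (Rx - 1).PosSemidef) (hRu : (Ru - 1).PosSemidef)
    {θ : LinSystem dx du} {L : Controller dx du} (hL : Stable (closedLoop θ L)) :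
    ∃ K, RiccatiPair Rx Ru θ K (riccati Rx Ru θ) := by
  have h := Classical.epsilon_spec (exists_riccati_solution hRx hRu hL)
  exact ⟨_, riccatiPair_of_fixed hRu h.1 h.2⟩

/-- The value matrix is itself a Lyapunov function, the stage cost being at least |x|². -/
theorem RiccatiPair.stable {Rx : Matrix (Fin dx) (Fin dx) ℝ}
    {Ru : Matrix (Fin du) (Fin du) ℝ} (hRx : (Rx - 1).PosSemidef) (hRu : (Ru - 1).PosSemidef)
    {θ : LinSystem dx du} {K : Controller dx du} {P : Matrix (Fin dx) (Fin dx) ℝ}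
    (h : RiccatiPair Rx Ru θ K P) : Stable (closedLoop θ K) := by
  refine stable_of_lyapunov one_pos h.nonneg fun x => ?_
  have h1 : qf P x = qf P (closedLoop θ K *ᵥ x) + qf (costMatrix Rx Ru K) x := by
    conv_lhs => rw [h.lyap, qf_add, qf_conj]
  linarith [qf_costMatrix_ge hRx hRu K x]

theorem RiccatiPair.qf_eq {Rx : Matrix (Fin dx) (Fin dx) ℝ}
    {Ru : Matrix (Fin du) (Fin du) ℝ}
    {θ : LinSystem dx du} {K : Controller dx du} {P : Matrix (Fin dx) (Fin dx) ℝ}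
    (h : RiccatiPair Rx Ru θ K P) (x : Fin dx → ℝ) :
    qf P x = qf P (closedLoop θ K *ᵥ x) + qf Rx x + qf Ru (K *ᵥ x) := by
  conv_lhs => rw [h.lyap, qf_add, qf_conj, qf_costMatrix]
  ring

/-- Gelfand's formula: a spectral radius below 1 makes some power of the complexified loop smaller
than 1 in norm, and complexification preserves the Frobenius norm. -/
theorem exists_stable_of_stabilizable {θ : LinSystem dx du} (h : Stabilizable θ) :
    ∃ K : Controller dx du, Stable (closedLoop θ K) := by
  obtain ⟨K, hK⟩ := h
  refine ⟨K, ?_⟩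
  change spectralRadius ℂ ((closedLoop θ K).map (algebraMap ℝ ℂ)) < 1 at hK
  set W := closedLoop θ K
  have h1 := spectrum.pow_nnnorm_pow_one_div_tendsto_nhds_spectralRadius
    (W.map (algebraMap ℝ ℂ))
  obtain ⟨k, hk, hk0⟩ := ((h1.eventually (gt_mem_nhds hK)).and (eventually_gt_atTop 0)).exists
  have h2 : (W.map (algebraMap ℝ ℂ)) ^ k = (W ^ k).map (algebraMap ℝ ℂ) :=
    ((algebraMap ℝ ℂ).mapMatrix.map_pow W k).symm
  have h3 : ‖(W.map (algebraMap ℝ ℂ)) ^ k‖₊ = ‖W ^ k‖₊ := by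
    rw [h2]
    exact Matrix.frobenius_nnnorm_map_eq _ _ fun a => by simp
  rw [h3] at hk
  have hk' : (‖W ^ k‖₊ : ℝ≥0∞) < 1 := by
    by_contra hcon
    exact absurd hk (not_lt.2 (ENNReal.one_le_rpow (not_lt.1 hcon) (by positivity)))
  refine stable_of_norm_pow_lt (k := k) ?_
  exact_mod_cast hk'

/-- Decomposition of the value of a stabilizing controller. -/
theorem RiccatiPair.dlyap_eq {Rx : Matrix (Fin dx) (Fin dx) ℝ}
    {Ru : Matrix (Fin du) (Fin du) ℝ} (hRu : Ruᵀ = Ru)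
    {θ : LinSystem dx du} {K : Controller dx du} {P : Matrix (Fin dx) (Fin dx) ℝ}
    (h : RiccatiPair Rx Ru θ K P) {L : Controller dx du} (hL : Stable (closedLoop θ L)) :
    dlyap (closedLoop θ L) (costMatrix Rx Ru L)
      = P + dlyap (closedLoop θ L) ((L - K)ᵀ * inputGram Ru θ P * (L - K)) := by
  refine (eq_dlyap hL ?_).symm
  have h1 := h.complete_square hRu L
  have h2 := _root_.dlyap_eq hL ((L - K)ᵀ * inputGram Ru θ P * (L - K))
  set Y := dlyap (closedLoop θ L) ((L - K)ᵀ * inputGram Ru θ P * (L - K))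
  set M := (L - K)ᵀ * inputGram Ru θ P * (L - K)
  rw [Matrix.mul_add, Matrix.add_mul, add_right_comm, h1]
  conv_lhs => rw [h2]
  abel

/-- The source dominates (L - K)ᵀ(L - K) because the input Gram matrix is at least the identity, and
a Lyapunov solution with nonnegative source dominates that source. This is where the curvature μ =
2σ² comes from. -/
theorem RiccatiPair.norm_sq_le {Rx : Matrix (Fin dx) (Fin dx) ℝ}
    {Ru : Matrix (Fin du) (Fin du) ℝ} (hRu : (Ru - 1).PosSemidef)
    {θ : LinSystem dx du} {K : Controller dx du} {P : Matrix (Fin dx) (Fin dx) ℝ}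
    (h : RiccatiPair Rx Ru θ K P) {L : Controller dx du} (hL : Stable (closedLoop θ L)) :
    ‖L - K‖ ^ 2
      ≤ (dlyap (closedLoop θ L) ((L - K)ᵀ * inputGram Ru θ P * (L - K))).trace := by
  rw [frobenius_sq_eq_trace]
  refine trace_le_of_qf_le fun x => ?_
  have hM : ∀ x, ((L - K) *ᵥ x) ⬝ᵥ ((L - K) *ᵥ x)
      ≤ qf ((L - K)ᵀ * inputGram Ru θ P * (L - K)) x := fun x => by
    rw [qf_conj]; exact qf_inputGram_ge hRu h.nonneg _
  have h1 := qf_conj (L - K) 1 x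
  rw [Matrix.mul_one, qf_one] at h1
  rw [h1, qf_dlyap hL]
  have h2 := qf_dlyap_nonneg hL (fun x => (dotProduct_self_nonneg' _).trans (hM x))
    (closedLoop θ L *ᵥ x)
  linarith [hM x]

theorem RiccatiPair.iInf_lqrCost {σ : ℝ≥0} (hσ : 0 < σ) {Rx : Matrix (Fin dx) (Fin dx) ℝ}
    {Ru : Matrix (Fin du) (Fin du) ℝ} (hRx : (Rx - 1).PosSemidef) (hRu : (Ru - 1).PosSemidef)
    {θ : LinSystem dx du} {K : Controller dx du} {P : Matrix (Fin dx) (Fin dx) ℝ}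
    (h : RiccatiPair Rx Ru θ K P) :
    ⨅ L, lqrCost σ Rx Ru θ L = ENNReal.ofReal ((σ : ℝ) ^ 2 * P.trace) := by
  have hRus := transpose_eq_of_posSemidef_sub_one hRu
  refine le_antisymm ?_ ?_
  · refine (iInf_le _ K).trans ?_
    rw [lqrCost_of_stable hRx hRu (h.stable hRx hRu), ← eq_dlyap (h.stable hRx hRu) h.lyap]
  · refine le_iInf fun L => ?_
    by_cases hL : Stable (closedLoop θ L)
    · rw [lqrCost_of_stable hRx hRu hL, h.dlyap_eq hRus hL, Matrix.trace_add]
      refine ENNReal.ofReal_le_ofReal (mul_le_mul_of_nonneg_left ?_ (by positivity))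
      linarith [h.norm_sq_le hRu hL, sq_nonneg ‖L - K‖]
    · rw [lqrCost_of_not_stable hσ hRx hRu hL]
      exact le_top

theorem RiccatiPair.lqrRisk_of_stable {σ : ℝ≥0} (hσ : 0 < σ) {Rx : Matrix (Fin dx) (Fin dx) ℝ}
    {Ru : Matrix (Fin du) (Fin du) ℝ} (hRx : (Rx - 1).PosSemidef) (hRu : (Ru - 1).PosSemidef)
    {θ : LinSystem dx du} {K : Controller dx du} {P : Matrix (Fin dx) (Fin dx) ℝ}
    (h : RiccatiPair Rx Ru θ K P) {L : Controller dx du} (hL : Stable (closedLoop θ L)) :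
    lqrRisk σ Rx Ru L θ = ENNReal.ofReal ((σ : ℝ) ^ 2 *
      (dlyap (closedLoop θ L) ((L - K)ᵀ * inputGram Ru θ P * (L - K))).trace) := by
  have hP : 0 ≤ P.trace := by
    rw [trace_eq_sum_qf]; exact Finset.sum_nonneg fun i _ => h.nonneg _
  rw [lqrRisk, excessRisk, h.iInf_lqrCost hσ hRx hRu, lqrCost_of_stable hRx hRu hL,
    h.dlyap_eq (transpose_eq_of_posSemidef_sub_one hRu) hL, Matrix.trace_add,
    ← ENNReal.ofReal_sub _ (by positivity)]
  congr 1
  ring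

theorem RiccatiPair.lqrRisk_of_not_stable {σ : ℝ≥0} (hσ : 0 < σ)
    {Rx : Matrix (Fin dx) (Fin dx) ℝ}
    {Ru : Matrix (Fin du) (Fin du) ℝ} (hRx : (Rx - 1).PosSemidef) (hRu : (Ru - 1).PosSemidef)
    {θ : LinSystem dx du} {K : Controller dx du} {P : Matrix (Fin dx) (Fin dx) ℝ}
    (h : RiccatiPair Rx Ru θ K P) {L : Controller dx du} (hL : ¬ Stable (closedLoop θ L)) :
    lqrRisk σ Rx Ru L θ = (⊤ : ℝ≥0∞) := by
  rw [lqrRisk, excessRisk, h.iInf_lqrCost hσ hRx hRu, lqrCost_of_not_stable hσ hRx hRu hL]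
  exact ENNReal.top_sub ENNReal.ofReal_ne_top

theorem RiccatiPair.quadratic_growth {σ : ℝ≥0} (hσ : 0 < σ) {Rx : Matrix (Fin dx) (Fin dx) ℝ}
    {Ru : Matrix (Fin du) (Fin du) ℝ} (hRx : (Rx - 1).PosSemidef) (hRu : (Ru - 1).PosSemidef)
    {θ : LinSystem dx du} {K : Controller dx du} {P : Matrix (Fin dx) (Fin dx) ℝ}
    (h : RiccatiPair Rx Ru θ K P) (L : Controller dx du) :
    ENNReal.ofReal ((σ : ℝ) ^ 2 * ‖L - K‖ ^ 2) ≤ lqrRisk σ Rx Ru L θ := by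
  by_cases hL : Stable (closedLoop θ L)
  · rw [h.lqrRisk_of_stable hσ hRx hRu hL]
    exact ENNReal.ofReal_le_ofReal
      (mul_le_mul_of_nonneg_left (h.norm_sq_le hRu hL) (by positivity))
  · rw [h.lqrRisk_of_not_stable hσ hRx hRu hL]
    exact le_top

theorem RiccatiPair.lqrRisk_self {σ : ℝ≥0} (hσ : 0 < σ) {Rx : Matrix (Fin dx) (Fin dx) ℝ}
    {Ru : Matrix (Fin du) (Fin du) ℝ} (hRx : (Rx - 1).PosSemidef) (hRu : (Ru - 1).PosSemidef)
    {θ : LinSystem dx du} {K : Controller dx du} {P : Matrix (Fin dx) (Fin dx) ℝ}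
    (h : RiccatiPair Rx Ru θ K P) : lqrRisk σ Rx Ru K θ = 0 := by
  rw [h.lqrRisk_of_stable hσ hRx hRu (h.stable hRx hRu), sub_self, Matrix.mul_zero,
    dlyap_zero (h.stable hRx hRu)]
  simp

theorem RiccatiPair.isMinOn {σ : ℝ≥0} (hσ : 0 < σ) {Rx : Matrix (Fin dx) (Fin dx) ℝ}
    {Ru : Matrix (Fin du) (Fin du) ℝ} (hRx : (Rx - 1).PosSemidef) (hRu : (Ru - 1).PosSemidef)
    {θ : LinSystem dx du} {K : Controller dx du} {P : Matrix (Fin dx) (Fin dx) ℝ}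
    (h : RiccatiPair Rx Ru θ K P) : IsMinOn (fun L => lqrRisk σ Rx Ru L θ) Set.univ K :=
  fun L _ => by
    change lqrRisk σ Rx Ru K θ ≤ lqrRisk σ Rx Ru L θ
    rw [h.lqrRisk_self hσ hRx hRu]
    exact zero_le

theorem RiccatiPair.eq_of_isMinOn {σ : ℝ≥0} (hσ : 0 < σ) {Rx : Matrix (Fin dx) (Fin dx) ℝ}
    {Ru : Matrix (Fin du) (Fin du) ℝ} (hRx : (Rx - 1).PosSemidef) (hRu : (Ru - 1).PosSemidef)
    {θ : LinSystem dx du} {K : Controller dx du} {P : Matrix (Fin dx) (Fin dx) ℝ}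
    (h : RiccatiPair Rx Ru θ K P) {L : Controller dx du}
    (hL : IsMinOn (fun L => lqrRisk σ Rx Ru L θ) Set.univ L) : L = K := by
  have h1 : lqrRisk σ Rx Ru L θ ≤ lqrRisk σ Rx Ru K θ := hL (Set.mem_univ K)
  rw [h.lqrRisk_self hσ hRx hRu] at h1
  have h2 := (h.quadratic_growth hσ hRx hRu L).trans h1
  have h3 := ENNReal.ofReal_eq_zero.1 (le_antisymm h2 zero_le)
  have hσ' : (0 : ℝ) < (σ : ℝ) ^ 2 := by positivity
  have h4 : ‖L - K‖ ^ 2 ≤ 0 := by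
    by_contra hc
    exact absurd h3 (not_le.2 (mul_pos hσ' (not_le.1 hc)))
  have h5 : ‖L - K‖ = 0 := by
    have := sq_nonneg ‖L - K‖
    exact pow_eq_zero_iff (two_ne_zero) |>.1 (le_antisymm h4 this)
  exact sub_eq_zero.1 (norm_eq_zero.1 h5)

/-- A minimizer exists, so the arbitrary choice in `optDecision` is a minimizer, and quadratic
growth leaves only K. -/
theorem RiccatiPair.optDecision_eq {σ : ℝ≥0} (hσ : 0 < σ) {Rx : Matrix (Fin dx) (Fin dx) ℝ}
    {Ru : Matrix (Fin du) (Fin du) ℝ} (hRx : (Rx - 1).PosSemidef) (hRu : (Ru - 1).PosSemidef)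
    {θ : LinSystem dx du} {K : Controller dx du} {P : Matrix (Fin dx) (Fin dx) ℝ}
    (h : RiccatiPair Rx Ru θ K P) : optDecision (lqrRisk σ Rx Ru) θ = K :=
  h.eq_of_isMinOn hσ hRx hRu (Classical.epsilon_spec (p := fun a =>
    IsMinOn (fun a' => lqrRisk σ Rx Ru a' θ) Set.univ a) ⟨K, h.isMinOn hσ hRx hRu⟩)

end Riccati

/-! ### Smooth dependence of the optimal controller on the system -/

section ImplicitFunction

/-- The partial derivative in the second variable is an endomorphism of a finite-dimensional space,
so injectivity is enough, and injectivity can be tested on directional derivatives. -/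
theorem exists_contDiffAt_implicit {E₁ E₂ : Type*} [NormedAddCommGroup E₁] [NormedSpace ℝ E₁]
    [CompleteSpace E₁] [NormedAddCommGroup E₂] [NormedSpace ℝ E₂] [FiniteDimensional ℝ E₂]
    {f : E₁ × E₂ → E₂} {u : E₁ × E₂} (hf : ContDiffAt ℝ ω f u)
    (hinj : ∀ v : E₂, HasDerivAt (fun t : ℝ => f (u.1, u.2 + t • v)) 0 0 → v = 0) :
    ∃ ψ : E₁ → E₂, ContDiffAt ℝ ω ψ u.1 ∧ ψ u.1 = u.2 ∧ ∀ᶠ x in 𝓝 u.1, f (x, ψ x) = f u := by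
  have : CompleteSpace E₂ := FiniteDimensional.complete ℝ E₂
  have hω : (ω : ℕ∞ω) ≠ 0 := by simp
  set D : E₂ →L[ℝ] E₂ := fderiv ℝ f u ∘L .inr ℝ E₁ E₂ with hD
  have hline : ∀ v : E₂, HasDerivAt (fun t : ℝ => f (u.1, u.2 + t • v)) (D v) 0 := by
    intro v
    have h1 : HasDerivAt (fun t : ℝ => (u.1, u.2 + t • v)) ((0 : E₁), v) 0 := by
      refine (hasDerivAt_const _ _).prodMk ?_
      simpa using ((hasDerivAt_id (0 : ℝ)).smul_const v).const_add u.2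
    have h2 : HasFDerivAt f (fderiv ℝ f u) (u.1, u.2 + (0 : ℝ) • v) := by
      rw [zero_smul, add_zero]
      exact (hf.differentiableAt hω).hasFDerivAt
    exact h2.comp_hasDerivAt (0 : ℝ) h1
  have hDinj : Function.Injective D.toLinearMap := by
    rw [← LinearMap.ker_eq_bot, LinearMap.ker_eq_bot']
    intro v hv
    refine hinj v ?_
    have := hline v
    rwa [show D v = 0 from hv] at this
  have hDinv : D.IsInvertible :=
    ⟨(LinearEquiv.ofInjectiveEndo D.toLinearMap hDinj).toContinuousLinearEquiv, by ext1; rfl⟩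
  exact ⟨hf.implicitFunction hω hDinv, hf.contDiffAt_implicitFunction hω hDinv,
    hf.implicitFunction_apply_self hω hDinv, hf.eventually_apply_implicitFunction hω hDinv⟩

end ImplicitFunction

/-! ### The optimal gain as an implicit function -/

section SmoothOpt

variable {dx du : ℕ}

theorem LinSystem.A_add (θ η : LinSystem dx du) :
    LinSystem.A (θ + η) = LinSystem.A θ + LinSystem.A η := rfl

theorem LinSystem.B_add (θ η : LinSystem dx du) :
    LinSystem.B (θ + η) = LinSystem.B θ + LinSystem.B η := rfl

theorem LinSystem.A_sub (θ η : LinSystem dx du) :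
    LinSystem.A (θ - η) = LinSystem.A θ - LinSystem.A η := rfl

theorem LinSystem.B_sub (θ η : LinSystem dx du) :
    LinSystem.B (θ - η) = LinSystem.B θ - LinSystem.B η := rfl

theorem LinSystem.A_smul (c : ℝ) (θ : LinSystem dx du) :
    LinSystem.A (c • θ) = c • LinSystem.A θ := rfl

theorem LinSystem.B_smul (c : ℝ) (θ : LinSystem dx du) :
    LinSystem.B (c • θ) = c • LinSystem.B θ := rfl

theorem LinSystem.norm_sq (θ : LinSystem dx du) :
    ‖θ‖ ^ 2 = ‖LinSystem.A θ‖ ^ 2 + ‖LinSystem.B θ‖ ^ 2 := by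
  simp only [frobenius_sq_eq_sum, Fintype.sum_sum_type, Finset.sum_add_distrib]
  rfl

theorem LinSystem.norm_A_le (θ : LinSystem dx du) : ‖LinSystem.A θ‖ ≤ ‖θ‖ := by
  refine le_of_sq_le_sq ?_ (norm_nonneg _)
  rw [LinSystem.norm_sq θ]
  nlinarith [sq_nonneg ‖LinSystem.B θ‖]

theorem LinSystem.norm_B_le (θ : LinSystem dx du) : ‖LinSystem.B θ‖ ≤ ‖θ‖ := by
  refine le_of_sq_le_sq ?_ (norm_nonneg _)
  rw [LinSystem.norm_sq θ]
  nlinarith [sq_nonneg ‖LinSystem.A θ‖]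

variable {E : Type*} [NormedAddCommGroup E] [NormedSpace ℝ E]

theorem contDiff_linA {k : ℕ∞ω} :
    ContDiff ℝ k (LinSystem.A : LinSystem dx du → Matrix (Fin dx) (Fin dx) ℝ) :=
  (LinearMap.toContinuousLinearMap (𝕜 := ℝ) (E := LinSystem dx du)
    (F' := Matrix (Fin dx) (Fin dx) ℝ)
    { toFun := LinSystem.A, map_add' := LinSystem.A_add, map_smul' := LinSystem.A_smul }).contDiff

theorem contDiff_linB {k : ℕ∞ω} :
    ContDiff ℝ k (LinSystem.B : LinSystem dx du → Matrix (Fin dx) (Fin du) ℝ) :=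
  (LinearMap.toContinuousLinearMap (𝕜 := ℝ) (E := LinSystem dx du)
    (F' := Matrix (Fin dx) (Fin du) ℝ)
    { toFun := LinSystem.B, map_add' := LinSystem.B_add, map_smul' := LinSystem.B_smul }).contDiff

theorem ContDiffAt.closedLoop {k : ℕ∞ω} {x : E} {θ : E → LinSystem dx du}
    {K : E → Controller dx du} (hθ : ContDiffAt ℝ k θ x) (hK : ContDiffAt ℝ k K x) :
    ContDiffAt ℝ k (fun y => closedLoop (θ y) (K y)) x :=
  (contDiff_linA.contDiffAt.comp x hθ).add ((contDiff_linB.contDiffAt.comp x hθ).matMul hK)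

theorem ContDiffAt.costMatrix {k : ℕ∞ω} {x : E} {K : E → Controller dx du}
    (Rx : Matrix (Fin dx) (Fin dx) ℝ) (Ru : Matrix (Fin du) (Fin du) ℝ)
    (hK : ContDiffAt ℝ k K x) : ContDiffAt ℝ k (fun y => costMatrix Rx Ru (K y)) x :=
  contDiffAt_const.add ((hK.matTranspose.matMul contDiffAt_const).matMul hK)

/-- The value matrix of a controller. -/
noncomputable def valueMatrix (Rx : Matrix (Fin dx) (Fin dx) ℝ) (Ru : Matrix (Fin du) (Fin du) ℝ)
    (θ : LinSystem dx du) (K : Controller dx du) : Matrix (Fin dx) (Fin dx) ℝ :=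
  dlyap (closedLoop θ K) (costMatrix Rx Ru K)

/-- The stationarity residual `Ru K + Bᵀ P_K (A + B K)` of a controller. -/
noncomputable def gainResidual (Rx : Matrix (Fin dx) (Fin dx) ℝ) (Ru : Matrix (Fin du) (Fin du) ℝ)
    (θ : LinSystem dx du) (K : Controller dx du) : Controller dx du :=
  Ru * K + (LinSystem.B θ)ᵀ * valueMatrix Rx Ru θ K * closedLoop θ K

theorem ContDiffAt.valueMatrix {k : ℕ∞ω} {x : E} {θ : E → LinSystem dx du}
    {K : E → Controller dx du} (Rx : Matrix (Fin dx) (Fin dx) ℝ)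
    (Ru : Matrix (Fin du) (Fin du) ℝ) (hθ : ContDiffAt ℝ k θ x) (hK : ContDiffAt ℝ k K x)
    (hs : Stable (_root_.closedLoop (θ x) (K x))) :
    ContDiffAt ℝ k (fun y => valueMatrix Rx Ru (θ y) (K y)) x :=
  (hθ.closedLoop hK).dlyap (hK.costMatrix Rx Ru) hs

theorem ContDiffAt.gainResidual {k : ℕ∞ω} {x : E} {θ : E → LinSystem dx du}
    {K : E → Controller dx du} (Rx : Matrix (Fin dx) (Fin dx) ℝ)
    (Ru : Matrix (Fin du) (Fin du) ℝ) (hθ : ContDiffAt ℝ k θ x) (hK : ContDiffAt ℝ k K x)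
    (hs : Stable (_root_.closedLoop (θ x) (K x))) :
    ContDiffAt ℝ k (fun y => gainResidual Rx Ru (θ y) (K y)) x :=
  (contDiffAt_const.matMul hK).add
    ((((contDiff_linB.contDiffAt.comp x hθ).matTranspose).matMul
      (hθ.valueMatrix Rx Ru hK hs)).matMul (hθ.closedLoop hK))

/-- This turns zeros of the residual at stabilizing gains into optimal pairs, with no Riccati
equation to solve. -/
theorem riccatiPair_of_residual_eq_zero {Rx : Matrix (Fin dx) (Fin dx) ℝ}
    {Ru : Matrix (Fin du) (Fin du) ℝ} (hRx : (Rx - 1).PosSemidef) (hRu : (Ru - 1).PosSemidef)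
    {θ : LinSystem dx du} {K : Controller dx du} (hs : Stable (closedLoop θ K))
    (h : gainResidual Rx Ru θ K = 0) : RiccatiPair Rx Ru θ K (valueMatrix Rx Ru θ K) where
  symm := dlyap_transpose hs (costMatrix_transpose (transpose_eq_of_posSemidef_sub_one hRx)
    (transpose_eq_of_posSemidef_sub_one hRu) K)
  nonneg := qf_dlyap_nonneg hs fun x =>
    (dotProduct_self_nonneg' x).trans (qf_costMatrix_ge hRx hRu K x)
  lyap := dlyap_eq hs _
  stationary := h

theorem RiccatiPair.valueMatrix_eq {Rx : Matrix (Fin dx) (Fin dx) ℝ}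
    {Ru : Matrix (Fin du) (Fin du) ℝ} (hRx : (Rx - 1).PosSemidef) (hRu : (Ru - 1).PosSemidef)
    {θ : LinSystem dx du} {K : Controller dx du} {P : Matrix (Fin dx) (Fin dx) ℝ}
    (h : RiccatiPair Rx Ru θ K P) : P = valueMatrix Rx Ru θ K :=
  eq_dlyap (h.stable hRx hRu) h.lyap

theorem hasDerivAt_line {F : Type*} [NormedAddCommGroup F] [NormedSpace ℝ F] (x v : F) (t : ℝ) :
    HasDerivAt (fun s : ℝ => x + s • v) v t := by
  simpa using ((hasDerivAt_id t).smul_const v).const_add x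

theorem hasDerivAt_mat_line {m n : ℕ} (x v : Matrix (Fin m) (Fin n) ℝ) (t : ℝ) :
    HasDerivAt (fun s : ℝ => x + s • v) v t := hasDerivAt_line x v t

/-- The residual at an optimal controller has derivative `(Ru + Bᵀ P B) V` in direction `V`. -/
theorem RiccatiPair.hasDerivAt_residual {Rx : Matrix (Fin dx) (Fin dx) ℝ}
    {Ru : Matrix (Fin du) (Fin du) ℝ} (hRx : (Rx - 1).PosSemidef) (hRu : (Ru - 1).PosSemidef)
    {θ : LinSystem dx du} {K : Controller dx du} {P : Matrix (Fin dx) (Fin dx) ℝ}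
    (h : RiccatiPair Rx Ru θ K P) (V : Controller dx du) :
    HasDerivAt (fun t : ℝ => gainResidual Rx Ru θ (K + t • V)) (inputGram Ru θ P * V) 0 := by
  have hRus := transpose_eq_of_posSemidef_sub_one hRu
  have hs := h.stable hRx hRu
  have hP := h.valueMatrix_eq hRx hRu
  have hK := hasDerivAt_mat_line K V 0
  have hW : HasDerivAt (fun t : ℝ => closedLoop θ (K + t • V)) (LinSystem.B θ * V) 0 := by
    refine ((hasDerivAt_const (0 : ℝ) (LinSystem.A θ)).add
      ((hasDerivAt_const (0 : ℝ) (LinSystem.B θ)).matMul hK)).congr_deriv ?_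
    simp
  have hQ : HasDerivAt (fun t : ℝ => costMatrix Rx Ru (K + t • V))
      (Vᵀ * Ru * K + Kᵀ * Ru * V) 0 := by
    refine ((hasDerivAt_const (0 : ℝ) Rx).add
      ((hK.matTranspose.matMul (hasDerivAt_const (0 : ℝ) Ru)).matMul hK)).congr_deriv ?_
    simp
  -- Envelope effect: the source of the differentiated Lyapunov equation is Vᵀ times the residual
  -- plus its transpose, so it vanishes at an optimum.
  have hX : HasDerivAt (fun t : ℝ => valueMatrix Rx Ru θ (K + t • V)) 0 0 := by
    have h1 := hasDerivAt_dlyap hW hQ (by simpa using hs)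
    have h2 : (LinSystem.B θ * V)ᵀ * P * closedLoop θ K
        + (closedLoop θ K)ᵀ * P * (LinSystem.B θ * V) + (Vᵀ * Ru * K + Kᵀ * Ru * V) = 0 := by
      have e1 := congrArg (fun M => Vᵀ * M) h.stationary
      have e2 := congrArg (fun M => Mᵀ * V) h.stationary
      simp only [Matrix.mul_add, Matrix.transpose_add, Matrix.transpose_mul, Matrix.mul_zero,
        Matrix.transpose_zero, Matrix.zero_mul, Matrix.add_mul, Matrix.transpose_transpose,
        h.symm, hRus] at e1 e2
      rw [← add_zero (0 : Matrix (Fin dx) (Fin dx) ℝ)]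
      nth_rewrite 1 [← e1]
      rw [← e2]
      simp only [Matrix.transpose_mul, Matrix.mul_assoc]
      abel
    simp only [zero_smul, add_zero] at h1
    rw [show dlyap (closedLoop θ K) (costMatrix Rx Ru K) = P from hP.symm, h2,
      dlyap_zero hs] at h1
    exact h1
  have hB := (((hasDerivAt_const (0 : ℝ) (LinSystem.B θ)ᵀ).matMul hX).matMul hW)
  refine (((hasDerivAt_const (0 : ℝ) Ru).matMul hK).add hB).congr_deriv ?_
  simp only [zero_smul, add_zero, Matrix.mul_zero, Matrix.zero_mul, zero_add, ← hP]
  rw [inputGram, Matrix.add_mul, Matrix.mul_assoc _ (LinSystem.B θ) V]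

theorem RiccatiPair.exists_smooth {Rx : Matrix (Fin dx) (Fin dx) ℝ}
    {Ru : Matrix (Fin du) (Fin du) ℝ} (hRx : (Rx - 1).PosSemidef) (hRu : (Ru - 1).PosSemidef)
    {θ : LinSystem dx du} {K : Controller dx du} {P : Matrix (Fin dx) (Fin dx) ℝ}
    (h : RiccatiPair Rx Ru θ K P) :
    ∃ ψ : LinSystem dx du → Controller dx du, ContDiffAt ℝ ω ψ θ ∧ ψ θ = K ∧
      ∀ᶠ η in 𝓝 θ, RiccatiPair Rx Ru η (ψ η) (valueMatrix Rx Ru η (ψ η)) := by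
  have hs := h.stable hRx hRu
  have hP := h.valueMatrix_eq hRx hRu
  have hsm : ContDiffAt ℝ ω (fun p : LinSystem dx du × Controller dx du =>
      gainResidual Rx Ru p.1 p.2) (θ, K) := ContDiffAt.gainResidual Rx Ru contDiffAt_fst contDiffAt_snd hs
  obtain ⟨ψ, hψ, hψθ, hψe⟩ := exists_contDiffAt_implicit hsm (by
    intro V hV
    have h1 := h.hasDerivAt_residual hRx hRu V
    have h2 : inputGram Ru θ P * V = 0 := h1.unique hV
    have hu := isUnit_of_qf_ge (qf_inputGram_ge (θ := θ) hRu h.nonneg)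
    have hu' := (Matrix.isUnit_iff_isUnit_det _).1 hu
    rw [← Matrix.nonsing_inv_mul_cancel_left _ V hu', h2, Matrix.mul_zero])
  refine ⟨ψ, hψ, hψθ, ?_⟩
  have hcont : ContinuousAt (fun η => closedLoop η (ψ η)) θ :=
    (contDiffAt_id.closedLoop hψ).continuousAt
  have hst : ∀ᶠ η in 𝓝 θ, Stable (closedLoop η (ψ η)) := by
    have h1 : Stable (closedLoop θ (ψ θ)) := by rw [show ψ θ = K from hψθ]; exact hs
    exact hcont.eventually h1.eventually
  filter_upwards [hst, hψe] with η h1 h2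
  refine riccatiPair_of_residual_eq_zero hRx hRu h1 (h2.trans ?_)
  rw [gainResidual, ← hP]
  exact h.stationary

/-- The implicit function yields optimal pairs at all nearby systems, and the optimal gain is
unique, so it coincides locally with `optDecision`. -/
theorem RiccatiPair.contDiffAt_optDecision {σ : ℝ≥0} (hσ : 0 < σ)
    {Rx : Matrix (Fin dx) (Fin dx) ℝ}
    {Ru : Matrix (Fin du) (Fin du) ℝ} (hRx : (Rx - 1).PosSemidef) (hRu : (Ru - 1).PosSemidef)
    {θ : LinSystem dx du} {K : Controller dx du} {P : Matrix (Fin dx) (Fin dx) ℝ}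
    (h : RiccatiPair Rx Ru θ K P) :
    ContDiffAt ℝ ω (optDecision (lqrRisk σ Rx Ru)) θ ∧
      ∀ᶠ η in 𝓝 θ, RiccatiPair Rx Ru η (optDecision (lqrRisk σ Rx Ru) η)
        (valueMatrix Rx Ru η (optDecision (lqrRisk σ Rx Ru) η)) := by
  obtain ⟨ψ, hψ, -, hψe⟩ := h.exists_smooth hRx hRu
  constructor
  · refine hψ.congr_of_eventuallyEq ?_
    filter_upwards [hψe] with η hη
    exact hη.optDecision_eq hσ hRx hRu
  · filter_upwards [hψe] with η hη
    rw [hη.optDecision_eq hσ hRx hRu]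
    exact hη

end SmoothOpt

/-! ### Derivatives along lines -/

section Lines

variable {E F : Type*} [NormedAddCommGroup E] [NormedSpace ℝ E] [NormedAddCommGroup F]
  [NormedSpace ℝ F]

/-- `f₁, f₂, f₃` are the successive derivatives of `f` near `0`. -/
structure DerivChain (f f₁ f₂ f₃ : ℝ → F) : Prop where
  one : ∀ᶠ t in 𝓝 (0 : ℝ), HasDerivAt f (f₁ t) t
  two : ∀ᶠ t in 𝓝 (0 : ℝ), HasDerivAt f₁ (f₂ t) t
  three : ∀ᶠ t in 𝓝 (0 : ℝ), HasDerivAt f₂ (f₃ t) t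

theorem ContDiffAt.exists_derivChain [CompleteSpace F] {f : ℝ → F} (hf : ContDiffAt ℝ ω f 0) :
    ∃ f₁ f₂ f₃, DerivChain f f₁ f₂ f₃ := by
  have h0 : AnalyticAt ℝ f 0 := hf.analyticAt
  have key : ∀ {g : ℝ → F}, AnalyticAt ℝ g 0 → ∀ᶠ t in 𝓝 (0 : ℝ), HasDerivAt g (deriv g t) t :=
    fun hg => hg.eventually_analyticAt.mono fun t ht => ht.differentiableAt.hasDerivAt
  exact ⟨deriv f, deriv (deriv f), deriv (deriv (deriv f)), key h0, key h0.deriv, key h0.deriv.deriv⟩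

theorem eventually_deriv_eq {f g f₁ g₁ : ℝ → F} (h : f =ᶠ[𝓝 0] g)
    (hf : ∀ᶠ t in 𝓝 (0 : ℝ), HasDerivAt f (f₁ t) t)
    (hg : ∀ᶠ t in 𝓝 (0 : ℝ), HasDerivAt g (g₁ t) t) : f₁ =ᶠ[𝓝 0] g₁ := by
  filter_upwards [h.eventually_nhds, hf, hg] with t h1 h2 h3
  exact h2.unique (h3.congr_of_eventuallyEq h1)

theorem hasDerivAt_iteratedFDeriv_line {f : E → F} {x δ : E} {t : ℝ}
    (hf : ContDiffAt ℝ ω f (x + t • δ)) (k : ℕ) :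
    HasDerivAt (fun s : ℝ => iteratedFDeriv ℝ k f (x + s • δ) fun _ => δ)
      (iteratedFDeriv ℝ (k + 1) f (x + t • δ) fun _ => δ) t := by
  have h1 : DifferentiableAt ℝ (iteratedFDeriv ℝ k f) (x + t • δ) :=
    (hf.of_le (m := (k + 1 : ℕ)) le_top).differentiableAt_iteratedFDeriv
      (by exact_mod_cast Nat.lt_succ_self k)
  have h2 := h1.hasFDerivAt.comp_hasDerivAt t (hasDerivAt_line x δ t)
  have h3 := (ContinuousMultilinearMap.apply ℝ (fun _ : Fin k => E) F fun _ => δ).hasFDerivAt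
    (x := iteratedFDeriv ℝ k f (x + t • δ)) |>.comp_hasDerivAt t h2
  convert! h3 using 1

theorem ContDiffAt.eventually_line {f : E → F} {x δ : E} (hf : ContDiffAt ℝ ω f x) :
    ∀ᶠ t in 𝓝 (0 : ℝ), ContDiffAt ℝ ω f (x + t • δ) := by
  have hc : ContinuousAt (fun t : ℝ => x + t • δ) 0 := by fun_prop
  refine hc.eventually ?_
  simp only [zero_smul, add_zero]
  exact hf.eventually (by simp)

/-- Reduces the diagonal values of the first three derivatives to successive derivatives of a curve,
which can be computed by any means. -/
theorem iteratedFDeriv_line_eq {f : E → F} {x δ : E} (hf : ContDiffAt ℝ ω f x)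
    {φ φ₁ φ₂ φ₃ : ℝ → F} (h : DerivChain φ φ₁ φ₂ φ₃)
    (h0 : ∀ᶠ t in 𝓝 (0 : ℝ), f (x + t • δ) = φ t) :
    fderiv ℝ f x δ = φ₁ 0 ∧ iteratedFDeriv ℝ 2 f x (fun _ => δ) = φ₂ 0 ∧
      iteratedFDeriv ℝ 3 f x (fun _ => δ) = φ₃ 0 := by
  set G : ℕ → ℝ → F := fun k t => iteratedFDeriv ℝ k f (x + t • δ) fun _ => δ with hG
  have hGd : ∀ k, ∀ᶠ t in 𝓝 (0 : ℝ), HasDerivAt (G k) (G (k + 1) t) t := fun k =>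
    hf.eventually_line.mono fun t ht => hasDerivAt_iteratedFDeriv_line ht k
  have e0 : G 0 =ᶠ[𝓝 0] φ := by
    filter_upwards [h0] with t ht
    simpa [hG] using ht
  have e1 := eventually_deriv_eq e0 (hGd 0) h.one
  have e2 := eventually_deriv_eq e1 (hGd 1) h.two
  have e3 := eventually_deriv_eq e2 (hGd 2) h.three
  have r1 := e1.self_of_nhds
  have r2 := e2.self_of_nhds
  have r3 := e3.self_of_nhds
  simp only [hG, zero_smul, add_zero] at r1 r2 r3
  refine ⟨?_, r2, r3⟩
  rw [← r1, zero_add, iteratedFDeriv_one_apply]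

end Lines

/-! ### Derivatives of the Riccati solution in normalized coordinates -/

section NormalizedJets

variable {n m : ℕ}

theorem norm_mul_le_of_opNorm_le_one {l : ℕ} {A : Matrix (Fin l) (Fin m) ℝ} (hA : opNorm A ≤ 1)
    (M : Matrix (Fin m) (Fin n) ℝ) : ‖A * M‖ ≤ ‖M‖ :=
  (norm_mul_le_opNorm_left A M).trans (mul_le_of_le_one_left (norm_nonneg _) hA)

theorem norm_mul_le_of_opNorm_le_one' {l : ℕ} {A : Matrix (Fin m) (Fin n) ℝ} (hA : opNorm A ≤ 1)
    (M : Matrix (Fin l) (Fin m) ℝ) : ‖M * A‖ ≤ ‖M‖ :=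
  (norm_mul_le_opNorm_right M A).trans (mul_le_of_le_one_right (norm_nonneg _) hA)

/-- Solutions of the Lyapunov equation of a strict contraction. -/
theorem norm_le_of_lyap {w p M : Matrix (Fin n) (Fin n) ℝ} {Ψ : ℝ} (hΨ : 1 ≤ Ψ)
    (hw : opNorm w ^ 2 ≤ 1 - 1 / Ψ) (h : p = wᵀ * p * w + M) : ‖p‖ ≤ Ψ * ‖M‖ := by
  have h0 : 0 < Ψ := by linarith
  have h1 : ‖p‖ ≤ opNorm w ^ 2 * ‖p‖ + ‖M‖ := by
    calc ‖p‖ = ‖wᵀ * p * w + M‖ := by rw [← h]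
      _ ≤ ‖wᵀ * p * w‖ + ‖M‖ := norm_add_le _ _
      _ ≤ ‖wᵀ * p‖ * opNorm w + ‖M‖ := by gcongr; exact norm_mul_le_opNorm_right _ _
      _ ≤ (opNorm wᵀ * ‖p‖) * opNorm w + ‖M‖ := by
          gcongr
          · exact opNorm_nonneg _
          · exact norm_mul_le_opNorm_left _ _
      _ = _ := by rw [opNorm_transpose]; ring
  have h2 : opNorm w ^ 2 * ‖p‖ ≤ (1 - 1 / Ψ) * ‖p‖ :=
    mul_le_mul_of_nonneg_right hw (norm_nonneg _)
  have h3 : 1 / Ψ * ‖p‖ ≤ ‖M‖ := by linarith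
  rw [one_div, inv_mul_le_iff₀ h0] at h3
  exact h3

theorem norm_add_transpose_le (M : Matrix (Fin n) (Fin n) ℝ) : ‖M + Mᵀ‖ ≤ 2 * ‖M‖ := by
  have := norm_add_le M Mᵀ
  rw [Matrix.frobenius_norm_transpose] at this
  linarith

/-- Bounds for the jet of the solution of the normalized optimality equations. -/
theorem normalized_jet_bounds {w d p₁ p₂ p₃ w₁ w₂ z₁ z₂ : Matrix (Fin n) (Fin n) ℝ}
    {β e : Matrix (Fin n) (Fin m) ℝ} {ρ : Matrix (Fin m) (Fin m) ℝ}
    {k₁ k₂ k₃ : Matrix (Fin m) (Fin n) ℝ} {Ψ : ℝ} (hΨ : 1 ≤ Ψ)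
    (hw : opNorm w ^ 2 ≤ 1 - 1 / Ψ) (hβ : opNorm β ≤ 1) (hρ : ρ + βᵀ * β = 1)
    (hd : ‖d‖ ≤ Ψ) (he : ‖e‖ ≤ Ψ)
    (hw₁ : w₁ = d + β * k₁) (hw₂ : w₂ = (2 : ℝ) • (e * k₁) + β * k₂)
    (hz₁ : z₁ = p₁ * w + w₁) (hz₂ : z₂ = p₂ * w + (2 : ℝ) • (p₁ * w₁) + w₂)
    (hp₁ : p₁ = wᵀ * p₁ * w + (dᵀ * w + (dᵀ * w)ᵀ))
    (hp₂ : p₂ = wᵀ * p₂ * w + ((w₁ᵀ * p₁ * w + (w₁ᵀ * p₁ * w)ᵀ)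
      + (((e * k₁)ᵀ * w + dᵀ * z₁) + ((e * k₁)ᵀ * w + dᵀ * z₁)ᵀ)))
    (hp₃ : p₃ = wᵀ * p₃ * w + ((((2 : ℝ) • (w₁ᵀ * p₂ * w) + w₂ᵀ * p₁ * w + w₁ᵀ * p₁ * w₁)
        + ((2 : ℝ) • (w₁ᵀ * p₂ * w) + w₂ᵀ * p₁ * w + w₁ᵀ * p₁ * w₁)ᵀ)
      + (((e * k₂)ᵀ * w + (2 : ℝ) • ((e * k₁)ᵀ * z₁) + dᵀ * z₂)
        + ((e * k₂)ᵀ * w + (2 : ℝ) • ((e * k₁)ᵀ * z₁) + dᵀ * z₂)ᵀ)))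
    (hk₁ : ρ * k₁ + eᵀ * w + βᵀ * z₁ = 0)
    (hk₂ : ρ * k₂ + (2 : ℝ) • (eᵀ * z₁) + βᵀ * z₂ = 0)
    (hk₃ : ρ * k₃ + (3 : ℝ) • (eᵀ * z₂) + βᵀ * (p₃ * w + (3 : ℝ) • (p₂ * w₁)
      + (3 : ℝ) • (p₁ * w₂) + ((3 : ℝ) • (e * k₂) + β * k₃)) = 0) :
    ‖k₁‖ ≤ 4 * Ψ ^ 2 ∧ ‖k₂‖ ≤ 84 * Ψ ^ 5 ∧ ‖k₃‖ ≤ 3792 * Ψ ^ 8 := by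
  have h0 : 0 ≤ Ψ := by linarith
  have hw1 : opNorm w ≤ 1 := by
    have : opNorm w ^ 2 ≤ 1 ^ 2 := by
      have : 0 ≤ 1 / Ψ := by positivity
      linarith
    exact le_of_sq_le_sq this zero_le_one
  have hβt : opNorm βᵀ ≤ 1 := by rwa [opNorm_transpose]
  -- Since Ψ ≥ 1, lower powers are rounded up to the leading one, and each estimate becomes an
  -- addition of integer coefficients.
  have pw : ∀ a b : ℕ, a ≤ b → Ψ ^ a ≤ Ψ ^ b := fun a b h => pow_le_pow_right₀ hΨ h
  have P12 := pw 1 2 (by norm_num)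
  have P35 := pw 3 5 (by norm_num)
  have P25 := pw 2 5 (by norm_num)
  have P34 := pw 3 4 (by norm_num)
  have P45 := pw 4 5 (by norm_num)
  have P56 := pw 5 6 (by norm_num)
  have P67 := pw 6 7 (by norm_num)
  have P68 := pw 6 8 (by norm_num)
  have P78 := pw 7 8 (by norm_num)
  rw [pow_one] at P12
  have tr : ∀ {a b : ℕ} (M : Matrix (Fin a) (Fin b) ℝ), ‖Mᵀ‖ = ‖M‖ :=
    fun M => Matrix.frobenius_norm_transpose M
  have mm : ∀ {a b c : ℕ} (M : Matrix (Fin a) (Fin b) ℝ) (N : Matrix (Fin b) (Fin c) ℝ)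
      {x y : ℝ}, ‖M‖ ≤ x → ‖N‖ ≤ y → ‖M * N‖ ≤ x * y := fun M N x y hM hN =>
    (Matrix.frobenius_norm_mul M N).trans
      (mul_le_mul hM hN (norm_nonneg _) ((norm_nonneg _).trans hM))
  -- In every order the unknown k enters as ρk + βᵀβk, which is k itself by the normalization.
  have solve : ∀ {k r : Matrix (Fin m) (Fin n) ℝ}, ρ * k + βᵀ * (β * k) + r = 0 → k = -r := by
    intro k r h
    rw [← Matrix.mul_assoc, ← Matrix.add_mul, hρ, Matrix.one_mul] at h
    exact eq_neg_of_add_eq_zero_left h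
  have sm : ∀ {a b : ℕ} (c : ℝ) (M : Matrix (Fin a) (Fin b) ℝ), 0 ≤ c → ‖c • M‖ = c * ‖M‖ :=
    fun c M hc => by rw [norm_smul, Real.norm_eq_abs, abs_of_nonneg hc]
  -- first order
  have bp₁ : ‖p₁‖ ≤ 2 * Ψ ^ 2 := by
    have h1 := norm_le_of_lyap hΨ hw hp₁
    have h2 := norm_add_transpose_le (dᵀ * w)
    have h3 := norm_mul_le_of_opNorm_le_one' hw1 dᵀ
    rw [tr] at h3
    nlinarith
  have bk₁ : ‖k₁‖ ≤ 4 * Ψ ^ 2 := by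
    have e1 : k₁ = -(eᵀ * w + βᵀ * (p₁ * w + d)) := solve (by
      rw [← hk₁, hz₁, hw₁]; simp only [Matrix.mul_add]; abel)
    have h1 : ‖k₁‖ ≤ ‖eᵀ * w‖ + ‖βᵀ * (p₁ * w + d)‖ := by
      rw [e1, norm_neg]; exact norm_add_le _ _
    have h2 := norm_mul_le_of_opNorm_le_one' hw1 eᵀ
    rw [tr] at h2
    have h3 := norm_mul_le_of_opNorm_le_one hβt (p₁ * w + d)
    have h4 := norm_add_le (p₁ * w) d
    have h5 := norm_mul_le_of_opNorm_le_one' hw1 p₁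
    linarith
  have bw₁ : ‖w₁‖ ≤ 5 * Ψ ^ 2 := by
    have h1 : ‖w₁‖ ≤ ‖d‖ + ‖β * k₁‖ := by rw [hw₁]; exact norm_add_le _ _
    have h2 := norm_mul_le_of_opNorm_le_one hβ k₁
    linarith
  have bz₁ : ‖z₁‖ ≤ 7 * Ψ ^ 2 := by
    have h1 : ‖z₁‖ ≤ ‖p₁ * w‖ + ‖w₁‖ := by rw [hz₁]; exact norm_add_le _ _
    have h2 := norm_mul_le_of_opNorm_le_one' hw1 p₁
    linarith
  have bek₁ : ‖e * k₁‖ ≤ 4 * Ψ ^ 3 := (mm e k₁ he bk₁).trans (le_of_eq (by ring))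
  -- second order
  have bp₂ : ‖p₂‖ ≤ 42 * Ψ ^ 5 := by
    have h1 := norm_le_of_lyap hΨ hw hp₂
    have h2 := norm_add_transpose_le (w₁ᵀ * p₁ * w)
    have h3 := norm_mul_le_of_opNorm_le_one' hw1 (w₁ᵀ * p₁)
    have h4 := mm w₁ᵀ p₁ ((tr _).trans_le bw₁) bp₁
    have h5 := norm_add_transpose_le ((e * k₁)ᵀ * w + dᵀ * z₁)
    have h6 := norm_add_le ((e * k₁)ᵀ * w) (dᵀ * z₁)
    have h7 := norm_mul_le_of_opNorm_le_one' hw1 (e * k₁)ᵀ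
    rw [tr (e * k₁)] at h7
    have h8 := mm dᵀ z₁ ((tr _).trans_le hd) bz₁
    refine h1.trans ?_
    have h9 := norm_add_le (w₁ᵀ * p₁ * w + (w₁ᵀ * p₁ * w)ᵀ)
      (((e * k₁)ᵀ * w + dᵀ * z₁) + ((e * k₁)ᵀ * w + dᵀ * z₁)ᵀ)
    -- The coefficient is 42 = 2·10 + 2·(4 + 7).
    have h10 : 5 * Ψ ^ 2 * (2 * Ψ ^ 2) = 10 * Ψ ^ 4 := by ring
    have h11 : Ψ * (7 * Ψ ^ 2) = 7 * Ψ ^ 3 := by ring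
    calc _ ≤ Ψ * (42 * Ψ ^ 4) := mul_le_mul_of_nonneg_left (by linarith) h0
      _ = _ := by ring
  have bp₁w₁ : ‖p₁ * w₁‖ ≤ 10 * Ψ ^ 4 := (mm p₁ w₁ bp₁ bw₁).trans (le_of_eq (by ring))
  have bez₁ : ‖eᵀ * z₁‖ ≤ 7 * Ψ ^ 3 :=
    (mm eᵀ z₁ ((tr _).trans_le he) bz₁).trans (le_of_eq (by ring))
  have bk₂ : ‖k₂‖ ≤ 84 * Ψ ^ 5 := by
    have e1 : k₂ = -((2 : ℝ) • (eᵀ * z₁)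
        + βᵀ * (p₂ * w + (2 : ℝ) • (p₁ * w₁) + (2 : ℝ) • (e * k₁))) := solve (by
      rw [← hk₂, hz₂, hw₂]; simp only [Matrix.mul_add]; abel)
    have h1 : ‖k₂‖ ≤ ‖(2 : ℝ) • (eᵀ * z₁)‖
        + ‖βᵀ * (p₂ * w + (2 : ℝ) • (p₁ * w₁) + (2 : ℝ) • (e * k₁))‖ := by
      rw [e1, norm_neg]; exact norm_add_le _ _
    have h3 := norm_mul_le_of_opNorm_le_one hβt
      (p₂ * w + (2 : ℝ) • (p₁ * w₁) + (2 : ℝ) • (e * k₁))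
    have h4 := norm_add₃_le (a := p₂ * w) (b := (2 : ℝ) • (p₁ * w₁)) (c := (2 : ℝ) • (e * k₁))
    have h5 := norm_mul_le_of_opNorm_le_one' hw1 p₂
    rw [sm _ _ (by norm_num)] at h1
    rw [sm _ _ (by norm_num), sm _ _ (by norm_num)] at h4
    linarith
  have bw₂ : ‖w₂‖ ≤ 92 * Ψ ^ 5 := by
    have h1 : ‖w₂‖ ≤ ‖(2 : ℝ) • (e * k₁)‖ + ‖β * k₂‖ := by rw [hw₂]; exact norm_add_le _ _
    have h2 := norm_mul_le_of_opNorm_le_one hβ k₂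
    rw [sm _ _ (by norm_num)] at h1
    linarith
  have bz₂ : ‖z₂‖ ≤ 154 * Ψ ^ 5 := by
    have h1 : ‖z₂‖ ≤ ‖p₂ * w‖ + ‖(2 : ℝ) • (p₁ * w₁)‖ + ‖w₂‖ := by
      rw [hz₂]; exact norm_add₃_le
    have h2 := norm_mul_le_of_opNorm_le_one' hw1 p₂
    rw [sm _ _ (by norm_num)] at h1
    linarith
  -- third order
  have bp₃ : ‖p₃‖ ≤ 1896 * Ψ ^ 8 := by
    have h1 := norm_le_of_lyap hΨ hw hp₃
    set M := (2 : ℝ) • (w₁ᵀ * p₂ * w) + w₂ᵀ * p₁ * w + w₁ᵀ * p₁ * w₁ with hM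
    set N := (e * k₂)ᵀ * w + (2 : ℝ) • ((e * k₁)ᵀ * z₁) + dᵀ * z₂ with hN
    have h2 := norm_add_le (M + Mᵀ) (N + Nᵀ)
    have h3 := norm_add_transpose_le M
    have h4 := norm_add_transpose_le N
    have hM1 : ‖M‖ ≤ ‖(2 : ℝ) • (w₁ᵀ * p₂ * w)‖ + ‖w₂ᵀ * p₁ * w‖ + ‖w₁ᵀ * p₁ * w₁‖ :=
      norm_add₃_le
    have hN1 : ‖N‖ ≤ ‖(e * k₂)ᵀ * w‖ + ‖(2 : ℝ) • ((e * k₁)ᵀ * z₁)‖ + ‖dᵀ * z₂‖ :=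
      norm_add₃_le
    rw [sm _ _ (by norm_num)] at hM1 hN1
    have m1 := (norm_mul_le_of_opNorm_le_one' hw1 (w₁ᵀ * p₂)).trans
      (mm w₁ᵀ p₂ ((tr _).trans_le bw₁) bp₂)
    have m2 := (norm_mul_le_of_opNorm_le_one' hw1 (w₂ᵀ * p₁)).trans
      (mm w₂ᵀ p₁ ((tr _).trans_le bw₂) bp₁)
    have m3 := mm (w₁ᵀ * p₁) w₁ (mm w₁ᵀ p₁ ((tr _).trans_le bw₁) bp₁) bw₁
    have n1 := (norm_mul_le_of_opNorm_le_one' hw1 (e * k₂)ᵀ).trans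
      ((tr (e * k₂)).trans_le (mm e k₂ he bk₂))
    have n2 := mm (e * k₁)ᵀ z₁ ((tr (e * k₁)).trans_le bek₁) bz₁
    have n3 := mm dᵀ z₂ ((tr _).trans_le hd) bz₂
    have a1 : 5 * Ψ ^ 2 * (42 * Ψ ^ 5) = 210 * Ψ ^ 7 := by ring
    have a2 : 92 * Ψ ^ 5 * (2 * Ψ ^ 2) = 184 * Ψ ^ 7 := by ring
    have a3 : 5 * Ψ ^ 2 * (2 * Ψ ^ 2) * (5 * Ψ ^ 2) = 50 * Ψ ^ 6 := by ring
    have a4 : Ψ * (84 * Ψ ^ 5) = 84 * Ψ ^ 6 := by ring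
    have a5 : 4 * Ψ ^ 3 * (7 * Ψ ^ 2) = 28 * Ψ ^ 5 := by ring
    have a6 : Ψ * (154 * Ψ ^ 5) = 154 * Ψ ^ 6 := by ring
    -- The coefficient is 1896 = 2·(2·210 + 184 + 50) + 2·(84 + 2·28 + 154).
    calc _ ≤ Ψ * ‖M + Mᵀ + (N + Nᵀ)‖ := h1
      _ ≤ Ψ * (1896 * Ψ ^ 7) := mul_le_mul_of_nonneg_left (by linarith) h0
      _ = _ := by ring
  refine ⟨bk₁, bk₂, ?_⟩
  have e1 : k₃ = -((3 : ℝ) • (eᵀ * z₂)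
      + βᵀ * (p₃ * w + (3 : ℝ) • (p₂ * w₁) + (3 : ℝ) • (p₁ * w₂) + (3 : ℝ) • (e * k₂))) :=
    solve (by rw [← hk₃]; simp only [Matrix.mul_add]; abel)
  have h1 : ‖k₃‖ ≤ ‖(3 : ℝ) • (eᵀ * z₂)‖ + ‖βᵀ * (p₃ * w + (3 : ℝ) • (p₂ * w₁)
      + (3 : ℝ) • (p₁ * w₂) + (3 : ℝ) • (e * k₂))‖ := by
    conv_lhs => rw [e1, norm_neg]
    exact norm_add_le _ _
  have h2 := norm_mul_le_of_opNorm_le_one hβt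
    (p₃ * w + (3 : ℝ) • (p₂ * w₁) + (3 : ℝ) • (p₁ * w₂) + (3 : ℝ) • (e * k₂))
  have h3 := norm_add_le (p₃ * w + (3 : ℝ) • (p₂ * w₁) + (3 : ℝ) • (p₁ * w₂))
    ((3 : ℝ) • (e * k₂))
  have h4 := norm_add₃_le (a := p₃ * w) (b := (3 : ℝ) • (p₂ * w₁)) (c := (3 : ℝ) • (p₁ * w₂))
  have h5 := norm_mul_le_of_opNorm_le_one' hw1 p₃
  rw [sm _ _ (by norm_num)] at h1 h3
  rw [sm _ _ (by norm_num), sm _ _ (by norm_num)] at h4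
  have m1 := mm eᵀ z₂ ((tr _).trans_le he) bz₂
  have m2 := mm p₂ w₁ bp₂ bw₁
  have m3 := mm p₁ w₂ bp₁ bw₂
  have m4 := mm e k₂ he bk₂
  have a1 : Ψ * (154 * Ψ ^ 5) = 154 * Ψ ^ 6 := by ring
  have a2 : 42 * Ψ ^ 5 * (5 * Ψ ^ 2) = 210 * Ψ ^ 7 := by ring
  have a3 : 2 * Ψ ^ 2 * (92 * Ψ ^ 5) = 184 * Ψ ^ 7 := by ring
  have a4 : Ψ * (84 * Ψ ^ 5) = 84 * Ψ ^ 6 := by ring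
  -- The coefficient is 3792 = 3·154 + 1896 + 3·210 + 3·184 + 3·84.
  linarith

end NormalizedJets

/-! ### The optimality equations differentiated along a line of systems -/

section RiccatiCurve

variable {n m : ℕ}

theorem hasDerivAt_congr_mat {a b : ℕ} {f : ℝ → Matrix (Fin a) (Fin b) ℝ} {f' g' t}
    (h : HasDerivAt f f' t) (e : f' = g') : HasDerivAt f g' t := e ▸ h

/-- Differentiating the optimality equations along a line of systems. -/
theorem riccati_curve_jet {K K₁ K₂ K₃ : ℝ → Matrix (Fin m) (Fin n) ℝ}
    {P P₁ P₂ P₃ : ℝ → Matrix (Fin n) (Fin n) ℝ} (hK : DerivChain K K₁ K₂ K₃)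
    (hP : DerivChain P P₁ P₂ P₃) {A a Rx : Matrix (Fin n) (Fin n) ℝ}
    {B b : Matrix (Fin n) (Fin m) ℝ} {Ru : Matrix (Fin m) (Fin m) ℝ} (hRu : Ruᵀ = Ru)
    (hsym : ∀ᶠ t in 𝓝 (0 : ℝ), (P t)ᵀ = P t)
    (hlyap : ∀ᶠ t in 𝓝 (0 : ℝ), P t = (A + t • a + (B + t • b) * K t)ᵀ * P t
      * (A + t • a + (B + t • b) * K t) + (Rx + (K t)ᵀ * Ru * K t))
    (hstat : ∀ᶠ t in 𝓝 (0 : ℝ),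
      Ru * K t + (B + t • b)ᵀ * P t * (A + t • a + (B + t • b) * K t) = 0)
    {W D W₁ W₂ Z₁ Z₂ : Matrix (Fin n) (Fin n) ℝ}
    (hW : W = A + B * K 0) (hD : D = a + b * K 0)
    (hW₁ : W₁ = D + B * K₁ 0) (hW₂ : W₂ = (2 : ℝ) • (b * K₁ 0) + B * K₂ 0)
    (hZ₁ : Z₁ = P₁ 0 * W + P 0 * W₁)
    (hZ₂ : Z₂ = P₂ 0 * W + (2 : ℝ) • (P₁ 0 * W₁) + P 0 * W₂) :
    (P₁ 0 = Wᵀ * P₁ 0 * W + (Dᵀ * (P 0 * W) + (Dᵀ * (P 0 * W))ᵀ)) ∧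
    (P₂ 0 = Wᵀ * P₂ 0 * W + ((W₁ᵀ * P₁ 0 * W + (W₁ᵀ * P₁ 0 * W)ᵀ)
      + (((b * K₁ 0)ᵀ * (P 0 * W) + Dᵀ * Z₁) + ((b * K₁ 0)ᵀ * (P 0 * W) + Dᵀ * Z₁)ᵀ))) ∧
    (P₃ 0 = Wᵀ * P₃ 0 * W + ((((2 : ℝ) • (W₁ᵀ * P₂ 0 * W) + W₂ᵀ * P₁ 0 * W + W₁ᵀ * P₁ 0 * W₁)
        + ((2 : ℝ) • (W₁ᵀ * P₂ 0 * W) + W₂ᵀ * P₁ 0 * W + W₁ᵀ * P₁ 0 * W₁)ᵀ)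
      + (((b * K₂ 0)ᵀ * (P 0 * W) + (2 : ℝ) • ((b * K₁ 0)ᵀ * Z₁) + Dᵀ * Z₂)
        + ((b * K₂ 0)ᵀ * (P 0 * W) + (2 : ℝ) • ((b * K₁ 0)ᵀ * Z₁) + Dᵀ * Z₂)ᵀ))) ∧
    (Ru * K₁ 0 + bᵀ * (P 0 * W) + Bᵀ * Z₁ = 0) ∧
    (Ru * K₂ 0 + (2 : ℝ) • (bᵀ * Z₁) + Bᵀ * Z₂ = 0) ∧
    (Ru * K₃ 0 + (3 : ℝ) • (bᵀ * Z₂) + Bᵀ * (P₃ 0 * W + (3 : ℝ) • (P₂ 0 * W₁)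
      + (3 : ℝ) • (P₁ 0 * W₂) + P 0 * ((3 : ℝ) • (b * K₂ 0) + B * K₃ 0)) = 0) := by
  set Bt : ℝ → Matrix (Fin n) (Fin m) ℝ := fun t => B + t • b with hBt
  set w : ℝ → Matrix (Fin n) (Fin n) ℝ := fun t => A + t • a + Bt t * K t with hw
  set d : ℝ → Matrix (Fin n) (Fin n) ℝ := fun t => a + b * K t with hd
  set w₁ : ℝ → Matrix (Fin n) (Fin n) ℝ := fun t => d t + Bt t * K₁ t with hw₁
  set w₂ : ℝ → Matrix (Fin n) (Fin n) ℝ :=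
    fun t => (2 : ℝ) • (b * K₁ t) + Bt t * K₂ t with hw₂
  set w₃ : ℝ → Matrix (Fin n) (Fin n) ℝ :=
    fun t => (3 : ℝ) • (b * K₂ t) + Bt t * K₃ t with hw₃
  set z : ℝ → Matrix (Fin n) (Fin n) ℝ := fun t => P t * w t with hz
  set z₁ : ℝ → Matrix (Fin n) (Fin n) ℝ := fun t => P₁ t * w t + P t * w₁ t with hz₁
  set z₂ : ℝ → Matrix (Fin n) (Fin n) ℝ :=
    fun t => P₂ t * w t + (2 : ℝ) • (P₁ t * w₁ t) + P t * w₂ t with hz₂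
  set z₃ : ℝ → Matrix (Fin n) (Fin n) ℝ :=
    fun t => P₃ t * w t + (3 : ℝ) • (P₂ t * w₁ t) + (3 : ℝ) • (P₁ t * w₂ t) + P t * w₃ t with hz₃
  have two : ∀ {i j : ℕ} (M : Matrix (Fin i) (Fin j) ℝ), (2 : ℝ) • M = M + M :=
    fun M => two_smul ℝ M
  have three : ∀ {i j : ℕ} (M : Matrix (Fin i) (Fin j) ℝ), (3 : ℝ) • M = M + M + M := fun M => by
    rw [show (3 : ℝ) = 2 + 1 by norm_num, add_smul, two_smul, one_smul]
  have c : ∀ {i j : ℕ} (M : Matrix (Fin i) (Fin j) ℝ) (t : ℝ),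
      HasDerivAt (fun _ : ℝ => M) 0 t := fun M t => hasDerivAt_const t M
  have hK1 : ∀ᶠ t in 𝓝 (0 : ℝ), HasDerivAt K (K₁ t) t := hK.one
  have hK2 : ∀ᶠ t in 𝓝 (0 : ℝ), HasDerivAt K₁ (K₂ t) t := hK.two
  have hK3 : ∀ᶠ t in 𝓝 (0 : ℝ), HasDerivAt K₂ (K₃ t) t := hK.three
  have hP1 : ∀ᶠ t in 𝓝 (0 : ℝ), HasDerivAt P (P₁ t) t := hP.one
  have hP2 : ∀ᶠ t in 𝓝 (0 : ℝ), HasDerivAt P₁ (P₂ t) t := hP.two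
  have hP3 : ∀ᶠ t in 𝓝 (0 : ℝ), HasDerivAt P₂ (P₃ t) t := hP.three
  have dB : ∀ t, HasDerivAt Bt b t := fun t => hasDerivAt_mat_line B b t
  have dw : ∀ᶠ t in 𝓝 (0 : ℝ), HasDerivAt w (w₁ t) t := by
    filter_upwards [hK1] with t h
    refine hasDerivAt_congr_mat ((hasDerivAt_mat_line A a t).add ((dB t).matMul h)) ?_
    simp only [hw₁, hd]; abel
  have dd : ∀ᶠ t in 𝓝 (0 : ℝ), HasDerivAt d (b * K₁ t) t := by
    filter_upwards [hK1] with t h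
    refine hasDerivAt_congr_mat ((c a t).add ((c b t).matMul h)) ?_
    simp
  have dd₁ : ∀ᶠ t in 𝓝 (0 : ℝ), HasDerivAt (fun t => b * K₁ t) (b * K₂ t) t := by
    filter_upwards [hK2] with t h
    exact hasDerivAt_congr_mat ((c b t).matMul h) (by simp)
  have dw₁ : ∀ᶠ t in 𝓝 (0 : ℝ), HasDerivAt w₁ (w₂ t) t := by
    filter_upwards [dd, hK2] with t h1 h2
    refine hasDerivAt_congr_mat (h1.add ((dB t).matMul h2)) ?_
    simp only [hw₂, two]; abel
  have dw₂ : ∀ᶠ t in 𝓝 (0 : ℝ), HasDerivAt w₂ (w₃ t) t := by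
    filter_upwards [dd₁, hK3] with t h1 h2
    refine hasDerivAt_congr_mat ((h1.const_smul (2 : ℝ)).add ((dB t).matMul h2)) ?_
    simp only [hw₃, two, three]; abel
  have dz : ∀ᶠ t in 𝓝 (0 : ℝ), HasDerivAt z (z₁ t) t := by
    filter_upwards [dw, hP1] with t h1 h2
    exact h2.matMul h1
  have dz₁ : ∀ᶠ t in 𝓝 (0 : ℝ), HasDerivAt z₁ (z₂ t) t := by
    filter_upwards [dw, dw₁, hP1, hP2] with t h1 h2 h3 h4
    refine hasDerivAt_congr_mat ((h4.matMul h1).add (h3.matMul h2)) ?_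
    simp only [hz₂, two]; abel
  have dz₂ : ∀ᶠ t in 𝓝 (0 : ℝ), HasDerivAt z₂ (z₃ t) t := by
    filter_upwards [dw, dw₁, dw₂, hP1, hP2, hP3] with t h1 h2 h3 h4 h5 h6
    refine hasDerivAt_congr_mat (((h6.matMul h1).add
      ((h5.matMul h2).const_smul (2 : ℝ))).add (h4.matMul h3)) ?_
    simp only [hz₃, two, three]; abel
  -- stationarity
  have s0 : (fun t => Ru * K t + (Bt t)ᵀ * z t) =ᶠ[𝓝 0] fun _ => 0 := by
    filter_upwards [hstat] with t h
    simpa only [hz, Matrix.mul_assoc] using h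
  have s1 : (fun t => Ru * K₁ t + bᵀ * z t + (Bt t)ᵀ * z₁ t) =ᶠ[𝓝 0] fun _ => 0 := by
    refine eventually_deriv_eq s0 ?_ (Eventually.of_forall fun t => c _ t)
    filter_upwards [hK1, dz] with t h1 h2
    refine hasDerivAt_congr_mat (((c Ru t).matMul h1).add ((dB t).matTranspose.matMul h2)) ?_
    simp only [Matrix.zero_mul, zero_add]; abel
  have s2 : (fun t => Ru * K₂ t + (2 : ℝ) • (bᵀ * z₁ t) + (Bt t)ᵀ * z₂ t)
      =ᶠ[𝓝 0] fun _ => 0 := by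
    refine eventually_deriv_eq s1 ?_ (Eventually.of_forall fun t => c _ t)
    filter_upwards [hK2, dz, dz₁] with t h1 h2 h3
    refine hasDerivAt_congr_mat ((((c Ru t).matMul h1).add ((c bᵀ t).matMul h2)).add
      ((dB t).matTranspose.matMul h3)) ?_
    simp only [Matrix.zero_mul, zero_add, two]; abel
  have s3 : (fun t => Ru * K₃ t + (3 : ℝ) • (bᵀ * z₂ t) + (Bt t)ᵀ * z₃ t)
      =ᶠ[𝓝 0] fun _ => 0 := by
    refine eventually_deriv_eq s2 ?_ (Eventually.of_forall fun t => c _ t)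
    filter_upwards [hK3, dz₁, dz₂] with t h1 h2 h3
    refine hasDerivAt_congr_mat ((((c Ru t).matMul h1).add
      (((c bᵀ t).matMul h2).const_smul (2 : ℝ))).add ((dB t).matTranspose.matMul h3)) ?_
    simp only [Matrix.zero_mul, zero_add, two, three]; abel
  -- symmetry
  have y1 : (fun t => (P₁ t)ᵀ) =ᶠ[𝓝 0] P₁ :=
    eventually_deriv_eq hsym (hP1.mono fun t h => h.matTranspose) hP1
  have y2 : (fun t => (P₂ t)ᵀ) =ᶠ[𝓝 0] P₂ :=
    eventually_deriv_eq y1 (hP2.mono fun t h => h.matTranspose) hP2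
  -- Lyapunov equations
  have l1 : P₁ =ᶠ[𝓝 0] fun t => (w t)ᵀ * P₁ t * w t
      + ((d t)ᵀ * z t + ((d t)ᵀ * z t)ᵀ) := by
    have e : P₁ =ᶠ[𝓝 0] fun t => ((w₁ t)ᵀ * P t + (w t)ᵀ * P₁ t) * w t + (w t)ᵀ * P t * w₁ t
        + ((K₁ t)ᵀ * Ru * K t + (K t)ᵀ * Ru * K₁ t) := by
      refine eventually_deriv_eq hlyap hP1 ?_
      filter_upwards [hK1, hP1, dw] with t h1 h2 h3
      refine hasDerivAt_congr_mat (((h3.matTranspose.matMul h2).matMul h3).add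
        ((c Rx t).add ((h1.matTranspose.matMul (c Ru t)).matMul h1))) ?_
      simp only [Matrix.mul_zero, add_zero, zero_add]
    filter_upwards [e, s0, hsym] with t h1 h2 h3
    -- Multiplying the stationarity equation by K₁ᵀ, and its transpose by K₁, cancels all terms with
    -- K₁. Hence P₁ depends on K only, and each later derivative of P involves K only to one order
    -- less.
    have e1 := congrArg (fun M => (K₁ t)ᵀ * M) h2
    have e2 := congrArg (fun M => Mᵀ * K₁ t) h2
    simp only [hz, Matrix.mul_add, Matrix.transpose_add, Matrix.transpose_mul, Matrix.mul_zero,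
      Matrix.transpose_zero, Matrix.zero_mul, Matrix.add_mul, Matrix.transpose_transpose,
      h3, hRu, Matrix.mul_assoc] at e1 e2
    have e3 : P₁ t = ((w t)ᵀ * (P₁ t * w t) + ((d t)ᵀ * (P t * w t) + (w t)ᵀ * (P t * d t)))
        + ((K₁ t)ᵀ * (Ru * K t) + (K₁ t)ᵀ * ((Bt t)ᵀ * (P t * w t)))
        + ((K t)ᵀ * (Ru * K₁ t) + (w t)ᵀ * (P t * (Bt t * K₁ t))) := by
      conv_lhs => rw [h1]
      simp only [hw₁, Matrix.transpose_add, Matrix.transpose_mul, Matrix.mul_add, Matrix.add_mul,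
        Matrix.mul_assoc]
      abel
    rw [e1, e2, add_zero, add_zero] at e3
    conv_lhs => rw [e3]
    simp only [hz, Matrix.transpose_mul, Matrix.transpose_transpose, h3, Matrix.mul_assoc]
  have l2 : P₂ =ᶠ[𝓝 0] fun t => (w t)ᵀ * P₂ t * w t
      + (((w₁ t)ᵀ * P₁ t * w t + ((w₁ t)ᵀ * P₁ t * w t)ᵀ)
      + (((b * K₁ t)ᵀ * z t + (d t)ᵀ * z₁ t) + ((b * K₁ t)ᵀ * z t + (d t)ᵀ * z₁ t)ᵀ)) := by
    have e : P₂ =ᶠ[𝓝 0] fun t => ((w₁ t)ᵀ * P₁ t + (w t)ᵀ * P₂ t) * w t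
        + (w t)ᵀ * P₁ t * w₁ t + (((b * K₁ t)ᵀ * z t + (d t)ᵀ * z₁ t)
          + ((b * K₁ t)ᵀ * z t + (d t)ᵀ * z₁ t)ᵀ) := by
      refine eventually_deriv_eq l1 hP2 ?_
      filter_upwards [hP2, dw, dd, dz] with t h1 h2 h3 h4
      have h5 := h3.matTranspose.matMul h4
      exact ((h2.matTranspose.matMul h1).matMul h2).add (h5.add h5.matTranspose)
    filter_upwards [e, y1] with t h1 h2
    conv_lhs => rw [h1]
    simp only [Matrix.transpose_add, Matrix.transpose_mul, Matrix.transpose_transpose,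
      h2, Matrix.add_mul, Matrix.mul_assoc]
    abel
  have l3 : P₃ =ᶠ[𝓝 0] fun t => (w t)ᵀ * P₃ t * w t
      + ((((2 : ℝ) • ((w₁ t)ᵀ * P₂ t * w t) + (w₂ t)ᵀ * P₁ t * w t + (w₁ t)ᵀ * P₁ t * w₁ t)
        + ((2 : ℝ) • ((w₁ t)ᵀ * P₂ t * w t) + (w₂ t)ᵀ * P₁ t * w t
          + (w₁ t)ᵀ * P₁ t * w₁ t)ᵀ)
      + (((b * K₂ t)ᵀ * z t + (2 : ℝ) • ((b * K₁ t)ᵀ * z₁ t) + (d t)ᵀ * z₂ t)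
        + ((b * K₂ t)ᵀ * z t + (2 : ℝ) • ((b * K₁ t)ᵀ * z₁ t) + (d t)ᵀ * z₂ t)ᵀ)) := by
    have e : P₃ =ᶠ[𝓝 0] fun t => ((w₁ t)ᵀ * P₂ t + (w t)ᵀ * P₃ t) * w t
        + (w t)ᵀ * P₂ t * w₁ t
        + (((((w₂ t)ᵀ * P₁ t + (w₁ t)ᵀ * P₂ t) * w t + (w₁ t)ᵀ * P₁ t * w₁ t)
          + (((w₂ t)ᵀ * P₁ t + (w₁ t)ᵀ * P₂ t) * w t + (w₁ t)ᵀ * P₁ t * w₁ t)ᵀ)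
        + ((((b * K₂ t)ᵀ * z t + (b * K₁ t)ᵀ * z₁ t)
            + ((b * K₁ t)ᵀ * z₁ t + (d t)ᵀ * z₂ t))
          + (((b * K₂ t)ᵀ * z t + (b * K₁ t)ᵀ * z₁ t)
            + ((b * K₁ t)ᵀ * z₁ t + (d t)ᵀ * z₂ t))ᵀ)) := by
      refine eventually_deriv_eq l2 hP3 ?_
      filter_upwards [hP2, hP3, dw, dw₁, dd, dd₁, dz, dz₁] with t h1 h2 h3 h4 h5 h6 h7 h8
      have g1 := (h4.matTranspose.matMul h1).matMul h3
      have g2 := (h6.matTranspose.matMul h7).add (h5.matTranspose.matMul h8)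
      exact ((h3.matTranspose.matMul h2).matMul h3).add
        ((g1.add g1.matTranspose).add (g2.add g2.matTranspose))
    filter_upwards [e, y1, y2] with t h1 h2 h3
    conv_lhs => rw [h1]
    simp only [two, Matrix.transpose_add, Matrix.transpose_mul, Matrix.transpose_transpose,
      h2, h3, Matrix.add_mul, Matrix.mul_assoc]
    abel
  have v0 : w 0 = W := by simp [hw, hBt, hW]
  have vB : Bt 0 = B := by simp [hBt]
  have vd : d 0 = D := by simp [hd, hD]
  have v1 : w₁ 0 = W₁ := by rw [hW₁, ← vd, ← vB]
  have v2 : w₂ 0 = W₂ := by rw [hW₂, ← vB]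
  have vz : z 0 = P 0 * W := by rw [← v0]
  have vz1 : z₁ 0 = Z₁ := by rw [hZ₁, ← v0, ← v1]
  have vz2 : z₂ 0 = Z₂ := by rw [hZ₂, ← v0, ← v1, ← v2]
  have r1 := l1.self_of_nhds
  have r2 := l2.self_of_nhds
  have r3 := l3.self_of_nhds
  have r4 := s1.self_of_nhds
  have r5 := s2.self_of_nhds
  have r6 := s3.self_of_nhds
  simp only [hz₃, hw₃, v0, vB, vd, v1, v2, vz, vz1, vz2] at r1 r2 r3 r4 r5 r6
  exact ⟨r1, r2, r3, r4, r5, r6⟩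

end RiccatiCurve

/-! ### Derivative bounds for the optimal gain -/

section GainDerivatives

variable {dx du : ℕ}

theorem DerivChain.conj {a b c d : ℕ} {f f₁ f₂ f₃ : ℝ → Matrix (Fin b) (Fin c) ℝ}
    (h : DerivChain f f₁ f₂ f₃) (X : Matrix (Fin a) (Fin b) ℝ) (Y : Matrix (Fin c) (Fin d) ℝ) :
    DerivChain (fun t => X * f t * Y) (fun t => X * f₁ t * Y) (fun t => X * f₂ t * Y)
      (fun t => X * f₃ t * Y) := by
  have key : ∀ {g g₁ : ℝ → Matrix (Fin b) (Fin c) ℝ},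
      (∀ᶠ t in 𝓝 (0 : ℝ), HasDerivAt g (g₁ t) t) →
      ∀ᶠ t in 𝓝 (0 : ℝ), HasDerivAt (fun t => X * g t * Y) (X * g₁ t * Y) t := by
    intro g g₁ hg
    filter_upwards [hg] with t ht
    refine hasDerivAt_congr_mat (((hasDerivAt_const t X).matMul ht).matMul
      (hasDerivAt_const t Y)) ?_
    simp
  exact ⟨key h.one, key h.two, key h.three⟩

/-- A matrix bounded below by the identity factors as `Sᵀ S` with `S⁻¹` a contraction. -/
theorem exists_factor {n : ℕ} {M : Matrix (Fin n) (Fin n) ℝ} (hs : Mᵀ = M)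
    (h : ∀ x, x ⬝ᵥ x ≤ qf M x) :
    ∃ S Si : Matrix (Fin n) (Fin n) ℝ, M = Sᵀ * S ∧ S * Si = 1 ∧ Si * S = 1 ∧ opNorm Si ≤ 1 := by
  obtain ⟨S, hS⟩ := exists_eq_transpose_mul_self ((posSemidef_iff_qf M).2
    ⟨hs, fun x => (dotProduct_self_nonneg' x).trans (h x)⟩)
  have hu : IsUnit S.det := by
    have h1 := (Matrix.isUnit_iff_isUnit_det M).1 (isUnit_of_qf_ge h)
    rw [hS, Matrix.det_mul] at h1
    exact isUnit_of_mul_isUnit_right h1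
  refine ⟨S, S⁻¹, hS, Matrix.mul_nonsing_inv S hu, Matrix.nonsing_inv_mul S hu, ?_⟩
  refine opNorm_le_of_mulVec zero_le_one fun x => ?_
  have h1 := h (S⁻¹ *ᵥ x)
  have h2 := qf_conj S 1 (S⁻¹ *ᵥ x)
  rw [Matrix.mul_one, ← hS, qf_one, Matrix.mulVec_mulVec, Matrix.mul_nonsing_inv S hu,
    Matrix.one_mulVec] at h2
  linarith

theorem qf_gram {m n : ℕ} (S : Matrix (Fin m) (Fin n) ℝ) (x : Fin n → ℝ) :
    qf (Sᵀ * S) x = (S *ᵥ x) ⬝ᵥ (S *ᵥ x) := by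
  have h := qf_conj S 1 x
  rwa [Matrix.mul_one, qf_one] at h

theorem RiccatiPair.qf_ge {Rx : Matrix (Fin dx) (Fin dx) ℝ}
    {Ru : Matrix (Fin du) (Fin du) ℝ} (hRx : (Rx - 1).PosSemidef) (hRu : (Ru - 1).PosSemidef)
    {θ : LinSystem dx du} {K : Controller dx du} {P : Matrix (Fin dx) (Fin dx) ℝ}
    (h : RiccatiPair Rx Ru θ K P) (x : Fin dx → ℝ) : x ⬝ᵥ x ≤ qf P x := by
  have h1 := h.qf_eq x
  linarith [h.nonneg (closedLoop θ K *ᵥ x), dotProduct_self_le_qf hRx x,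
    dotProduct_self_le_qf hRu (K *ᵥ x), dotProduct_self_nonneg' (K *ᵥ x)]

/-- The value of x is at least the first stage cost, hence at least |x|² + |Kx|². -/
theorem RiccatiPair.gain_sq_le {Rx : Matrix (Fin dx) (Fin dx) ℝ}
    {Ru : Matrix (Fin du) (Fin du) ℝ} (hRx : (Rx - 1).PosSemidef) (hRu : (Ru - 1).PosSemidef)
    {θ : LinSystem dx du} {K : Controller dx du} {P : Matrix (Fin dx) (Fin dx) ℝ}
    (h : RiccatiPair Rx Ru θ K P) {Ψ : ℝ} (hΨ : 1 ≤ Ψ) (hP : ∀ x, qf P x ≤ Ψ * (x ⬝ᵥ x)) :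
    opNorm K ^ 2 ≤ Ψ - 1 := by
  have h0 : 0 ≤ Ψ - 1 := by linarith
  have h1 : opNorm K ≤ √(Ψ - 1) := by
    refine opNorm_le_of_mulVec (Real.sqrt_nonneg _) fun x => ?_
    rw [Real.sq_sqrt h0]
    have h1 := h.qf_eq x
    linarith [h.nonneg (closedLoop θ K *ᵥ x), dotProduct_self_le_qf hRx x,
      dotProduct_self_le_qf hRu (K *ᵥ x), hP x]
  calc opNorm K ^ 2 ≤ √(Ψ - 1) ^ 2 := pow_le_pow_left₀ (opNorm_nonneg _) h1 2
    _ = Ψ - 1 := Real.sq_sqrt h0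

/-- The closed-loop perturbation `δA + δB K` is controlled by `‖δ‖`. -/
theorem norm_closedLoop_sq_le (δ : LinSystem dx du) (K : Controller dx du) {Ψ : ℝ}
    (hK : opNorm K ^ 2 ≤ Ψ - 1) : ‖closedLoop δ K‖ ≤ √Ψ * ‖δ‖ := by
  have h1 : ‖closedLoop δ K‖ ≤ ‖LinSystem.A δ‖ + ‖LinSystem.B δ‖ * opNorm K :=
    (norm_add_le _ _).trans (add_le_add_right (norm_mul_le_opNorm_right _ _) _)
  have hΨ : 0 ≤ Ψ := by nlinarith [sq_nonneg (opNorm K)]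
  refine h1.trans (le_of_sq_le_sq ?_ (by positivity))
  rw [mul_pow, Real.sq_sqrt hΨ, LinSystem.norm_sq δ]
  -- Cauchy–Schwarz: (a + bκ)² ≤ (1 + κ²)(a² + b²), and here 1 + κ² ≤ Ψ.
  have := sq_nonneg (‖LinSystem.A δ‖ * opNorm K - ‖LinSystem.B δ‖)
  nlinarith [sq_nonneg ‖LinSystem.A δ‖, sq_nonneg ‖LinSystem.B δ‖]

/-- The coordinates Sx and Tu, with P = SᵀS and Ru + BᵀPB = TᵀT, make both matrices the identity.
Since |S| ≤ √Ψ and the inverses are contractions, a unit direction δ becomes data of size at most Ψ,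
and returning to the original gain costs √Ψ. -/
theorem RiccatiPair.gain_jet_bounds {Rx : Matrix (Fin dx) (Fin dx) ℝ}
    {Ru : Matrix (Fin du) (Fin du) ℝ} (hRx : (Rx - 1).PosSemidef) (hRu : (Ru - 1).PosSemidef)
    {θ : LinSystem dx du} {K : Controller dx du} {P : Matrix (Fin dx) (Fin dx) ℝ}
    (h : RiccatiPair Rx Ru θ K P) {Ψ : ℝ} (hΨ : 1 ≤ Ψ) (hP : ∀ x, qf P x ≤ Ψ * (x ⬝ᵥ x))
    {δ : LinSystem dx du} (hδ : ‖δ‖ ≤ 1) {ψ : LinSystem dx du → Controller dx du}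
    (hψ : ContDiffAt ℝ ω ψ θ) (hψθ : ψ θ = K)
    (hψe : ∀ᶠ η in 𝓝 θ, RiccatiPair Rx Ru η (ψ η) (valueMatrix Rx Ru η (ψ η))) :
    ∃ K₁ K₂ K₃ : ℝ → Controller dx du, DerivChain (fun t => ψ (θ + t • δ)) K₁ K₂ K₃ ∧
      ‖K₁ 0‖ ≤ √Ψ * (4 * Ψ ^ 2) ∧ ‖K₂ 0‖ ≤ √Ψ * (84 * Ψ ^ 5) ∧
      ‖K₃ 0‖ ≤ √Ψ * (3792 * Ψ ^ 8) := by
  have hΨ0 : 0 < Ψ := by linarith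
  have hRus := transpose_eq_of_posSemidef_sub_one hRu
  have hs := h.stable hRx hRu
  have hPv := h.valueMatrix_eq hRx hRu
  have hline : ContDiffAt ℝ ω (fun t : ℝ => θ + t • δ) 0 := by
    have : ContDiff ℝ ω (fun t : ℝ => θ + t • δ) := by fun_prop
    exact this.contDiffAt
  have hψ' : ContDiffAt ℝ ω ψ (θ + (0 : ℝ) • δ) := by rwa [zero_smul, add_zero]
  have hKc : ContDiffAt ℝ ω (fun t : ℝ => ψ (θ + t • δ)) 0 :=
    ContDiffAt.comp (0 : ℝ) (f := fun t : ℝ => θ + t • δ) hψ' hline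
  have hPc : ContDiffAt ℝ ω
      (fun t : ℝ => valueMatrix Rx Ru (θ + t • δ) (ψ (θ + t • δ))) 0 := by
    refine hline.valueMatrix Rx Ru hKc ?_
    rw [zero_smul, add_zero, hψθ]
    exact hs
  obtain ⟨K₁, K₂, K₃, hK⟩ := hKc.exists_derivChain
  obtain ⟨P₁, P₂, P₃, hPch⟩ := hPc.exists_derivChain
  have hev : ∀ᶠ t in 𝓝 (0 : ℝ), RiccatiPair Rx Ru (θ + t • δ) (ψ (θ + t • δ))
      (valueMatrix Rx Ru (θ + t • δ) (ψ (θ + t • δ))) := by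
    have hψe' : ∀ᶠ η in 𝓝 (θ + (0 : ℝ) • δ),
        RiccatiPair Rx Ru η (ψ η) (valueMatrix Rx Ru η (ψ η)) := by
      simpa only [zero_smul, add_zero] using hψe
    exact (show Tendsto (fun t : ℝ => θ + t • δ) (𝓝 0) (𝓝 (θ + (0 : ℝ) • δ)) from
      hline.continuousAt).eventually hψe'
  obtain ⟨S, Si, hS, hSSi, hSiS, hSi⟩ := exists_factor h.symm (h.qf_ge hRx hRu)
  obtain ⟨T, Ti, hT, hTTi, hTiT, hTi⟩ := exists_factor (inputGram_transpose (θ := θ) hRus h.symm)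
    (qf_inputGram_ge (θ := θ) hRu h.nonneg)
  have hSt : Sᵀ * Siᵀ = 1 := by rw [← Matrix.transpose_mul, hSiS, Matrix.transpose_one]
  have hSit : Siᵀ * Sᵀ = 1 := by rw [← Matrix.transpose_mul, hSSi, Matrix.transpose_one]
  have hTit : Tiᵀ * Tᵀ = 1 := by rw [← Matrix.transpose_mul, hTTi, Matrix.transpose_one]
  have hTt : Tᵀ * Tiᵀ = 1 := by rw [← Matrix.transpose_mul, hTiT, Matrix.transpose_one]
  have cS : ∀ {c : ℕ} (M : Matrix (Fin dx) (Fin c) ℝ), S * (Si * M) = M := fun M => by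
    rw [← Matrix.mul_assoc, hSSi, Matrix.one_mul]
  have cSi : ∀ {c : ℕ} (M : Matrix (Fin dx) (Fin c) ℝ), Si * (S * M) = M := fun M => by
    rw [← Matrix.mul_assoc, hSiS, Matrix.one_mul]
  have cSt : ∀ {c : ℕ} (M : Matrix (Fin dx) (Fin c) ℝ), Sᵀ * (Siᵀ * M) = M := fun M => by
    rw [← Matrix.mul_assoc, hSt, Matrix.one_mul]
  have cTi : ∀ {c : ℕ} (M : Matrix (Fin du) (Fin c) ℝ), Ti * (T * M) = M := fun M => by
    rw [← Matrix.mul_assoc, hTiT, Matrix.one_mul]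
  have cTt : ∀ {c : ℕ} (M : Matrix (Fin du) (Fin c) ℝ), Tᵀ * (Tiᵀ * M) = M := fun M => by
    rw [← Matrix.mul_assoc, hTt, Matrix.one_mul]
  have hSn : opNorm S ≤ √Ψ := by
    refine opNorm_le_of_mulVec (Real.sqrt_nonneg _) fun x => ?_
    rw [Real.sq_sqrt hΨ0.le, ← qf_gram, ← hS]
    exact hP x
  -- normalized data
  set A' := S * LinSystem.A θ * Si with hA'
  set a' := S * LinSystem.A δ * Si with ha'
  set B' := S * LinSystem.B θ * Ti with hB'
  set b' := S * LinSystem.B δ * Ti with hb'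
  have hwt : ∀ t : ℝ, A' + t • a' + (B' + t • b') * (T * ψ (θ + t • δ) * Si)
      = S * closedLoop (θ + t • δ) (ψ (θ + t • δ)) * Si := fun t => by
    simp only [hA', ha', hB', hb', closedLoop, LinSystem.A_add, LinSystem.A_smul, LinSystem.B_add,
      LinSystem.B_smul, Matrix.add_mul, Matrix.mul_add, Matrix.smul_mul, Matrix.mul_smul,
      Matrix.mul_assoc, cTi]
  have hBt : ∀ t : ℝ, B' + t • b' = S * LinSystem.B (θ + t • δ) * Ti := fun t => by
    simp only [hB', hb', LinSystem.B_add, LinSystem.B_smul, Matrix.add_mul, Matrix.mul_add,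
      Matrix.smul_mul, Matrix.mul_smul]
  have hRu' : (Tiᵀ * Ru * Ti)ᵀ = Tiᵀ * Ru * Ti := by
    simp [Matrix.transpose_mul, hRus, Matrix.mul_assoc]
  -- The optimality equations are covariant under the change of coordinates, with costs SiᵀRxSi and
  -- TiᵀRuTi.
  have hjet := riccati_curve_jet (hK.conj T Si) (hPch.conj Siᵀ Si) (A := A') (a := a') (B := B')
    (b := b') (Rx := Siᵀ * Rx * Si) hRu'
    (by
      filter_upwards [hev] with t ht
      simp [Matrix.transpose_mul, ht.symm, Matrix.mul_assoc])
    (by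
      filter_upwards [hev] with t ht
      rw [hwt]
      conv_lhs => rw [ht.lyap]
      simp only [costMatrix, Matrix.transpose_mul, Matrix.mul_add, Matrix.add_mul,
        Matrix.mul_assoc, cSi, cSt, cTi, cTt])
    (by
      filter_upwards [hev] with t ht
      rw [hwt, hBt]
      have e := congrArg (fun M => Tiᵀ * M * Si) ht.stationary
      simp only [Matrix.mul_zero, Matrix.zero_mul, Matrix.mul_add, Matrix.add_mul,
        Matrix.mul_assoc] at e
      simp only [Matrix.transpose_mul, Matrix.mul_assoc, cSi, cSt, cTi]
      exact e)
    rfl rfl rfl rfl rfl rfl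
  have hK0 : T * ψ (θ + (0 : ℝ) • δ) * Si = T * K * Si := by rw [zero_smul, add_zero, hψθ]
  have hP0 : Siᵀ * valueMatrix Rx Ru (θ + (0 : ℝ) • δ) (ψ (θ + (0 : ℝ) • δ)) * Si = 1 := by
    rw [zero_smul, add_zero, hψθ, ← hPv, hS]
    simp only [Matrix.mul_assoc, hSSi, Matrix.mul_one, hSit]
  have hw0 : A' + B' * (T * K * Si) = S * closedLoop θ K * Si := by
    have := hwt 0
    simpa only [zero_smul, add_zero, hψθ] using this
  have hd0 : a' + b' * (T * K * Si) = S * closedLoop δ K * Si := by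
    simp only [ha', hb', closedLoop, Matrix.add_mul, Matrix.mul_add, Matrix.mul_assoc, cTi]
  simp only [hK0, hP0, Matrix.one_mul] at hjet
  obtain ⟨j1, j2, j3, j4, j5, j6⟩ := hjet
  have hρ : Tiᵀ * Ru * Ti + B'ᵀ * B' = 1 := by
    have e : Tiᵀ * inputGram Ru θ P * Ti = 1 := by
      rw [hT]; simp only [Matrix.mul_assoc, hTTi, Matrix.mul_one, hTit]
    rw [← e, inputGram, hS]
    simp only [hB', Matrix.transpose_mul, Matrix.mul_add, Matrix.add_mul, Matrix.mul_assoc]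
  have hβ : opNorm B' ≤ 1 := by
    refine opNorm_le_of_mulVec zero_le_one fun u => ?_
    have e := congrArg (fun M => qf M u) hρ
    simp only [qf_add, qf_one, qf_gram, qf_conj] at e
    linarith [dotProduct_self_le_qf hRu (Ti *ᵥ u), dotProduct_self_nonneg' (Ti *ᵥ u)]
  -- With x = Si y one has |y|² = P(x) ≤ Ψ|x|², while the value of x drops by at least |x|² in one
  -- step; hence |wy|² ≤ |y|² - |x|² ≤ (1 - 1/Ψ)|y|².
  have hw : opNorm (A' + B' * (T * K * Si)) ^ 2 ≤ 1 - 1 / Ψ := by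
    have h01 : 0 ≤ 1 - 1 / Ψ := by rw [sub_nonneg, div_le_one hΨ0]; exact hΨ
    have e : opNorm (A' + B' * (T * K * Si)) ≤ √(1 - 1 / Ψ) := by
      refine opNorm_le_of_mulVec (Real.sqrt_nonneg _) fun y => ?_
      rw [Real.sq_sqrt h01, hw0, ← Matrix.mulVec_mulVec, ← Matrix.mulVec_mulVec, ← qf_gram, ← hS]
      have e1 := h.qf_eq (Si *ᵥ y)
      have e2 : qf P (Si *ᵥ y) = y ⬝ᵥ y := by
        rw [hS, qf_gram, Matrix.mulVec_mulVec, hSSi, Matrix.one_mulVec]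
      have e3 := hP (Si *ᵥ y)
      rw [e2, ← div_le_iff₀' hΨ0] at e3
      have e4 : (1 - 1 / Ψ) * (y ⬝ᵥ y) = y ⬝ᵥ y - (y ⬝ᵥ y) / Ψ := by ring
      linarith [dotProduct_self_le_qf hRx (Si *ᵥ y), dotProduct_self_le_qf hRu (K *ᵥ (Si *ᵥ y)),
        dotProduct_self_nonneg' (K *ᵥ (Si *ᵥ y))]
    calc _ ≤ √(1 - 1 / Ψ) ^ 2 := pow_le_pow_left₀ (opNorm_nonneg _) e 2
      _ = _ := Real.sq_sqrt h01
  have hsq : √Ψ * √Ψ = Ψ := Real.mul_self_sqrt hΨ0.le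
  have hsq1 : 1 ≤ √Ψ := Real.one_le_sqrt.2 hΨ
  have conjS : ∀ {c e : ℕ} (M : Matrix (Fin dx) (Fin c) ℝ) {N : Matrix (Fin c) (Fin e) ℝ},
      opNorm N ≤ 1 → ‖S * M * N‖ ≤ √Ψ * ‖M‖ := fun M N hN =>
    (norm_mul_le_of_opNorm_le_one' hN _).trans ((norm_mul_le_opNorm_left S M).trans
      (mul_le_mul_of_nonneg_right hSn (norm_nonneg _)))
  have hd : ‖a' + b' * (T * K * Si)‖ ≤ Ψ := by
    rw [hd0]
    refine (conjS _ hSi).trans ?_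
    have e := norm_closedLoop_sq_le δ K (h.gain_sq_le hRx hRu hΨ hP)
    calc √Ψ * ‖closedLoop δ K‖ ≤ √Ψ * (√Ψ * 1) := by gcongr; exact e.trans (by gcongr)
      _ = Ψ := by rw [mul_one, hsq]
  have he : ‖b'‖ ≤ Ψ := by
    refine (conjS _ hTi).trans ?_
    calc √Ψ * ‖LinSystem.B δ‖ ≤ √Ψ * √Ψ := by
          gcongr; exact ((LinSystem.norm_B_le δ).trans hδ).trans hsq1
      _ = Ψ := hsq
  obtain ⟨b1, b2, b3⟩ := normalized_jet_bounds hΨ hw hβ hρ hd he rfl rfl rfl rfl j1 j2 j3 j4 j5 j6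
  have back : ∀ M : Controller dx du, ‖M‖ ≤ √Ψ * ‖T * M * Si‖ := fun M => by
    have e : M = Ti * (T * M * Si) * S := by
      simp only [Matrix.mul_assoc, hSiS, Matrix.mul_one, cTi]
    conv_lhs => rw [e]
    refine (norm_mul_le_opNorm_right _ _).trans ?_
    rw [mul_comm]
    exact mul_le_mul hSn (norm_mul_le_of_opNorm_le_one hTi _) (norm_nonneg _) (Real.sqrt_nonneg _)
  exact ⟨K₁, K₂, K₃, hK, (back _).trans (by gcongr), (back _).trans (by gcongr),
    (back _).trans (by gcongr)⟩

end GainDerivatives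

/-! ### Polarization -/

section Polarization

variable {E F : Type*} [NormedAddCommGroup E] [NormedSpace ℝ E] [NormedAddCommGroup F]
  [NormedSpace ℝ F]

theorem ContinuousMultilinearMap.norm_le_of_unit {k : ℕ}
    (f : ContinuousMultilinearMap ℝ (fun _ : Fin k => E) F) {C : ℝ} (hC : 0 ≤ C)
    (h : ∀ m : Fin k → E, (∀ i, ‖m i‖ = 1) → ‖f m‖ ≤ C) : ‖f‖ ≤ C := by
  refine f.opNorm_le_bound hC fun m => ?_
  by_cases h0 : ∃ i, m i = 0
  · obtain ⟨i, hi⟩ := h0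
    rw [f.map_coord_zero i hi, norm_zero]
    positivity
  · push Not at h0
    have e : m = fun i => ‖m i‖ • (‖m i‖⁻¹ • m i) := by
      ext i
      rw [smul_smul, mul_inv_cancel₀ (norm_ne_zero_iff.2 (h0 i)), one_smul]
    have h1 := h (fun i => ‖m i‖⁻¹ • m i) fun i => by
      rw [norm_smul, norm_inv, norm_norm, inv_mul_cancel₀ (norm_ne_zero_iff.2 (h0 i))]
    conv_lhs => rw [e]
    rw [f.map_smul_univ, norm_smul, Real.norm_of_nonneg (by positivity), mul_comm]
    gcongr

theorem ContinuousMultilinearMap.norm_diag_le {k : ℕ} (hk : k ≠ 0)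
    (f : ContinuousMultilinearMap ℝ (fun _ : Fin k => E) F) {D : ℝ}
    (h : ∀ δ : E, ‖δ‖ = 1 → ‖f fun _ => δ‖ ≤ D) (δ : E) : ‖f fun _ => δ‖ ≤ D * ‖δ‖ ^ k := by
  rcases eq_or_ne δ 0 with rfl | h0
  · have : NeZero k := ⟨hk⟩
    rw [f.map_coord_zero 0 rfl]
    simp [hk]
  · have h1 := h (‖δ‖⁻¹ • δ) (by
      rw [norm_smul, norm_inv, norm_norm, inv_mul_cancel₀ (norm_ne_zero_iff.2 h0)])
    have e : (fun _ : Fin k => δ) = fun _ => ‖δ‖ • (‖δ‖⁻¹ • δ) := by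
      ext i
      rw [smul_smul, mul_inv_cancel₀ (norm_ne_zero_iff.2 h0), one_smul]
    rw [e, f.map_smul_univ, norm_smul, Finset.prod_const, Finset.card_univ, Fintype.card_fin,
      Real.norm_of_nonneg (by positivity), mul_comm]
    gcongr

/-- Polarization of a symmetric continuous bilinear map. -/
theorem ContinuousMultilinearMap.norm_two_le_of_symm
    {f : ContinuousMultilinearMap ℝ (fun _ : Fin 2 => E) F}
    (hs : ∀ (m : Fin 2 → E) (τ : Equiv.Perm (Fin 2)), f (m ∘ τ) = f m) {D : ℝ} (hD : 0 ≤ D)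
    (h : ∀ δ : E, ‖δ‖ = 1 → ‖f fun _ => δ‖ ≤ D) : ‖f‖ ≤ 2 * D := by
  refine f.norm_le_of_unit (by positivity) fun m hm => ?_
  have hd := f.norm_diag_le two_ne_zero h
  set T : E → E → F := fun u v => f ![u, v] with hT
  have add1 : ∀ u u' v, T (u + u') v = T u v + T u' v := fun u u' v => by
    simp only [hT]
    exact f.cons_add ![v] u u'
  have sw : ∀ u v, T u v = T v u := fun u v => by
    simp only [hT]
    rw [← hs ![v, u] (Equiv.swap 0 1)]
    congr 1; ext i; fin_cases i <;> simp
  have add2 : ∀ u v v', T u (v + v') = T u v + T u v' := fun u v v' => by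
    rw [sw, add1, sw v, sw v']
  have neg1 : ∀ u v, T (-u) v = -T u v := fun u v => by
    have h0 : T 0 v = 0 := by have := add1 0 0 v; rwa [add_zero, left_eq_add] at this
    have := add1 u (-u) v
    rw [add_neg_cancel, h0] at this
    exact (neg_eq_of_add_eq_zero_right this.symm).symm
  have neg2 : ∀ u v, T u (-v) = -T u v := fun u v => by rw [sw, neg1, sw]
  have hg : ∀ u, ‖T u u‖ ≤ D * ‖u‖ ^ 2 := fun u => by
    have e : (![u, u] : Fin 2 → E) = fun _ => u := by ext i; fin_cases i <;> rfl
    simpa only [hT, e] using hd u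
  have em : f m = T (m 0) (m 1) := by
    simp only [hT]; congr 1; ext i; fin_cases i <;> rfl
  set u := m 0
  set v := m 1
  have hu : ‖u‖ = 1 := hm 0
  have hv : ‖v‖ = 1 := hm 1
  -- Each term on the right has norm at most 4D, so the quotient by 4 gives the factor 2.
  have key : (4 : ℝ) • T u v = T (u + v) (u + v) - T (u + -v) (u + -v) := by
    simp only [add1, add2, neg1, neg2, sw v u]
    module
  have b : ∀ a, ‖a‖ ≤ 2 → ‖T a a‖ ≤ D * 4 := fun a ha => (hg a).trans (by
    gcongr; nlinarith [norm_nonneg a])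
  have b1 := b (u + v) ((norm_add_le _ _).trans (by rw [hu, hv]; norm_num))
  have b2 := b (u + -v) ((norm_add_le _ _).trans (by rw [norm_neg, hu, hv]; norm_num))
  have := congrArg norm key
  rw [norm_smul, Real.norm_of_nonneg (by norm_num : (0 : ℝ) ≤ 4)] at this
  have := norm_sub_le (T (u + v) (u + v)) (T (u + -v) (u + -v))
  rw [em]
  linarith

/-- Polarization of a symmetric continuous trilinear map. -/
theorem ContinuousMultilinearMap.norm_three_le_of_symm
    {f : ContinuousMultilinearMap ℝ (fun _ : Fin 3 => E) F}
    (hs : ∀ (m : Fin 3 → E) (τ : Equiv.Perm (Fin 3)), f (m ∘ τ) = f m) {D : ℝ} (hD : 0 ≤ D)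
    (h : ∀ δ : E, ‖δ‖ = 1 → ‖f fun _ => δ‖ ≤ D) : ‖f‖ ≤ 5 * D := by
  refine f.norm_le_of_unit (by positivity) fun m hm => ?_
  have hd := f.norm_diag_le three_ne_zero h
  set T : E → E → E → F := fun u v w => f ![u, v, w] with hT
  have add1 : ∀ u u' v w, T (u + u') v w = T u v w + T u' v w := fun u u' v w => by
    simp only [hT]
    exact f.cons_add ![v, w] u u'
  have sw : ∀ u v w, T u v w = T v u w := fun u v w => by
    simp only [hT]
    rw [← hs ![v, u, w] (Equiv.swap 0 1)]
    congr 1; ext i; fin_cases i <;> simp [Equiv.swap_apply_of_ne_of_ne]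
  have sw' : ∀ u v w, T u v w = T w v u := fun u v w => by
    simp only [hT]
    rw [← hs ![w, v, u] (Equiv.swap 0 2)]
    congr 1; ext i; fin_cases i <;> simp [Equiv.swap_apply_of_ne_of_ne]
  have sw'' : ∀ u v w, T u v w = T u w v := fun u v w => by rw [sw, sw', sw]
  have add2 : ∀ u v v' w, T u (v + v') w = T u v w + T u v' w := fun u v v' w => by
    rw [sw, add1, sw v, sw v']
  have add3 : ∀ u v w w', T u v (w + w') = T u v w + T u v w' := fun u v w w' => by
    rw [sw', add1, sw' w, sw' w']
  have neg1 : ∀ u v w, T (-u) v w = -T u v w := fun u v w => by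
    have h0 : T 0 v w = 0 := by have := add1 0 0 v w; rwa [add_zero, left_eq_add] at this
    have := add1 u (-u) v w
    rw [add_neg_cancel, h0] at this
    exact (neg_eq_of_add_eq_zero_right this.symm).symm
  have neg2 : ∀ u v w, T u (-v) w = -T u v w := fun u v w => by rw [sw, neg1, sw]
  have neg3 : ∀ u v w, T u v (-w) = -T u v w := fun u v w => by rw [sw', neg1, sw']
  have hg : ∀ u, ‖T u u u‖ ≤ D * ‖u‖ ^ 3 := fun u => by
    have e : (![u, u, u] : Fin 3 → E) = fun _ => u := by ext i; fin_cases i <;> rfl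
    simpa only [hT, e] using hd u
  have em : f m = T (m 0) (m 1) (m 2) := by
    simp only [hT]; congr 1; ext i; fin_cases i <;> rfl
  set u := m 0
  set v := m 1
  set w := m 2
  have hu : ‖u‖ = 1 := hm 0
  have hv : ‖v‖ = 1 := hm 1
  have hw : ‖w‖ = 1 := hm 2
  -- Four cubes of vectors of norm at most 3 give 4·27/24 = 4.5, rounded up to 5.
  have key : (24 : ℝ) • T u v w
      = T (u + v + w) (u + v + w) (u + v + w) - T (u + v + -w) (u + v + -w) (u + v + -w)
        - T (u + -v + w) (u + -v + w) (u + -v + w)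
        + T (u + -v + -w) (u + -v + -w) (u + -v + -w) := by
    simp only [add1, add2, add3, neg1, neg2, neg3]
    simp only [sw v u, sw w u, sw w v, sw'' u w v, sw'' v w v, sw'' u w u, sw'' u v u,
      sw'' v v u, sw'' v w u, sw'' w w u, sw'' w w v]
    module
  have b : ∀ a, ‖a‖ ≤ 3 → ‖T a a a‖ ≤ D * 27 := fun a ha => (hg a).trans (by
    gcongr
    calc ‖a‖ ^ 3 ≤ 3 ^ 3 := by gcongr
      _ = 27 := by norm_num)
  have n3 : ∀ a b c : E, ‖a‖ = 1 → ‖b‖ = 1 → ‖c‖ = 1 → ‖a + b + c‖ ≤ 3 := fun a b c ha hb hc =>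
    norm_add₃_le.trans (by rw [ha, hb, hc]; norm_num)
  have hv' : ‖-v‖ = 1 := by rwa [norm_neg]
  have hw' : ‖-w‖ = 1 := by rwa [norm_neg]
  have b1 := b _ (n3 u v w hu hv hw)
  have b2 := b _ (n3 u v (-w) hu hv hw')
  have b3 := b _ (n3 u (-v) w hu hv' hw)
  have b4 := b _ (n3 u (-v) (-w) hu hv' hw')
  have e := congrArg norm key
  rw [norm_smul, Real.norm_of_nonneg (by norm_num : (0 : ℝ) ≤ 24)] at e
  generalize T (u + v + w) (u + v + w) (u + v + w) = a₁ at *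
  generalize T (u + v + -w) (u + v + -w) (u + v + -w) = a₂ at *
  generalize T (u + -v + w) (u + -v + w) (u + -v + w) = a₃ at *
  generalize T (u + -v + -w) (u + -v + -w) (u + -v + -w) = a₄ at *
  have c1 := norm_add_le (a₁ - a₂ - a₃) a₄
  have c2 := norm_sub_le (a₁ - a₂) a₃
  have c3 := norm_sub_le a₁ a₂
  rw [em]
  linarith

/-- Bounds on the first three derivatives of `f` at `x`; the third on the diagonal. -/
structure JetBound (f : E → F) (x : E) (C₁ C₂ C₃ : ℝ) : Prop where
  contDiffAt : ContDiffAt ℝ ω f x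
  one : ‖fderiv ℝ f x‖ ≤ C₁
  two : ‖iteratedFDeriv ℝ 2 f x‖ ≤ 2 * C₂
  three_diag : ∀ δ : E, ‖δ‖ = 1 → ‖iteratedFDeriv ℝ 3 f x fun _ => δ‖ ≤ C₃
  three : ‖iteratedFDeriv ℝ 3 f x‖ ≤ 5 * C₃

/-- Curves see only the diagonals of the higher derivatives; these are symmetric, so polarization
recovers their operator norms. -/
theorem JetBound.of_lines {f : E → F} {x : E} (hf : ContDiffAt ℝ ω f x) {C₁ C₂ C₃ : ℝ}
    (h₁ : 0 ≤ C₁) (h₂ : 0 ≤ C₂) (h₃ : 0 ≤ C₃)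
    (h : ∀ δ : E, ‖δ‖ = 1 → ∃ φ φ₁ φ₂ φ₃ : ℝ → F, DerivChain φ φ₁ φ₂ φ₃ ∧
      (∀ᶠ t in 𝓝 (0 : ℝ), f (x + t • δ) = φ t) ∧
      ‖φ₁ 0‖ ≤ C₁ ∧ ‖φ₂ 0‖ ≤ C₂ ∧ ‖φ₃ 0‖ ≤ C₃) : JetBound f x C₁ C₂ C₃ := by
  have key : ∀ δ : E, ‖δ‖ = 1 → ‖fderiv ℝ f x δ‖ ≤ C₁ ∧
      ‖iteratedFDeriv ℝ 2 f x fun _ => δ‖ ≤ C₂ ∧ ‖iteratedFDeriv ℝ 3 f x fun _ => δ‖ ≤ C₃ := by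
    intro δ hδ
    obtain ⟨φ, φ₁, φ₂, φ₃, hc, h0, b₁, b₂, b₃⟩ := h δ hδ
    obtain ⟨e₁, e₂, e₃⟩ := iteratedFDeriv_line_eq hf hc h0
    exact ⟨e₁ ▸ b₁, e₂ ▸ b₂, e₃ ▸ b₃⟩
  have hsym : ∀ {k : ℕ} (m : Fin k → E) (τ : Equiv.Perm (Fin k)),
      iteratedFDeriv ℝ k f x (m ∘ τ) = iteratedFDeriv ℝ k f x m :=
    fun m τ => hf.iteratedFDeriv_comp_perm m τ
  exact ⟨hf, ContinuousLinearMap.opNorm_le_of_unit_norm h₁ fun δ hδ => (key δ hδ).1,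
    ContinuousMultilinearMap.norm_two_le_of_symm hsym h₂ fun δ hδ => (key δ hδ).2.1,
    fun δ hδ => (key δ hδ).2.2,
    ContinuousMultilinearMap.norm_three_le_of_symm hsym h₃ fun δ hδ => (key δ hδ).2.2⟩

theorem JetBound.norm_image_sub_le {f : E → F} {x₀ x : E} {r C₁ C₂ C₃ : ℝ} (hr : 0 ≤ r)
    (h : ∀ y, ‖y - x₀‖ ≤ r → JetBound f y C₁ C₂ C₃) (hx : ‖x - x₀‖ ≤ r) :
    ‖f x - f x₀‖ ≤ C₁ * ‖x - x₀‖ :=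
  (convex_closedBall x₀ r).norm_image_sub_le_of_norm_fderiv_le
    (fun y hy => (h y (mem_closedBall_iff_norm.1 hy)).contDiffAt.differentiableAt (by simp))
    (fun y hy => (h y (mem_closedBall_iff_norm.1 hy)).one)
    (Metric.mem_closedBall_self hr) (mem_closedBall_iff_norm.2 hx)

theorem norm_iteratedFDeriv_two_sub_le {f g : E → F} {x : E} (hf : ContDiffAt ℝ ω f x)
    (hg : ContDiffAt ℝ ω g x) {C : ℝ} (hC : 0 ≤ C)
    (h : ∀ δ : E, ‖δ‖ = 1 → ∃ φ φ₁ φ₂ φ₃ γ γ₁ γ₂ γ₃ : ℝ → F,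
      DerivChain φ φ₁ φ₂ φ₃ ∧ DerivChain γ γ₁ γ₂ γ₃ ∧
      (∀ᶠ t in 𝓝 (0 : ℝ), f (x + t • δ) = φ t) ∧ (∀ᶠ t in 𝓝 (0 : ℝ), g (x + t • δ) = γ t) ∧
      ‖φ₂ 0 - γ₂ 0‖ ≤ C) :
    ‖iteratedFDeriv ℝ 2 f x - iteratedFDeriv ℝ 2 g x‖ ≤ 2 * C := by
  refine ContinuousMultilinearMap.norm_two_le_of_symm (fun m τ => ?_) hC fun δ hδ => ?_
  · simp only [sub_apply]
    rw [hf.iteratedFDeriv_comp_perm m τ, hg.iteratedFDeriv_comp_perm m τ]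
  · obtain ⟨φ, φ₁, φ₂, φ₃, γ, γ₁, γ₂, γ₃, hc, hc', h0, h0', b⟩ := h δ hδ
    rw [sub_apply, (iteratedFDeriv_line_eq hf hc h0).2.1,
      (iteratedFDeriv_line_eq hg hc' h0').2.1]
    exact b

end Polarization

/-! ### The region around the nominal system -/

section Region

variable {dx du : ℕ}

/-- Weighted triangle inequality for a positive semidefinite form. -/
theorem qf_add_le {n : ℕ} {P : Matrix (Fin n) (Fin n) ℝ} (hs : Pᵀ = P) (h0 : ∀ x, 0 ≤ qf P x)
    {a : ℝ} (ha : 0 < a) (u v : Fin n → ℝ) :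
    qf P (u + v) ≤ (1 + a) * qf P u + (1 + 1 / a) * qf P v := by
  have hsym : v ⬝ᵥ (P *ᵥ u) = u ⬝ᵥ (P *ᵥ v) := by
    rw [← dotProduct_transpose_mulVec P u v |>.trans (dotProduct_comm _ _), hs]
  have e1 : qf P (u + v) = qf P u + qf P v + 2 * (u ⬝ᵥ (P *ᵥ v)) := by
    simp only [qf, Matrix.mulVec_add, dotProduct_add, add_dotProduct, hsym]; ring
  have e2 : qf P (a • u - v) = a ^ 2 * qf P u + qf P v - 2 * a * (u ⬝ᵥ (P *ᵥ v)) := by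
    simp only [qf, Matrix.mulVec_sub, Matrix.mulVec_smul, dotProduct_sub, sub_dotProduct,
      dotProduct_smul, smul_dotProduct, smul_eq_mul, hsym]; ring
  have h1 := h0 (a • u - v)
  rw [e2] at h1
  have h2 : 2 * (u ⬝ᵥ (P *ᵥ v)) ≤ a * qf P u + 1 / a * qf P v := by
    have : a * (2 * (u ⬝ᵥ (P *ᵥ v))) ≤ a * (a * qf P u + 1 / a * qf P v) := by
      rw [mul_add, ← mul_assoc a (1 / a), mul_one_div_cancel ha.ne']
      nlinarith
    exact le_of_mul_le_mul_left this ha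
  rw [e1]; linarith

theorem qf_mulVec_le {n m : ℕ} {P : Matrix (Fin n) (Fin n) ℝ} {Ψ : ℝ} (hΨ : 0 ≤ Ψ)
    (hP : ∀ x, qf P x ≤ Ψ * (x ⬝ᵥ x)) {E : Matrix (Fin n) (Fin m) ℝ} {e : ℝ}
    (hE : opNorm E ≤ e) (x : Fin m → ℝ) : qf P (E *ᵥ x) ≤ Ψ * e ^ 2 * (x ⬝ᵥ x) := by
  have h1 := mulVec_dotProduct_self_le E x
  have h2 : opNorm E ^ 2 ≤ e ^ 2 := pow_le_pow_left₀ (opNorm_nonneg E) hE 2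
  calc qf P (E *ᵥ x) ≤ Ψ * ((E *ᵥ x) ⬝ᵥ (E *ᵥ x)) := hP _
    _ ≤ Ψ * (e ^ 2 * (x ⬝ᵥ x)) := by
      gcongr
      exact h1.trans (mul_le_mul_of_nonneg_right h2 (dotProduct_self_nonneg' x))
    _ = _ := by ring

/-- The value matrix is a Lyapunov function for perturbed closed loops. -/
theorem RiccatiPair.lyapunov_perturb {Rx : Matrix (Fin dx) (Fin dx) ℝ}
    {Ru : Matrix (Fin du) (Fin du) ℝ} (hRx : (Rx - 1).PosSemidef) (hRu : (Ru - 1).PosSemidef)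
    {θ : LinSystem dx du} {K : Controller dx du} {P : Matrix (Fin dx) (Fin dx) ℝ}
    (h : RiccatiPair Rx Ru θ K P) {Ψ : ℝ} (hΨ : 0 ≤ Ψ) (hP : ∀ x, qf P x ≤ Ψ * (x ⬝ᵥ x))
    {E : Matrix (Fin dx) (Fin dx) ℝ} {e ε : ℝ} (he : 0 < e) (hE : opNorm E ≤ e)
    (hε : Ψ * (2 * e + e ^ 2) ≤ ε) (x : Fin dx → ℝ) :
    (1 - ε) * qf (costMatrix Rx Ru K) x + qf P ((closedLoop θ K + E) *ᵥ x) ≤ qf P x := by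
  have h1 := h.qf_eq x
  have hQ := qf_costMatrix_ge hRx hRu K x
  -- The weight e balances the two errors: eΨ from the unperturbed loop and (1 + 1/e) Ψe² = Ψ(e² +
  -- e) from the perturbation, in all Ψ(2e + e²).
  have h2 := qf_add_le h.symm h.nonneg he (closedLoop θ K *ᵥ x) (E *ᵥ x)
  have h3 := qf_mulVec_le hΨ hP hE x
  rw [qf_costMatrix] at hQ ⊢
  rw [Matrix.add_mulVec]
  have hx := dotProduct_self_nonneg' x
  have h4 : qf P (closedLoop θ K *ᵥ x) ≤ Ψ * (x ⬝ᵥ x) := by linarith [hP x]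
  have h5 : (1 + 1 / e) * qf P (E *ᵥ x) ≤ (1 + 1 / e) * (Ψ * e ^ 2 * (x ⬝ᵥ x)) := by gcongr
  have h6 : (1 + 1 / e) * (Ψ * e ^ 2 * (x ⬝ᵥ x)) = Ψ * (e ^ 2 + e) * (x ⬝ᵥ x) := by
    field_simp
  have h7 : e * qf P (closedLoop θ K *ᵥ x) ≤ e * (Ψ * (x ⬝ᵥ x)) := by gcongr
  have h8 : Ψ * (2 * e + e ^ 2) * (x ⬝ᵥ x) ≤ ε * (qf Rx x + qf Ru (K *ᵥ x)) := by
    have : 0 ≤ Ψ * (2 * e + e ^ 2) := by positivity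
    calc _ ≤ ε * (x ⬝ᵥ x) := by gcongr
      _ ≤ _ := mul_le_mul_of_nonneg_left hQ (this.trans hε)
  nlinarith

/-- An optimal pair at the nominal system, with bounds on its size and on the admissible radius.
Here `s ^ 2` bounds the value matrix and `β` the input matrix. -/
structure LocalRegion (Rx : Matrix (Fin dx) (Fin dx) ℝ) (Ru : Matrix (Fin du) (Fin du) ℝ)
    (θs : LinSystem dx du) (K : Controller dx du) (P : Matrix (Fin dx) (Fin dx) ℝ)
    (s β r : ℝ) : Prop where
  state_cost : (Rx - 1).PosSemidef
  input_cost : (Ru - 1).PosSemidef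
  pair : RiccatiPair Rx Ru θs K P
  one_le : 1 ≤ s
  qf_le : ∀ x, qf P x ≤ s ^ 2 * (x ⬝ᵥ x)
  input_le : opNorm (LinSystem.B θs) ≤ β
  radius_pos : 0 < r
  radius_le : 150 * s ^ 10 * r ≤ 1
  radius_mul_le : 240 * β * s ^ 10 * r ≤ 1
  radius_le_input : r ≤ β / 2

variable {Rx : Matrix (Fin dx) (Fin dx) ℝ} {Ru : Matrix (Fin du) (Fin du) ℝ}
  {θs : LinSystem dx du} {Ks : Controller dx du} {Ps : Matrix (Fin dx) (Fin dx) ℝ} {s β r : ℝ}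

theorem closedLoop_eq_add (θ θs : LinSystem dx du) (K Ks : Controller dx du) :
    closedLoop θ K = closedLoop θs Ks + (closedLoop (θ - θs) Ks + LinSystem.B θ * (K - Ks)) := by
  simp only [closedLoop, LinSystem.A_sub, LinSystem.B_sub, Matrix.sub_mul, Matrix.mul_sub]
  abel

theorem LocalRegion.input_pos (h : LocalRegion Rx Ru θs Ks Ps s β r) : 0 < β := by
  linarith [h.radius_pos, h.radius_le_input]

theorem LocalRegion.opNorm_gain_sq_le (h : LocalRegion Rx Ru θs Ks Ps s β r) :
    opNorm Ks ^ 2 ≤ s ^ 2 - 1 :=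
  h.pair.gain_sq_le h.state_cost h.input_cost (one_le_pow₀ h.one_le) h.qf_le

theorem LocalRegion.opNorm_input_le (h : LocalRegion Rx Ru θs Ks Ps s β r)
    {θ : LinSystem dx du} (hθ : ‖θ - θs‖ ≤ r) : opNorm (LinSystem.B θ) ≤ 3 / 2 * β := by
  have e : LinSystem.B θ = LinSystem.B θs + LinSystem.B (θ - θs) := by
    rw [LinSystem.B_sub]; abel
  rw [e]
  linarith [opNorm_add_le (LinSystem.B θs) (LinSystem.B (θ - θs)), h.input_le,
    opNorm_le_norm (LinSystem.B (θ - θs)), LinSystem.norm_B_le (θ - θs), h.radius_le_input]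

theorem LocalRegion.norm_closedLoop_sub_le (h : LocalRegion Rx Ru θs Ks Ps s β r)
    (δ : LinSystem dx du) : ‖closedLoop δ Ks‖ ≤ s * ‖δ‖ := by
  have h1 := norm_closedLoop_sq_le δ Ks h.opNorm_gain_sq_le
  rwa [Real.sqrt_sq (by linarith [h.one_le])] at h1

theorem LocalRegion.lyapunov_nominal_gain (h : LocalRegion Rx Ru θs Ks Ps s β r)
    {θ : LinSystem dx du} (hθ : ‖θ - θs‖ ≤ r) (x : Fin dx → ℝ) :
    49 / 50 * qf (costMatrix Rx Ru Ks) x + qf Ps (closedLoop θ Ks *ᵥ x) ≤ qf Ps x := by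
  have hs := h.one_le
  have hs0 : 0 < s := by linarith
  have hr := h.radius_pos
  have hE : opNorm (closedLoop (θ - θs) Ks) ≤ s * r := (opNorm_le_norm _).trans
    ((h.norm_closedLoop_sub_le _).trans (by gcongr))
  have e : closedLoop θ Ks = closedLoop θs Ks + closedLoop (θ - θs) Ks := by
    rw [closedLoop_eq_add θ θs Ks Ks]; simp
  -- With s³r ≤ 1/150 the error is at most 2/150 + 1/150² < 1/50, which leaves the fraction 49/50 of
  -- the stage cost.
  have hε : s ^ 2 * (2 * (s * r) + (s * r) ^ 2) ≤ 1 / 50 := by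
    have h1 : s ^ 3 * r ≤ 1 / 150 := by
      have : s ^ 3 * r ≤ s ^ 10 * r := by gcongr; norm_num
      linarith [h.radius_le]
    have h2 : s ^ 2 * (2 * (s * r) + (s * r) ^ 2) ≤ 2 * (s ^ 3 * r) + (s ^ 3 * r) ^ 2 := by
      have : s ^ 4 * r ^ 2 ≤ s ^ 6 * r ^ 2 := by gcongr; norm_num
      nlinarith
    have h3 : 0 ≤ s ^ 3 * r := by positivity
    nlinarith
  have := h.pair.lyapunov_perturb h.state_cost h.input_cost (by positivity) h.qf_le
    (by positivity) hE hε x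
  rw [e]
  linarith

theorem LocalRegion.stable_nominal_gain (h : LocalRegion Rx Ru θs Ks Ps s β r)
    {θ : LinSystem dx du} (hθ : ‖θ - θs‖ ≤ r) : Stable (closedLoop θ Ks) := by
  refine stable_of_lyapunov (c := 49 / 50) (by norm_num) h.pair.nonneg fun x => ?_
  linarith [h.lyapunov_nominal_gain hθ x, qf_costMatrix_ge h.state_cost h.input_cost Ks x]

/-- The optimal value at θ is at most the cost of the nominal gain at θ, and the decrease with
constant 49/50 bounds that cost by 50/49 times the nominal value. -/
theorem LocalRegion.qf_value_le (h : LocalRegion Rx Ru θs Ks Ps s β r)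
    {θ : LinSystem dx du} (hθ : ‖θ - θs‖ ≤ r) {K : Controller dx du}
    {P : Matrix (Fin dx) (Fin dx) ℝ} (hp : RiccatiPair Rx Ru θ K P) (x : Fin dx → ℝ) :
    qf P x ≤ 50 / 49 * s ^ 2 * (x ⬝ᵥ x) := by
  have hst := h.stable_nominal_gain hθ
  have h1 := congrArg (fun M => qf M x)
    (hp.dlyap_eq (transpose_eq_of_posSemidef_sub_one h.input_cost) hst)
  simp only [qf_add] at h1
  have h2 := qf_dlyap_nonneg hst (M := (Ks - K)ᵀ * inputGram Ru θ P * (Ks - K)) (fun y => by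
    rw [qf_conj]
    exact (dotProduct_self_nonneg' _).trans (qf_inputGram_ge h.input_cost hp.nonneg _)) x
  have h3 := qf_nonneg_of_le_comp hst
    (Z := (50 / 49 : ℝ) • Ps - dlyap (closedLoop θ Ks) (costMatrix Rx Ru Ks)) (fun y => by
      simp only [qf_sub, qf_smul]
      linarith [h.lyapunov_nominal_gain hθ y, qf_dlyap hst (costMatrix Rx Ru Ks) y]) x
  simp only [qf_sub, qf_smul] at h3
  linarith [h.qf_le x]

/-- In the whole region the nominal value matrix is a Lyapunov function. -/
theorem LocalRegion.lyapunov (h : LocalRegion Rx Ru θs Ks Ps s β r)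
    {θ : LinSystem dx du} (hθ : ‖θ - θs‖ ≤ r) {K : Controller dx du}
    (hK : ‖K - Ks‖ ≤ 8 * s ^ 7 * r) (x : Fin dx → ℝ) :
    4 / 5 * (x ⬝ᵥ x) + qf Ps (closedLoop θ K *ᵥ x) ≤ qf Ps x := by
  have hs := h.one_le
  have hs0 : 0 < s := by linarith
  have hr := h.radius_pos
  have hβ := h.input_pos
  have hE : opNorm (closedLoop (θ - θs) Ks + LinSystem.B θ * (K - Ks))
      ≤ s * r + 12 * β * s ^ 7 * r := by
    refine (opNorm_add_le _ _).trans (add_le_add ((opNorm_le_norm _).trans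
      ((h.norm_closedLoop_sub_le _).trans (by gcongr))) ((opNorm_mul_le _ _).trans ?_))
    calc opNorm (LinSystem.B θ) * opNorm (K - Ks) ≤ 3 / 2 * β * (8 * s ^ 7 * r) :=
          mul_le_mul (h.opNorm_input_le hθ) ((opNorm_le_norm _).trans hK) (opNorm_nonneg _)
            (by positivity)
      _ = _ := by ring
  -- Here 17/300 = 1/150 + 12/240, one summand from each of the two radius conditions.
  have h1 : s ^ 2 * (s * r + 12 * β * s ^ 7 * r) ≤ 17 / 300 := by
    have e1 : s ^ 3 * r ≤ s ^ 10 * r := by gcongr; norm_num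
    have e2 : β * s ^ 9 * r ≤ β * s ^ 10 * r := by gcongr; norm_num
    nlinarith [h.radius_le, h.radius_mul_le]
  set e := s * r + 12 * β * s ^ 7 * r
  have he : 0 < e := by positivity
  have hε : s ^ 2 * (2 * e + e ^ 2) ≤ 1 / 5 := by
    have e1 : e ≤ s ^ 2 * e := le_mul_of_one_le_left he.le (one_le_pow₀ hs)
    nlinarith
  have := h.pair.lyapunov_perturb h.state_cost h.input_cost (by positivity) h.qf_le he hE hε x
  rw [closedLoop_eq_add θ θs K Ks]
  linarith [qf_costMatrix_ge h.state_cost h.input_cost Ks x]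

theorem LocalRegion.stable (h : LocalRegion Rx Ru θs Ks Ps s β r)
    {θ : LinSystem dx du} (hθ : ‖θ - θs‖ ≤ r) {K : Controller dx du}
    (hK : ‖K - Ks‖ ≤ 8 * s ^ 7 * r) : Stable (closedLoop θ K) :=
  stable_of_lyapunov (c := 4 / 5) (by norm_num) h.pair.nonneg (h.lyapunov hθ hK)

end Region

/-! ### The optimal gain in the region -/

section OptimalGain

variable {dx du : ℕ} {Rx : Matrix (Fin dx) (Fin dx) ℝ} {Ru : Matrix (Fin du) (Fin du) ℝ}
  {θs : LinSystem dx du} {Ks : Controller dx du} {Ps : Matrix (Fin dx) (Fin dx) ℝ} {s β r : ℝ}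

theorem LocalRegion.pair_at (h : LocalRegion Rx Ru θs Ks Ps s β r) {σ : ℝ≥0} (hσ : 0 < σ)
    {θ : LinSystem dx du} (hθ : ‖θ - θs‖ ≤ r) :
    RiccatiPair Rx Ru θ (optDecision (lqrRisk σ Rx Ru) θ) (riccati Rx Ru θ) := by
  obtain ⟨K, hK⟩ := riccatiPair_of_stable h.state_cost h.input_cost (h.stable_nominal_gain hθ)
  rwa [hK.optDecision_eq hσ h.state_cost h.input_cost]

/-- The estimates at a single system apply with Ψ = 50/49 s², which bounds the value matrix
throughout the ball. -/
theorem LocalRegion.jetBound_optDecision (h : LocalRegion Rx Ru θs Ks Ps s β r) {σ : ℝ≥0}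
    (hσ : 0 < σ) {θ : LinSystem dx du} (hθ : ‖θ - θs‖ ≤ r) :
    JetBound (optDecision (lqrRisk σ Rx Ru)) θ (8 * s ^ 7) (100 * s ^ 12) (4600 * s ^ 18) := by
  have hp := h.pair_at hσ hθ
  obtain ⟨hc, hev⟩ := hp.contDiffAt_optDecision hσ h.state_cost h.input_cost
  have hs := h.one_le
  have hs0 : 0 < s := by linarith
  refine JetBound.of_lines hc (by positivity) (by positivity) (by positivity) fun δ hδ => ?_
  obtain ⟨K₁, K₂, K₃, hch, b1, b2, b3⟩ := hp.gain_jet_bounds h.state_cost h.input_cost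
    (Ψ := 50 / 49 * s ^ 2) (by nlinarith) (h.qf_value_le hθ hp) hδ.le hc rfl hev
  have hsq : √(50 / 49 * s ^ 2) ≤ 50 / 49 * s := by
    rw [Real.sqrt_le_left (by positivity)]
    nlinarith [sq_nonneg s]
  refine ⟨_, K₁, K₂, K₃, hch, Eventually.of_forall fun _ => rfl, b1.trans ?_, b2.trans ?_,
    b3.trans ?_⟩
  -- The powers of 50/49 are absorbed in the constants. The powers of s are rounded up to the stated
  -- 7, and below to the even exponents 12 and 18, so that those bounds are polynomial in s².
  · calc √(50 / 49 * s ^ 2) * (4 * (50 / 49 * s ^ 2) ^ 2)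
        ≤ 50 / 49 * s * (4 * (50 / 49 * s ^ 2) ^ 2) := by gcongr
      _ = 4 * (50 / 49) ^ 3 * s ^ 5 := by ring
      _ ≤ 8 * s ^ 7 := by gcongr <;> first | exact hs | norm_num
  · calc √(50 / 49 * s ^ 2) * (84 * (50 / 49 * s ^ 2) ^ 5)
        ≤ 50 / 49 * s * (84 * (50 / 49 * s ^ 2) ^ 5) := by gcongr
      _ = 84 * (50 / 49) ^ 6 * s ^ 11 := by ring
      _ ≤ 100 * s ^ 12 := by gcongr <;> first | exact hs | norm_num
  · calc √(50 / 49 * s ^ 2) * (3792 * (50 / 49 * s ^ 2) ^ 8)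
        ≤ 50 / 49 * s * (3792 * (50 / 49 * s ^ 2) ^ 8) := by gcongr
      _ = 3792 * (50 / 49) ^ 9 * s ^ 17 := by ring
      _ ≤ 4600 * s ^ 18 := by gcongr <;> first | exact hs | norm_num

/-- The mean value inequality with the first derivative bound: the optimal gains stay within the
same radius as the gains under study. -/
theorem LocalRegion.norm_optDecision_sub_le (h : LocalRegion Rx Ru θs Ks Ps s β r) {σ : ℝ≥0}
    (hσ : 0 < σ) {θ : LinSystem dx du} (hθ : ‖θ - θs‖ ≤ r) :
    ‖optDecision (lqrRisk σ Rx Ru) θ - Ks‖ ≤ 8 * s ^ 7 * r := by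
  have hs0 : 0 < s := by linarith [h.one_le]
  have e : optDecision (lqrRisk σ Rx Ru) θs = Ks :=
    h.pair.optDecision_eq hσ h.state_cost h.input_cost
  have := JetBound.norm_image_sub_le h.radius_pos.le
    (fun y hy => h.jetBound_optDecision hσ hy) hθ
  rw [e] at this
  exact this.trans (by gcongr)

end OptimalGain

/-! ### Lyapunov equations along lines -/

section LyapunovLine

variable {m n : ℕ}

/-- The symmetrized product `Uᵀ X V + Vᵀ X U`. -/
def crossTerm (U : Matrix (Fin m) (Fin n) ℝ) (X : Matrix (Fin m) (Fin m) ℝ)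
    (V : Matrix (Fin m) (Fin n) ℝ) : Matrix (Fin n) (Fin n) ℝ :=
  Uᵀ * X * V + Vᵀ * X * U

theorem hasDerivAt_crossTerm_line (N W : Matrix (Fin n) (Fin n) ℝ)
    {X : ℝ → Matrix (Fin n) (Fin n) ℝ} {X' t} (hX : HasDerivAt X X' t) :
    HasDerivAt (fun t => crossTerm N (X t) (W + t • N))
      (crossTerm N X' (W + t • N) + (2 : ℝ) • (Nᵀ * X t * N)) t := by
  have hW := hasDerivAt_mat_line W N t
  refine hasDerivAt_congr_mat ((((hasDerivAt_const t Nᵀ).matMul hX).matMul hW).add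
    ((hW.matTranspose.matMul hX).matMul (hasDerivAt_const t N))) ?_
  simp only [crossTerm, Matrix.zero_mul, zero_add, Matrix.mul_zero, add_zero, Matrix.add_mul]
  rw [two_smul]
  abel

theorem hasDerivAt_smul_mat {a b : ℕ} {f : ℝ → Matrix (Fin a) (Fin b) ℝ} {f' t} (c : ℝ)
    (h : HasDerivAt f f' t) : HasDerivAt (fun s => c • f s) (c • f') t :=
  HasDerivAt.const_smul c h

theorem hasDerivAt_quadratic_mat {a b : ℕ} (M₀ M₁ M₂ : Matrix (Fin a) (Fin b) ℝ) (t : ℝ) :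
    HasDerivAt (fun t : ℝ => M₀ + t • M₁ + t ^ 2 • M₂) (M₁ + (2 * t) • M₂) t := by
  have h2 : HasDerivAt (fun t : ℝ => t ^ 2) (2 * t) t := by
    simpa using hasDerivAt_pow 2 t
  exact HasDerivAt.add (hasDerivAt_mat_line M₀ M₁ t) (h2.smul_const M₂)

theorem hasDerivAt_affine_mat {a b : ℕ} (M₁ M₂ : Matrix (Fin a) (Fin b) ℝ) (t : ℝ) :
    HasDerivAt (fun t : ℝ => M₁ + (2 * t) • M₂) ((2 : ℝ) • M₂) t := by
  have h2 : HasDerivAt (fun t : ℝ => 2 * t) 2 t := by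
    simpa using (hasDerivAt_id t).const_mul (2 : ℝ)
  refine hasDerivAt_congr_mat ((hasDerivAt_const t M₁).add (h2.smul_const M₂)) ?_
  simp

/-- The derivatives of the solution of a Lyapunov equation whose matrix moves along a line and
whose right-hand side is quadratic. -/
theorem derivChain_dlyap {W N M₀ M₁ M₂ : Matrix (Fin n) (Fin n) ℝ} (hW : Stable W) :
    ∃ X₁ X₂ X₃ : ℝ → Matrix (Fin n) (Fin n) ℝ,
      DerivChain (fun t : ℝ => dlyap (W + t • N) (M₀ + t • M₁ + t ^ 2 • M₂)) X₁ X₂ X₃ ∧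
      X₁ 0 = dlyap W (crossTerm N (dlyap W M₀) W + M₁) ∧
      X₂ 0 = dlyap W ((2 : ℝ) • crossTerm N (X₁ 0) W
        + ((2 : ℝ) • (Nᵀ * dlyap W M₀ * N) + (2 : ℝ) • M₂)) ∧
      X₃ 0 = dlyap W ((3 : ℝ) • crossTerm N (X₂ 0) W + (6 : ℝ) • (Nᵀ * X₁ 0 * N)) := by
  set X := fun t : ℝ => dlyap (W + t • N) (M₀ + t • M₁ + t ^ 2 • M₂) with hX
  set X₁ := fun t : ℝ => dlyap (W + t • N) (crossTerm N (X t) (W + t • N) + (M₁ + (2 * t) • M₂))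
    with hX₁
  set X₂ := fun t : ℝ => dlyap (W + t • N) ((2 : ℝ) • crossTerm N (X₁ t) (W + t • N)
    + ((2 : ℝ) • (Nᵀ * X t * N) + (2 : ℝ) • M₂)) with hX₂
  set X₃ := fun t : ℝ => dlyap (W + t • N) ((3 : ℝ) • crossTerm N (X₂ t) (W + t • N)
    + (6 : ℝ) • (Nᵀ * X₁ t * N)) with hX₃
  have hst : ∀ᶠ t in 𝓝 (0 : ℝ), Stable (W + t • N) := by
    have hW' : ∀ᶠ V in 𝓝 (W + (0 : ℝ) • N), Stable V := by
      simpa only [zero_smul, add_zero] using hW.eventually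
    exact (show Tendsto (fun t : ℝ => W + t • N) (𝓝 0) (𝓝 (W + (0 : ℝ) • N)) from
      (hasDerivAt_mat_line W N 0).continuousAt).eventually hW'
  have d0 : ∀ t, Stable (W + t • N) → HasDerivAt X (X₁ t) t := fun t ht => by
    refine hasDerivAt_congr_mat (hasDerivAt_dlyap (hasDerivAt_mat_line W N t)
      (hasDerivAt_quadratic_mat M₀ M₁ M₂ t) ht) ?_
    rfl
  -- One cross term in X₁ comes from moving the Lyapunov operator, the other from differentiating
  -- the source; this explains the coefficient 2.
  have d1 : ∀ t, Stable (W + t • N) → HasDerivAt X₁ (X₂ t) t := fun t ht => by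
    refine hasDerivAt_congr_mat (hasDerivAt_dlyap (hasDerivAt_mat_line W N t)
      ((hasDerivAt_crossTerm_line N W (d0 t ht)).add (hasDerivAt_affine_mat M₁ M₂ t)) ht) ?_
    simp only [hX₂]
    congr 1
    change crossTerm N (X₁ t) (W + t • N) + (crossTerm N (X₁ t) (W + t • N) + _ + _) = _
    rw [two_smul ℝ (crossTerm _ _ _)]
    abel
  -- Again 3 = 1 + 2, and 6 = 4 + 2 counts the terms NᵀX₁N. The quadratic data no longer contribute.
  have d2 : ∀ t, Stable (W + t • N) → HasDerivAt X₂ (X₃ t) t := fun t ht => by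
    refine hasDerivAt_congr_mat (hasDerivAt_dlyap (hasDerivAt_mat_line W N t)
      ((hasDerivAt_smul_mat 2 (hasDerivAt_crossTerm_line N W (d1 t ht))).add
        ((hasDerivAt_smul_mat 2 (((hasDerivAt_const t Nᵀ).matMul (d0 t ht)).matMul
          (hasDerivAt_const t N))).add (hasDerivAt_const t ((2 : ℝ) • M₂)))) ht) ?_
    simp only [hX₃]
    congr 1
    change crossTerm N (X₂ t) (W + t • N) + _ = _
    simp only [Matrix.zero_mul, Matrix.mul_zero, zero_add, add_zero, smul_add]
    module
  refine ⟨X₁, X₂, X₃, ⟨hst.mono d0, hst.mono d1, hst.mono d2⟩, ?_, ?_, ?_⟩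
  · simp [hX₁, hX]
  · simp [hX₂, hX]
  · simp [hX₃]

theorem DerivChain.mul_trace {X X₁ X₂ X₃ : ℝ → Matrix (Fin n) (Fin n) ℝ}
    (h : DerivChain X X₁ X₂ X₃) (c d : ℝ) :
    DerivChain (fun t => c * ((X t).trace - d)) (fun t => c * (X₁ t).trace)
      (fun t => c * (X₂ t).trace) (fun t => c * (X₃ t).trace) :=
  ⟨h.one.mono fun _ ht => (ht.matTrace.sub_const d).const_mul c,
    h.two.mono fun _ ht => ht.matTrace.const_mul c,
    h.three.mono fun _ ht => ht.matTrace.const_mul c⟩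

/-! ### Domination by a Lyapunov function -/

/-- `M` is symmetric and its form is at most `b` times the Euclidean one. -/
structure FormBound (M : Matrix (Fin n) (Fin n) ℝ) (b : ℝ) : Prop where
  symm : Mᵀ = M
  nonneg : 0 ≤ b
  le : ∀ x, |qf M x| ≤ b * (x ⬝ᵥ x)

/-- `X` is symmetric and its form is at most `b` times that of `P`. -/
structure Dominated (P X : Matrix (Fin n) (Fin n) ℝ) (b : ℝ) : Prop where
  symm : Xᵀ = X
  nonneg : 0 ≤ b
  le : ∀ x, |qf X x| ≤ b * qf P x

theorem FormBound.add {M N : Matrix (Fin n) (Fin n) ℝ} {a b : ℝ} (hM : FormBound M a)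
    (hN : FormBound N b) : FormBound (M + N) (a + b) where
  symm := by rw [Matrix.transpose_add, hM.symm, hN.symm]
  nonneg := add_nonneg hM.nonneg hN.nonneg
  le x := by
    rw [qf_add, add_mul]
    exact (abs_add_le _ _).trans (add_le_add (hM.le x) (hN.le x))

theorem FormBound.smul {M : Matrix (Fin n) (Fin n) ℝ} {a c : ℝ} (hc : 0 ≤ c)
    (hM : FormBound M a) : FormBound (c • M) (c * a) where
  symm := by rw [Matrix.transpose_smul, hM.symm]
  nonneg := mul_nonneg hc hM.nonneg
  le x := by
    rw [qf_smul, abs_mul, abs_of_nonneg hc, mul_assoc]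
    exact mul_le_mul_of_nonneg_left (hM.le x) hc

theorem FormBound.mono {M : Matrix (Fin n) (Fin n) ℝ} {a b : ℝ} (hM : FormBound M a)
    (h : a ≤ b) : FormBound M b where
  symm := hM.symm
  nonneg := hM.nonneg.trans h
  le x := (hM.le x).trans (mul_le_mul_of_nonneg_right h (dotProduct_self_nonneg' x))

theorem FormBound.of_opNorm {M : Matrix (Fin n) (Fin n) ℝ} (hs : Mᵀ = M) {b : ℝ}
    (h : opNorm M ≤ b) : FormBound M b where
  symm := hs
  nonneg := (opNorm_nonneg M).trans h
  le x := (abs_qf_le M x).trans (mul_le_mul_of_nonneg_right h (dotProduct_self_nonneg' x))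

/-- `P` is a Lyapunov function of size `s ^ 2` for the matrix `W`. -/
structure LyapunovFunction (P W : Matrix (Fin n) (Fin n) ℝ) (s : ℝ) : Prop where
  symm : Pᵀ = P
  nonneg : ∀ x, 0 ≤ qf P x
  qf_le : ∀ x, qf P x ≤ s ^ 2 * (x ⬝ᵥ x)
  decrease : ∀ x, 4 / 5 * (x ⬝ᵥ x) + qf P (W *ᵥ x) ≤ qf P x

theorem LyapunovFunction.stable {P W : Matrix (Fin n) (Fin n) ℝ} {s : ℝ}
    (h : LyapunovFunction P W s) : Stable W :=
  stable_of_lyapunov (c := 4 / 5) (by norm_num) h.nonneg h.decrease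

/-- The comparison principle with decrease constant 4/5: every Lyapunov solve costs the factor 5/4.
-/
theorem LyapunovFunction.dominated {P W : Matrix (Fin n) (Fin n) ℝ} {s : ℝ}
    (h : LyapunovFunction P W s) {M : Matrix (Fin n) (Fin n) ℝ} {b b' : ℝ} (hM : FormBound M b)
    (hb : 5 / 4 * b ≤ b') : Dominated P (dlyap W M) b' where
  symm := dlyap_transpose h.stable hM.symm
  nonneg := (mul_nonneg (by norm_num) hM.nonneg).trans hb
  le x := (abs_qf_dlyap_le h.stable (by norm_num) h.decrease hM.nonneg hM.le x).trans
    (mul_le_mul_of_nonneg_right (by linarith) (h.nonneg x))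

theorem LyapunovFunction.qf_self_le {P W : Matrix (Fin n) (Fin n) ℝ} {s : ℝ}
    (h : LyapunovFunction P W s) (x : Fin n → ℝ) :
    qf P (W *ᵥ x) ≤ s ^ 2 * 1 ^ 2 * (x ⬝ᵥ x) := by
  linarith [h.decrease x, h.qf_le x, dotProduct_self_nonneg' x]

/-- Polarization of X at u ± v, with the parallelogram law for P on the right-hand side. -/
theorem Dominated.two_mul_le {P X : Matrix (Fin n) (Fin n) ℝ} {b : ℝ} (h : Dominated P X b)
    (hP : Pᵀ = P) (u v : Fin n → ℝ) : |2 * (u ⬝ᵥ (X *ᵥ v))| ≤ b * (qf P u + qf P v) := by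
  have hsym : ∀ {M : Matrix (Fin n) (Fin n) ℝ}, Mᵀ = M → v ⬝ᵥ (M *ᵥ u) = u ⬝ᵥ (M *ᵥ v) := by
    intro M hM
    rw [← dotProduct_transpose_mulVec M u v |>.trans (dotProduct_comm _ _), hM]
  have hX := hsym h.symm
  have hP' := hsym hP
  have e1 : ∀ {M : Matrix (Fin n) (Fin n) ℝ}, v ⬝ᵥ (M *ᵥ u) = u ⬝ᵥ (M *ᵥ v) →
      qf M (u + v) = qf M u + qf M v + 2 * (u ⬝ᵥ (M *ᵥ v)) ∧
      qf M (u - v) = qf M u + qf M v - 2 * (u ⬝ᵥ (M *ᵥ v)) := by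
    intro M hM
    constructor
    · simp only [qf, Matrix.mulVec_add, dotProduct_add, add_dotProduct, hM]; ring
    · simp only [qf, Matrix.mulVec_sub, dotProduct_sub, sub_dotProduct, hM]; ring
  have h1 := abs_le.1 (h.le (u + v))
  have h2 := abs_le.1 (h.le (u - v))
  rw [(e1 hX).1, (e1 hP').1] at h1
  rw [(e1 hX).2, (e1 hP').2] at h2
  rw [abs_le]
  constructor <;> linarith [h1.1, h1.2, h2.1, h2.2]

theorem Dominated.crossTerm {P X : Matrix (Fin n) (Fin n) ℝ} {b : ℝ} (h : Dominated P X b)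
    (hP : Pᵀ = P) {U V : Matrix (Fin n) (Fin m) ℝ} {s u v : ℝ} (hu : 0 < u) (hv : 0 < v)
    (hU : ∀ x, qf P (U *ᵥ x) ≤ s ^ 2 * u ^ 2 * (x ⬝ᵥ x))
    (hV : ∀ x, qf P (V *ᵥ x) ≤ s ^ 2 * v ^ 2 * (x ⬝ᵥ x)) :
    FormBound (crossTerm U X V) (2 * b * s ^ 2 * u * v) where
  symm := by
    simp only [_root_.crossTerm, Matrix.transpose_add, Matrix.transpose_mul,
      Matrix.transpose_transpose, h.symm, Matrix.mul_assoc]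
    exact add_comm _ _
  nonneg := by have := h.nonneg; positivity
  le x := by
    have e : qf (_root_.crossTerm U X V) x = 2 * ((U *ᵥ x) ⬝ᵥ (X *ᵥ (V *ᵥ x))) := by
      rw [_root_.crossTerm, qf_add, ← qf_transpose (Vᵀ * X * U)]
      simp only [Matrix.transpose_mul, Matrix.transpose_transpose, h.symm]
      rw [← Matrix.mul_assoc, qf_transpose_mul_mul]; ring
    -- Rescaling by the opposite sizes makes both P-terms at most s²u²v²|x|²; dividing by uv then
    -- gives a product bound in place of a sum of squares.
    have h1 := h.two_mul_le hP (v • (U *ᵥ x)) (u • (V *ᵥ x))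
    have e2 : ∀ (c : ℝ) y, qf P (c • y) = c ^ 2 * qf P y := fun c y => by
      simp only [qf, Matrix.mulVec_smul, dotProduct_smul, smul_dotProduct, smul_eq_mul]; ring
    have e3 : 2 * ((v • (U *ᵥ x)) ⬝ᵥ (X *ᵥ (u • (V *ᵥ x))))
        = (u * v) * (2 * ((U *ᵥ x) ⬝ᵥ (X *ᵥ (V *ᵥ x)))) := by
      simp only [Matrix.mulVec_smul, dotProduct_smul, smul_dotProduct, smul_eq_mul]; ring
    rw [e3, e2, e2, ← e, abs_mul, abs_of_pos (mul_pos hu hv)] at h1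
    have h2 : u * v * |qf (_root_.crossTerm U X V) x|
        ≤ u * v * (2 * b * s ^ 2 * u * v * (x ⬝ᵥ x)) := by
      refine h1.trans ?_
      have h3 := mul_le_mul_of_nonneg_left (hU x) (sq_nonneg v)
      have h4 := mul_le_mul_of_nonneg_left (hV x) (sq_nonneg u)
      have h5 := mul_le_mul_of_nonneg_left (add_le_add h3 h4) h.nonneg
      linarith
    exact le_of_mul_le_mul_left h2 (mul_pos hu hv)

theorem Dominated.conj {P X : Matrix (Fin n) (Fin n) ℝ} {b : ℝ} (h : Dominated P X b)
    {U : Matrix (Fin n) (Fin m) ℝ} {s u : ℝ}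
    (hU : ∀ x, qf P (U *ᵥ x) ≤ s ^ 2 * u ^ 2 * (x ⬝ᵥ x)) :
    FormBound (Uᵀ * X * U) (b * s ^ 2 * u ^ 2) where
  symm := by simp [Matrix.transpose_mul, h.symm, Matrix.mul_assoc]
  nonneg := by have := h.nonneg; positivity
  le x := by
    rw [qf_conj]
    exact (h.le _).trans ((mul_le_mul_of_nonneg_left (hU x) h.nonneg).trans (le_of_eq (by ring)))

/-- Domination gives |X| ≤ b s² I as forms; taking the trace is the source of the dimension factor.
-/
theorem LyapunovFunction.abs_trace_le {P W X : Matrix (Fin n) (Fin n) ℝ} {s b : ℝ}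
    (h : LyapunovFunction P W s) (hX : Dominated P X b) : |X.trace| ≤ b * (n * s ^ 2) := by
  have h1 := abs_trace_le_of_qf_le (M := X) (N := (b * s ^ 2) • (1 : Matrix (Fin n) (Fin n) ℝ))
    fun x => by
      rw [qf_smul, qf_one]
      exact (hX.le x).trans ((mul_le_mul_of_nonneg_left (h.qf_le x) hX.nonneg).trans
        (le_of_eq (by ring)))
  rw [Matrix.trace_smul, Matrix.trace_one, Fintype.card_fin, smul_eq_mul] at h1
  linarith

end LyapunovLine

/-! ### Derivatives of the risk -/

section RiskDerivatives

variable {dx du n : ℕ}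

/-- The hypotheses on b₀, b₁, b₂ are 5/4 times the sizes of the successive sources. The factor 1
beside ν is the size of W relative to P, since P does not increase along W. -/
theorem LyapunovFunction.jet_dominated {P W N M₀ M₁ M₂ : Matrix (Fin n) (Fin n) ℝ} {s ν : ℝ}
    (h : LyapunovFunction P W s) (hν : 0 < ν) (hN : opNorm N ≤ ν) {m₀ m₁ m₂ b₀ b₁ b₂ : ℝ}
    (h₀ : FormBound M₀ m₀) (h₁ : FormBound M₁ m₁) (h₂ : FormBound M₂ m₂)
    (hb₀ : 5 / 4 * m₀ ≤ b₀) (hb₁ : 5 / 4 * (2 * b₀ * s ^ 2 * ν * 1 + m₁) ≤ b₁)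
    (hb₂ : 5 / 4 * (2 * (2 * b₁ * s ^ 2 * ν * 1) + (2 * (b₀ * s ^ 2 * ν ^ 2) + 2 * m₂)) ≤ b₂)
    {X₁ X₂ : Matrix (Fin n) (Fin n) ℝ}
    (hX₁ : X₁ = dlyap W (crossTerm N (dlyap W M₀) W + M₁))
    (hX₂ : X₂ = dlyap W ((2 : ℝ) • crossTerm N X₁ W
        + ((2 : ℝ) • (Nᵀ * dlyap W M₀ * N) + (2 : ℝ) • M₂))) :
    Dominated P (dlyap W M₀) b₀ ∧ Dominated P X₁ b₁ ∧ Dominated P X₂ b₂ := by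
  have hNP := qf_mulVec_le (sq_nonneg s) h.qf_le hN
  have d₀ := h.dominated h₀ hb₀
  have d₁ : Dominated P X₁ b₁ := hX₁ ▸
    h.dominated ((d₀.crossTerm h.symm hν one_pos hNP h.qf_self_le).add h₁) hb₁
  refine ⟨d₀, d₁, hX₂ ▸ h.dominated (((d₁.crossTerm h.symm hν one_pos hNP h.qf_self_le).smul
    zero_le_two).add (((d₀.conj hNP).smul zero_le_two).add (h₂.smul zero_le_two))) hb₂⟩

theorem LyapunovFunction.third_dominated {P W N : Matrix (Fin n) (Fin n) ℝ} {s ν : ℝ}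
    (h : LyapunovFunction P W s) (hν : 0 < ν) (hN : opNorm N ≤ ν) {b₁ b₂ b₃ : ℝ}
    {X₁ X₂ : Matrix (Fin n) (Fin n) ℝ} (h₁ : Dominated P X₁ b₁) (h₂ : Dominated P X₂ b₂)
    (hb₃ : 5 / 4 * (3 * (2 * b₂ * s ^ 2 * ν * 1) + 6 * (b₁ * s ^ 2 * ν ^ 2)) ≤ b₃) :
    Dominated P (dlyap W ((3 : ℝ) • crossTerm N X₂ W + (6 : ℝ) • (Nᵀ * X₁ * N))) b₃ := by
  have hNP := qf_mulVec_le (sq_nonneg s) h.qf_le hN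
  exact h.dominated (((h₂.crossTerm h.symm hν one_pos hNP h.qf_self_le).smul (by norm_num)).add
    ((h₁.conj hNP).smul (by norm_num))) hb₃

theorem closedLoop_line (θ : LinSystem dx du) (K δ : Controller dx du) (t : ℝ) :
    closedLoop θ (K + t • δ) = closedLoop θ K + t • (LinSystem.B θ * δ) := by
  simp only [closedLoop, Matrix.mul_add, Matrix.mul_smul, add_assoc]

theorem conj_line (D δ : Controller dx du) (G : Matrix (Fin du) (Fin du) ℝ) (t : ℝ) :
    (D + t • δ)ᵀ * G * (D + t • δ)
      = Dᵀ * G * D + t • crossTerm δ G D + t ^ 2 • (δᵀ * G * δ) := by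
  simp only [crossTerm, Matrix.transpose_add, Matrix.transpose_smul, Matrix.add_mul,
    Matrix.mul_add, Matrix.smul_mul, Matrix.mul_smul]
  module

variable {Rx : Matrix (Fin dx) (Fin dx) ℝ} {Ru : Matrix (Fin du) (Fin du) ℝ}
  {θs : LinSystem dx du} {Ks : Controller dx du} {Ps : Matrix (Fin dx) (Fin dx) ℝ} {s β r : ℝ}

theorem LocalRegion.lyapunovFunction (h : LocalRegion Rx Ru θs Ks Ps s β r)
    {θ : LinSystem dx du} (hθ : ‖θ - θs‖ ≤ r) {K : Controller dx du}
    (hK : ‖K - Ks‖ ≤ 8 * s ^ 7 * r) : LyapunovFunction Ps (closedLoop θ K) s :=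
  ⟨h.pair.symm, h.pair.nonneg, h.qf_le, h.lyapunov hθ hK⟩

theorem RiccatiPair.toReal_lqrRisk {σ : ℝ≥0} (hσ : 0 < σ) (hRx : (Rx - 1).PosSemidef)
    (hRu : (Ru - 1).PosSemidef) {θ : LinSystem dx du} {K : Controller dx du}
    {P : Matrix (Fin dx) (Fin dx) ℝ} (h : RiccatiPair Rx Ru θ K P) {L : Controller dx du}
    (hL : Stable (closedLoop θ L)) :
    (lqrRisk σ Rx Ru L θ).toReal = (σ : ℝ) ^ 2 *
      (dlyap (closedLoop θ L) ((L - K)ᵀ * inputGram Ru θ P * (L - K))).trace := by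
  rw [h.lqrRisk_of_stable hσ hRx hRu hL, ENNReal.toReal_ofReal]
  exact mul_nonneg (sq_nonneg _) ((sq_nonneg _).trans (h.norm_sq_le hRu hL))

/-- Here the optimal pair enters only through a constant in L, so derivatives in L do not see how
the optimal gain depends on the system. -/
theorem RiccatiPair.toReal_lqrRisk_eq_sub {σ : ℝ≥0} (hσ : 0 < σ) (hRx : (Rx - 1).PosSemidef)
    (hRu : (Ru - 1).PosSemidef) {θ : LinSystem dx du} {K : Controller dx du}
    {P : Matrix (Fin dx) (Fin dx) ℝ} (h : RiccatiPair Rx Ru θ K P) {L : Controller dx du}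
    (hL : Stable (closedLoop θ L)) :
    (lqrRisk σ Rx Ru L θ).toReal = (σ : ℝ) ^ 2 *
      ((dlyap (closedLoop θ L) (costMatrix Rx Ru L)).trace - P.trace) := by
  rw [h.toReal_lqrRisk hσ hRx hRu hL,
    h.dlyap_eq (transpose_eq_of_posSemidef_sub_one hRu) hL, Matrix.trace_add, add_sub_cancel_left]

theorem eventually_stable_gain {θ : LinSystem dx du} {K : Controller dx du}
    (h : Stable (closedLoop θ K)) : ∀ᶠ L in 𝓝 K, Stable (closedLoop θ L) := by
  have hc : ContDiffAt ℝ ω (fun L : Controller dx du => closedLoop θ L) K :=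
    ContDiffAt.closedLoop contDiffAt_const contDiffAt_id
  exact hc.continuousAt.eventually h.eventually

theorem RiccatiPair.contDiffAt_lqrRisk {σ : ℝ≥0} (hσ : 0 < σ) (hRx : (Rx - 1).PosSemidef)
    (hRu : (Ru - 1).PosSemidef) {θ : LinSystem dx du} {K : Controller dx du}
    {P : Matrix (Fin dx) (Fin dx) ℝ} (h : RiccatiPair Rx Ru θ K P) {L : Controller dx du}
    (hL : Stable (closedLoop θ L)) :
    ContDiffAt ℝ ω (fun L => (lqrRisk σ Rx Ru L θ).toReal) L := by
  have h1 : ContDiffAt ℝ ω (fun L : Controller dx du => (valueMatrix Rx Ru θ L).trace) L :=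
    (ContDiffAt.valueMatrix Rx Ru contDiffAt_const contDiffAt_id hL).matTrace
  have h2 : ContDiffAt ℝ ω (fun L : Controller dx du =>
      (σ : ℝ) ^ 2 * ((valueMatrix Rx Ru θ L).trace - P.trace)) L :=
    contDiffAt_const.mul (h1.sub contDiffAt_const)
  refine h2.congr_of_eventuallyEq ?_
  filter_upwards [eventually_stable_gain hL] with M hM
  exact h.toReal_lqrRisk_eq_sub hσ hRx hRu hM

theorem eventually_stable_line {θ : LinSystem dx du} {K : Controller dx du}
    (h : Stable (closedLoop θ K)) (δ : Controller dx du) :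
    ∀ᶠ t in 𝓝 (0 : ℝ), Stable (closedLoop θ (K + t • δ)) := by
  have h' : ∀ᶠ L in 𝓝 (K + (0 : ℝ) • δ), Stable (closedLoop θ L) := by
    simpa only [zero_smul, add_zero] using eventually_stable_gain h
  exact (show Tendsto (fun t : ℝ => K + t • δ) (𝓝 0) (𝓝 (K + (0 : ℝ) • δ)) from
    (hasDerivAt_mat_line K δ 0).continuousAt).eventually h'

/-- The identity with s = 1 plays the role of P on the input space, so that the domination lemmas
also cover the quadratic data. -/
theorem qf_one_mulVec_le {a b : ℕ} {M : Matrix (Fin a) (Fin b) ℝ} {c : ℝ} (h : opNorm M ≤ c)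
    (x : Fin b → ℝ) : qf 1 (M *ᵥ x) ≤ 1 ^ 2 * c ^ 2 * (x ⬝ᵥ x) := by
  have := qf_mulVec_le (P := 1) (Ψ := 1 ^ 2) (by norm_num) (fun x => by rw [qf_one]; linarith) h x
  exact this

theorem LocalRegion.dominated_inputGram (h : LocalRegion Rx Ru θs Ks Ps s β r) {ρ : ℝ}
    (hρ : opNorm Ru ≤ ρ) {θ : LinSystem dx du} (hθ : ‖θ - θs‖ ≤ r) {K : Controller dx du}
    {P : Matrix (Fin dx) (Fin dx) ℝ} (hp : RiccatiPair Rx Ru θ K P) :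
    Dominated 1 (inputGram Ru θ P) (ρ + 5 / 2 * β ^ 2 * s ^ 2) where
  symm := inputGram_transpose (transpose_eq_of_posSemidef_sub_one h.input_cost) hp.symm
  nonneg := by have := (opNorm_nonneg Ru).trans hρ; positivity
  le x := by
    rw [abs_of_nonneg ((dotProduct_self_nonneg' x).trans
      (qf_inputGram_ge h.input_cost hp.nonneg x)), qf_one, inputGram, qf_add, qf_conj]
    have h1 := (le_abs_self _).trans (abs_qf_le Ru x)
    have h2 := qf_mulVec_le (by positivity) (h.qf_value_le hθ hp) (h.opNorm_input_le hθ) x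
    have hx := dotProduct_self_nonneg' x
    have h3 := mul_le_mul_of_nonneg_right hρ hx
    have h4 : 0 ≤ β ^ 2 * s ^ 2 * (x ⬝ᵥ x) := by positivity
    -- The value bound 50/49 s² and the input bound 3/2 β give 50/49 · 9/4 ≤ 5/2.
    nlinarith

/-- The risk is written with the source DᵀGD, where D is the distance to the optimal gain of θ. It
vanishes to second order at D = 0, so the gradient bound carries the small factor 16 s⁷ r, the sum
of two radii of gains. -/
theorem LocalRegion.jetBound_risk (h : LocalRegion Rx Ru θs Ks Ps s β r) {σ : ℝ≥0} (hσ : 0 < σ)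
    {ρ : ℝ} (hρ : opNorm Ru ≤ ρ) {θ : LinSystem dx du} (hθ : ‖θ - θs‖ ≤ r)
    {K : Controller dx du} (hK : ‖K - Ks‖ ≤ 8 * s ^ 7 * r) :
    JetBound (fun L => (lqrRisk σ Rx Ru L θ).toReal) K
      ((σ : ℝ) ^ 2 * (3 * (ρ + 5 / 2 * β ^ 2 * s ^ 2) * (16 * s ^ 7 * r) * (dx * s ^ 2)))
      ((σ : ℝ) ^ 2 * (5 * (ρ + 5 / 2 * β ^ 2 * s ^ 2) * (dx * s ^ 2)))
      ((σ : ℝ) ^ 2 * (60 * (ρ + 5 / 2 * β ^ 2 * s ^ 2) * (β * s ^ 2) * (dx * s ^ 2))) := by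
  have hp := h.pair_at hσ hθ
  have hKo := h.norm_optDecision_sub_le hσ hθ
  set Ko := optDecision (lqrRisk σ Rx Ru) θ
  set P := riccati Rx Ru θ
  have hG := h.dominated_inputGram hρ hθ hp
  set g := ρ + 5 / 2 * β ^ 2 * s ^ 2
  have hg := hG.nonneg
  have hs := h.one_le
  have hs0 : 0 < s := by linarith
  have hr := h.radius_pos
  have hβ := h.input_pos
  have hst := h.stable hθ hK
  have hL := h.lyapunovFunction hθ hK
  refine JetBound.of_lines (hp.contDiffAt_lqrRisk hσ h.state_cost h.input_cost hst)
    (by positivity) (by positivity) (by positivity) fun δ hδ => ?_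
  set D := K - Ko with hD
  have hDn : opNorm D ≤ 16 * s ^ 7 * r := by
    refine (opNorm_le_norm _).trans ?_
    have e : D = (K - Ks) - (Ko - Ks) := by rw [hD]; abel
    rw [e]
    exact (norm_sub_le _ _).trans (by linarith)
  have hΔ : 0 < 16 * s ^ 7 * r := by positivity
  set N := LinSystem.B θ * δ with hN
  have hδ1 : opNorm δ ≤ 1 := (opNorm_le_norm _).trans hδ.le
  have hNn : opNorm N ≤ 3 / 2 * β := (opNorm_mul_le _ _).trans (by
    calc opNorm (LinSystem.B θ) * opNorm δ ≤ 3 / 2 * β * 1 :=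
          mul_le_mul (h.opNorm_input_le hθ) hδ1 (opNorm_nonneg _) (by positivity)
      _ = _ := mul_one _)
  -- The left side is 24 β s⁹ r, and 24/240 = 1/10. Every occurrence of s²νΔ below is replaced by
  -- 1/10.
  have hy : s ^ 2 * (3 / 2 * β) * (16 * s ^ 7 * r) ≤ 1 / 10 := by
    have e2 : β * s ^ 9 * r ≤ β * s ^ 10 * r := by gcongr; norm_num
    linarith [h.radius_mul_le]
  set Δ := 16 * s ^ 7 * r
  have m0 := hG.conj (qf_one_mulVec_le hDn)
  have m1 := hG.crossTerm Matrix.transpose_one one_pos hΔ (qf_one_mulVec_le hδ1)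
    (qf_one_mulVec_le hDn)
  have m2 := hG.conj (qf_one_mulVec_le hδ1)
  obtain ⟨X₁, X₂, X₃, hch, e₁, e₂, e₃⟩ := derivChain_dlyap (N := N)
    (M₀ := Dᵀ * inputGram Ru θ P * D) (M₁ := crossTerm δ (inputGram Ru θ P) D)
    (M₂ := δᵀ * inputGram Ru θ P * δ) hst
  have hν : 0 < 3 / 2 * β := by positivity
  set ν := 3 / 2 * β with hνd
  have hgΔ : 0 ≤ g * Δ := by positivity
  have hsν : 0 < s ^ 2 * ν := by positivity
  have hννs : ν ≤ s ^ 2 * ν := le_mul_of_one_le_left hν.le (one_le_pow₀ hs)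
  have k1 : g * Δ * (s ^ 2 * ν * Δ) ≤ g * Δ * (1 / 10) := by gcongr
  have k2 : g * (s ^ 2 * ν * Δ) ≤ g * (1 / 10) := by gcongr
  have k3 : g * (s ^ 2 * ν * Δ) * (ν * Δ) ≤ g * (1 / 10) * (1 / 10) := by
    have : ν * Δ ≤ 1 / 10 := le_trans (by gcongr) hy
    gcongr
  have k4 : g * (s ^ 2 * ν * Δ) * ν ≤ g * (1 / 10) * (s ^ 2 * ν) := by gcongr
  -- Rounding up: 5/4 · (2.5/10 + 2) ≤ 3 and 5/4 · (12/10 + 2.5/100 + 2) ≤ 5.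
  obtain ⟨d₀, d₁, d₂⟩ := hL.jet_dominated hν hNn m0 m1 m2
    (b₀ := 5 / 4 * (g * Δ ^ 2)) (b₁ := 3 * g * Δ) (b₂ := 5 * g) (le_of_eq (by ring))
    (by nlinarith) (by nlinarith) e₁ e₂
  -- With ν = 3/2 β the coefficient is 5/4 · (45 + 2.7) ≤ 60.
  have d₃ := hL.third_dominated hν hNn d₁ d₂ (b₃ := 60 * g * (β * s ^ 2)) (by
    have k5 : 0 ≤ g * β * s ^ 2 := by positivity
    rw [hνd] at k4 ⊢
    linarith)
  rw [← e₃] at d₃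
  have fin : ∀ {X : Matrix (Fin dx) (Fin dx) ℝ} {b : ℝ}, Dominated Ps X b →
      ‖(σ : ℝ) ^ 2 * X.trace‖ ≤ (σ : ℝ) ^ 2 * (b * (dx * s ^ 2)) := fun {X b} hX => by
    rw [norm_mul, Real.norm_of_nonneg (sq_nonneg _), Real.norm_eq_abs]
    exact mul_le_mul_of_nonneg_left (hL.abs_trace_le hX) (sq_nonneg _)
  refine ⟨_, _, _, _, hch.mul_trace ((σ : ℝ) ^ 2) 0, ?_, fin d₁, fin d₂, fin d₃⟩
  filter_upwards [eventually_stable_line hst δ] with t ht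
  rw [hp.toReal_lqrRisk hσ h.state_cost h.input_cost ht, sub_zero, closedLoop_line,
    show K + t • δ - Ko = D + t • δ by rw [hD]; abel, conj_line]

end RiskDerivatives

/-! ### Dependence of the Hessian on the system -/

section HessianLipschitz

variable {dx du m n : ℕ}

theorem qf_midpoint_le {P : Matrix (Fin n) (Fin n) ℝ} (hs : Pᵀ = P) (h0 : ∀ x, 0 ≤ qf P x)
    {U V : Matrix (Fin n) (Fin m) ℝ} {c : ℝ} (hU : ∀ x, qf P (U *ᵥ x) ≤ c * (x ⬝ᵥ x))
    (hV : ∀ x, qf P (V *ᵥ x) ≤ c * (x ⬝ᵥ x)) (x : Fin m → ℝ) :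
    qf P (((1 / 2 : ℝ) • (U + V)) *ᵥ x) ≤ c * (x ⬝ᵥ x) := by
  have h1 := qf_add_le hs h0 one_pos (U *ᵥ x) (V *ᵥ x)
  have e : qf P (((1 / 2 : ℝ) • (U + V)) *ᵥ x) = 1 / 4 * qf P (U *ᵥ x + V *ᵥ x) := by
    rw [Matrix.smul_mulVec, Matrix.add_mulVec]
    simp only [qf, Matrix.mulVec_smul, dotProduct_smul, smul_dotProduct, smul_eq_mul]; ring
  rw [e]
  linarith [hU x, hV x]

theorem conj_sub_conj (U V : Matrix (Fin n) (Fin m) ℝ) (X : Matrix (Fin n) (Fin n) ℝ) :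
    Uᵀ * X * U - Vᵀ * X * V = crossTerm (U - V) X ((1 / 2 : ℝ) • (U + V)) := by
  simp only [crossTerm, Matrix.transpose_sub, Matrix.transpose_smul, Matrix.transpose_add,
    Matrix.sub_mul, Matrix.mul_sub, Matrix.add_mul, Matrix.mul_add, Matrix.smul_mul,
    Matrix.mul_smul]
  module

theorem crossTerm_sub_crossTerm (U V U' V' : Matrix (Fin n) (Fin m) ℝ)
    (X X' : Matrix (Fin n) (Fin n) ℝ) :
    crossTerm U X V - crossTerm U' X' V'
      = crossTerm U (X - X') V + (crossTerm (U - U') X' V + crossTerm (V - V') X' U') := by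
  simp only [crossTerm, Matrix.transpose_sub, Matrix.sub_mul, Matrix.mul_sub]
  abel

theorem conj_sub_conj' (U V : Matrix (Fin n) (Fin m) ℝ) (X X' : Matrix (Fin n) (Fin n) ℝ) :
    Uᵀ * X * U - Vᵀ * X' * V
      = Uᵀ * (X - X') * U + crossTerm (U - V) X' ((1 / 2 : ℝ) • (U + V)) := by
  rw [← conj_sub_conj]
  simp only [Matrix.sub_mul, Matrix.mul_sub]
  abel

/-- The difference solves the Lyapunov equation of W, the change of W entering through WᵀX'W -
W'ᵀX'W', which is a cross term with the midpoint. -/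
theorem dlyap_sub_dlyap {W W' M M' : Matrix (Fin n) (Fin n) ℝ} (hW : Stable W)
    (hW' : Stable W') :
    dlyap W M - dlyap W' M'
      = dlyap W (crossTerm (W - W') (dlyap W' M') ((1 / 2 : ℝ) • (W + W')) + (M - M')) := by
  refine eq_dlyap hW ?_
  have h1 := dlyap_eq hW M
  have h2 := dlyap_eq hW' M'
  set X := dlyap W M
  set X' := dlyap W' M'
  rw [← conj_sub_conj, Matrix.mul_sub, Matrix.sub_mul]
  conv_lhs => rw [h1, h2]
  abel

theorem LyapunovFunction.dominated_sub {P W W' M M' : Matrix (Fin n) (Fin n) ℝ} {s e : ℝ}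
    (h : LyapunovFunction P W s) (h' : LyapunovFunction P W' s) (he : 0 < e)
    (hE : opNorm (W - W') ≤ e) {b c z : ℝ} (hX' : Dominated P (dlyap W' M') b)
    (hM : FormBound (M - M') c) (hz : 5 / 4 * (2 * b * s ^ 2 * e * 1 + c) ≤ z) :
    Dominated P (dlyap W M - dlyap W' M') z := by
  rw [dlyap_sub_dlyap h.stable h'.stable]
  exact h.dominated ((hX'.crossTerm h.symm he one_pos (qf_mulVec_le (sq_nonneg s) h.qf_le hE)
    (qf_midpoint_le h.symm h.nonneg h.qf_self_le h'.qf_self_le)).add hM) hz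

/-- Stability of the second derivative of the solution of a Lyapunov equation along a line. -/
theorem LyapunovFunction.second_dominated_sub {P W W' N N' M₀ M₁ M₂ : Matrix (Fin n) (Fin n) ℝ}
    {s e f ν : ℝ} (h : LyapunovFunction P W s) (h' : LyapunovFunction P W' s)
    (he : 0 < e) (hf : 0 < f) (hν : 0 < ν) (hE : opNorm (W - W') ≤ e)
    (hF : opNorm (N - N') ≤ f) (hN : opNorm N ≤ ν) (hN' : opNorm N' ≤ ν)
    {X₁ X₂ X₁' X₂' : Matrix (Fin n) (Fin n) ℝ}
    (hX₁ : X₁ = dlyap W (crossTerm N (dlyap W M₀) W + M₁))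
    (hX₂ : X₂ = dlyap W ((2 : ℝ) • crossTerm N X₁ W
        + ((2 : ℝ) • (Nᵀ * dlyap W M₀ * N) + (2 : ℝ) • M₂)))
    (hX₁' : X₁' = dlyap W' (crossTerm N' (dlyap W' M₀) W' + M₁))
    (hX₂' : X₂' = dlyap W' ((2 : ℝ) • crossTerm N' X₁' W'
        + ((2 : ℝ) • (N'ᵀ * dlyap W' M₀ * N') + (2 : ℝ) • M₂)))
    {b₀ b₁ b₂ z₀ z₁ z₂ : ℝ} (d₀ : Dominated P (dlyap W' M₀) b₀) (d₁ : Dominated P X₁' b₁)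
    (d₂ : Dominated P X₂' b₂) (hz₀ : 5 / 4 * (2 * b₀ * s ^ 2 * e) ≤ z₀)
    (hz₁ : 5 / 4 * (2 * b₁ * s ^ 2 * e
      + (2 * z₀ * s ^ 2 * ν + (2 * b₀ * s ^ 2 * f + 2 * b₀ * s ^ 2 * e * ν))) ≤ z₁)
    (hz₂ : 5 / 4 * (2 * b₂ * s ^ 2 * e
      + (2 * (2 * z₁ * s ^ 2 * ν + (2 * b₁ * s ^ 2 * f + 2 * b₁ * s ^ 2 * e * ν))
        + 2 * (z₀ * s ^ 2 * ν ^ 2 + 2 * b₀ * s ^ 2 * f * ν))) ≤ z₂) :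
    Dominated P (X₂ - X₂') z₂ := by
  have qE := qf_mulVec_le (sq_nonneg s) h.qf_le hE
  have qF := qf_mulVec_le (sq_nonneg s) h.qf_le hF
  have qN := qf_mulVec_le (sq_nonneg s) h.qf_le hN
  have qN' := qf_mulVec_le (sq_nonneg s) h.qf_le hN'
  have cross : ∀ {X X' : Matrix (Fin n) (Fin n) ℝ} {z b : ℝ}, Dominated P (X - X') z →
      Dominated P X' b → FormBound (crossTerm N X W - crossTerm N' X' W')
        (2 * z * s ^ 2 * ν * 1 + (2 * b * s ^ 2 * f * 1 + 2 * b * s ^ 2 * e * ν)) := by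
    intro X X' z b hZ hX'
    rw [crossTerm_sub_crossTerm]
    exact (hZ.crossTerm h.symm hν one_pos qN h.qf_self_le).add
      ((hX'.crossTerm h.symm hf one_pos qF h.qf_self_le).add
        (hX'.crossTerm h.symm he hν qE qN'))
  have k₀ : Dominated P (dlyap W M₀ - dlyap W' M₀) z₀ :=
    h.dominated_sub h' he hE d₀ (c := 0)
      (by rw [sub_self]; exact ⟨Matrix.transpose_zero, le_rfl, fun x => by simp [qf_zero]⟩)
      (by linarith)
  have k₁ : Dominated P (X₁ - X₁') z₁ := by
    have := cross k₀ d₀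
    rw [hX₁, hX₁'] at *
    exact h.dominated_sub h' he hE d₁ (by rw [add_sub_add_right_eq_sub]; exact this)
      (by linarith)
  have hc := cross k₁ d₁
  have hq : FormBound (Nᵀ * dlyap W M₀ * N - N'ᵀ * dlyap W' M₀ * N')
      (z₀ * s ^ 2 * ν ^ 2 + 2 * b₀ * s ^ 2 * f * ν) := by
    rw [conj_sub_conj']
    exact (k₀.conj qN).add (d₀.crossTerm h.symm hf hν qF
      (qf_midpoint_le h.symm h.nonneg qN qN'))
  rw [hX₂, hX₂'] at *
  refine h.dominated_sub h' he hE d₂ (c := 2 * (2 * z₁ * s ^ 2 * ν * 1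
    + (2 * b₁ * s ^ 2 * f * 1 + 2 * b₁ * s ^ 2 * e * ν))
    + 2 * (z₀ * s ^ 2 * ν ^ 2 + 2 * b₀ * s ^ 2 * f * ν)) ?_ (by linarith)
  have := (hc.smul zero_le_two).add (hq.smul zero_le_two)
  rw [smul_sub, smul_sub] at this
  convert this using 1
  abel

variable {Rx : Matrix (Fin dx) (Fin dx) ℝ} {Ru : Matrix (Fin du) (Fin du) ℝ}
  {θs : LinSystem dx du} {Ks : Controller dx du} {Ps : Matrix (Fin dx) (Fin dx) ℝ} {s β r : ℝ}

theorem LocalRegion.opNorm_gain_le (h : LocalRegion Rx Ru θs Ks Ps s β r) {K : Controller dx du}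
    (hK : ‖K - Ks‖ ≤ 8 * s ^ 7 * r) : opNorm K ≤ 11 / 10 * s := by
  have hs := h.one_le
  have hs0 : 0 < s := by linarith
  have hr := h.radius_pos
  have h1 : opNorm Ks ≤ s :=
    le_of_sq_le_sq (by linarith [h.opNorm_gain_sq_le]) hs0.le
  -- So 8 s⁷ r ≤ 8/150 ≤ 1/10, added to the bound s for the nominal gain.
  have e2 : s ^ 7 * r ≤ s ^ 10 * r := by gcongr; norm_num
  have e : K = Ks + (K - Ks) := by abel
  rw [e]
  linarith [opNorm_add_le Ks (K - Ks), opNorm_le_norm (K - Ks), h.radius_le]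

/-- No bound on Rx is assumed: the Riccati equation gives Rx ⪯ Ps, hence Rx ≤ s² as a form. The
input part is at most ρ (11/10)² s². -/
theorem LocalRegion.formBound_costMatrix (h : LocalRegion Rx Ru θs Ks Ps s β r) {ρ : ℝ}
    (hρ : opNorm Ru ≤ ρ) {K : Controller dx du} (hK : opNorm K ≤ 11 / 10 * s) :
    FormBound (costMatrix Rx Ru K) (3 * (1 + ρ) * s ^ 2) where
  symm := costMatrix_transpose (transpose_eq_of_posSemidef_sub_one h.state_cost)
    (transpose_eq_of_posSemidef_sub_one h.input_cost) K
  nonneg := by have := (opNorm_nonneg Ru).trans hρ; positivity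
  le x := by
    have hρ0 := (opNorm_nonneg Ru).trans hρ
    have hx := dotProduct_self_nonneg' x
    rw [abs_of_nonneg (hx.trans (qf_costMatrix_ge h.state_cost h.input_cost K x)), qf_costMatrix]
    have h1 := h.pair.qf_eq x
    have h2 := h.pair.nonneg (closedLoop θs Ks *ᵥ x)
    have h3 := (dotProduct_self_nonneg' _).trans (dotProduct_self_le_qf h.input_cost (Ks *ᵥ x))
    have h4 := qf_mulVec_le hρ0 (P := Ru) (fun u => ((le_abs_self _).trans
      (abs_qf_le Ru u)).trans (mul_le_mul_of_nonneg_right hρ (dotProduct_self_nonneg' u))) hK x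
    have h5 := h.qf_le x
    have h6 : 0 ≤ s ^ 2 * (x ⬝ᵥ x) := by positivity
    have h7 : 0 ≤ ρ * s ^ 2 * (x ⬝ᵥ x) := by positivity
    linarith

/-- The risk is used in the form σ² (tr X - tr P), so the cost data along the line are the same for
θ and θ', and only W and N = Bδ change. Both loops share the nominal Lyapunov function. -/
theorem LocalRegion.hessian_lipschitz (h : LocalRegion Rx Ru θs Ks Ps s β r) {σ : ℝ≥0}
    (hσ : 0 < σ) {ρ : ℝ} (hρ : opNorm Ru ≤ ρ) {θ θ' : LinSystem dx du} (hθ : ‖θ - θs‖ ≤ r)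
    (hθ' : ‖θ' - θs‖ ≤ r) (hne : θ ≠ θ') {K : Controller dx du}
    (hK : ‖K - Ks‖ ≤ 8 * s ^ 7 * r) {δ : Controller dx du} (hδ : ‖δ‖ = 1) :
    ∃ φ φ₁ φ₂ φ₃ γ γ₁ γ₂ γ₃ : ℝ → ℝ,
      DerivChain φ φ₁ φ₂ φ₃ ∧ DerivChain γ γ₁ γ₂ γ₃ ∧
      (∀ᶠ t in 𝓝 (0 : ℝ), (lqrRisk σ Rx Ru (K + t • δ) θ).toReal = φ t) ∧
      (∀ᶠ t in 𝓝 (0 : ℝ), (lqrRisk σ Rx Ru (K + t • δ) θ').toReal = γ t) ∧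
      ‖φ₂ 0 - γ₂ 0‖ ≤ (σ : ℝ) ^ 2 * (1060 * (3 * (1 + ρ) * s ^ 2)
        * (1 + s ^ 2 * (3 / 2 * β)) ^ 2 * s ^ 3 * ‖θ - θ'‖ * (dx * s ^ 2)) := by
  have hp := h.pair_at hσ hθ
  have hp' := h.pair_at hσ hθ'
  have hs := h.one_le
  have hs0 : 0 < s := by linarith
  have hβ := h.input_pos
  have hρ0 := (opNorm_nonneg Ru).trans hρ
  have hst := h.stable hθ hK
  have hst' := h.stable hθ' hK
  have hL := h.lyapunovFunction hθ hK
  have hL' := h.lyapunovFunction hθ' hK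
  have hKn := h.opNorm_gain_le hK
  have hδ1 : opNorm δ ≤ 1 := (opNorm_le_norm _).trans hδ.le
  -- Strict positivity is needed because the cross-term bound divides by the sizes of its factors.
  have hd : 0 < ‖θ - θ'‖ := norm_pos_iff.2 (sub_ne_zero.2 hne)
  have hν : 0 < 3 / 2 * β := by positivity
  have hNn : ∀ {η : LinSystem dx du}, ‖η - θs‖ ≤ r →
      opNorm (LinSystem.B η * δ) ≤ 3 / 2 * β := fun {η} hη => (opNorm_mul_le _ _).trans (by
    calc opNorm (LinSystem.B η) * opNorm δ ≤ 3 / 2 * β * 1 :=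
          mul_le_mul (h.opNorm_input_le hη) hδ1 (opNorm_nonneg _) (by positivity)
      _ = _ := mul_one _)
  have hE : opNorm (closedLoop θ K - closedLoop θ' K) ≤ 3 * s * ‖θ - θ'‖ := by
    have e : closedLoop θ K - closedLoop θ' K
        = LinSystem.A (θ - θ') + LinSystem.B (θ - θ') * K := by
      simp only [closedLoop, LinSystem.A_sub, LinSystem.B_sub, Matrix.sub_mul]; abel
    rw [e]
    have h1 := opNorm_add_le (LinSystem.A (θ - θ')) (LinSystem.B (θ - θ') * K)
    have h2 := (opNorm_le_norm _).trans (LinSystem.norm_A_le (θ - θ'))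
    have h3 := (opNorm_mul_le (LinSystem.B (θ - θ')) K).trans (mul_le_mul
      ((opNorm_le_norm _).trans (LinSystem.norm_B_le (θ - θ'))) hKn (opNorm_nonneg _) hd.le)
    nlinarith
  have hF : opNorm (LinSystem.B θ * δ - LinSystem.B θ' * δ) ≤ ‖θ - θ'‖ := by
    rw [← Matrix.sub_mul, ← LinSystem.B_sub]
    refine (opNorm_mul_le _ _).trans ?_
    calc opNorm (LinSystem.B (θ - θ')) * opNorm δ ≤ ‖θ - θ'‖ * 1 := mul_le_mul
          ((opNorm_le_norm _).trans (LinSystem.norm_B_le (θ - θ'))) hδ1 (opNorm_nonneg _) hd.le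
      _ = _ := mul_one _
  have hRuD : Dominated 1 Ru ρ := ⟨transpose_eq_of_posSemidef_sub_one h.input_cost, hρ0,
    fun x => by rw [qf_one]; exact (FormBound.of_opNorm
      (transpose_eq_of_posSemidef_sub_one h.input_cost) hρ).le x⟩
  have hq0 : 0 < 3 * (1 + ρ) * s ^ 2 := by positivity
  have m0 := h.formBound_costMatrix hρ hKn
  have hss : s ≤ s ^ 2 := by nlinarith
  have m1 : FormBound (crossTerm δ Ru K) (3 * (1 + ρ) * s ^ 2) :=
    (hRuD.crossTerm Matrix.transpose_one one_pos (by positivity) (qf_one_mulVec_le hδ1)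
      (qf_one_mulVec_le hKn)).mono (by nlinarith)
  have m2 : FormBound (δᵀ * Ru * δ) (3 * (1 + ρ) * s ^ 2) :=
    (hRuD.conj (qf_one_mulVec_le hδ1)).mono (by nlinarith)
  obtain ⟨X₁, X₂, X₃, hch, e₁, e₂, -⟩ := derivChain_dlyap (N := LinSystem.B θ * δ)
    (M₀ := costMatrix Rx Ru K) (M₁ := crossTerm δ Ru K) (M₂ := δᵀ * Ru * δ) hst
  obtain ⟨X₁', X₂', X₃', hch', e₁', e₂', -⟩ := derivChain_dlyap (N := LinSystem.B θ' * δ)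
    (M₀ := costMatrix Rx Ru K) (M₁ := crossTerm δ Ru K) (M₂ := δᵀ * Ru * δ) hst'
  set q := 3 * (1 + ρ) * s ^ 2
  set ν := 3 / 2 * β
  set d := ‖θ - θ'‖
  -- Since Y is at least 1 and at least s²ν, it absorbs both the constant terms and the powers of
  -- the input bound.
  set Y := 1 + s ^ 2 * ν with hY
  have hY1 : 1 ≤ Y := by rw [hY]; linarith [mul_pos (pow_pos hs0 2) hν]
  have hY0 : 0 < Y := by linarith
  have hνY : s ^ 2 * ν ≤ Y := by linarith
  have hννY : s ^ 2 * ν ^ 2 ≤ Y ^ 2 := by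
    have h1 : ν ≤ s ^ 2 * ν := le_mul_of_one_le_left hν.le (one_le_pow₀ hs)
    calc s ^ 2 * ν ^ 2 = s ^ 2 * ν * ν := by ring
      _ ≤ Y * Y := by gcongr; linarith
      _ = Y ^ 2 := by ring
  have hνs : ν ≤ s ^ 2 * ν := le_mul_of_one_le_left hν.le (one_le_pow₀ hs)
  -- The unrounded coefficients are 5/4, 5/4 · 5 and 5/4 · (28 + 4 + 2).
  obtain ⟨d₀, d₁, d₂⟩ := hL'.jet_dominated hν (hNn hθ') m0 m1 m2
    (b₀ := 2 * q) (b₁ := 7 * q * Y) (b₂ := 43 * q * Y ^ 2) (by linarith)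
    (by
      have a1 : q * (s ^ 2 * ν) ≤ q * Y := by gcongr
      have a2 : q * 1 ≤ q * Y := by gcongr
      linarith)
    (by
      have a1 : q * Y * (s ^ 2 * ν) ≤ q * Y * Y := by gcongr
      have a2 : q * 1 ≤ q * (Y * Y) := by gcongr; nlinarith
      have a3 : q * (s ^ 2 * ν ^ 2) ≤ q * Y ^ 2 := by gcongr
      linarith)
    e₁' e₂'
  have hs23 : s ^ 2 ≤ s ^ 3 := by gcongr; norm_num
  have hs13 : s ≤ s ^ 3 := by nlinarith
  have hs03 : 1 ≤ s ^ 3 := one_le_pow₀ hs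
  -- With e = 3sd and f = d the coefficients are exact: 15 = 5/4 · 12, 110 = 5/4 · (42 + 30 + 4 +
  -- 12), 1060 = 5/4 · (258 + 2·(220 + 14 + 42) + 2·(15 + 4)).
  have key := hL.second_dominated_sub hL' (e := 3 * s * d) (f := d) (by positivity) hd hν hE hF
    (hNn hθ) (hNn hθ') e₁ e₂ e₁' e₂' d₀ d₁ d₂
    (z₀ := 15 * q * s ^ 3 * d) (z₁ := 110 * q * Y * s ^ 3 * d)
    (z₂ := 1060 * q * Y ^ 2 * s ^ 3 * d) (by linarith)
    (by
      have a1 : q * (s ^ 2 * ν) * (s ^ 3 * d) ≤ q * Y * (s ^ 3 * d) := by gcongr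
      have a2 : q * 1 * (s ^ 2 * d) ≤ q * Y * (s ^ 3 * d) := by gcongr
      have a3 : q * (s ^ 2 * ν) * (s * d) ≤ q * Y * (s ^ 3 * d) := by gcongr
      have a4 : 0 < q * Y * (s ^ 3 * d) := by positivity
      linarith)
    (by
      have a1 : q * Y * (s ^ 2 * ν) * (s ^ 3 * d) ≤ q * Y * Y * (s ^ 3 * d) := by gcongr
      have a2 : q * Y * 1 * (s ^ 2 * d) ≤ q * Y * Y * (s ^ 3 * d) := by gcongr
      have a3 : q * Y * (s ^ 2 * ν) * (s * d) ≤ q * Y * Y * (s ^ 3 * d) := by gcongr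
      have a4 : q * (s ^ 2 * ν ^ 2) * (s ^ 3 * d) ≤ q * Y ^ 2 * (s ^ 3 * d) := by gcongr
      have a5 : q * 1 * (s ^ 2 * ν) * (1 * d) ≤ q * Y * Y * (s ^ 3 * d) := by gcongr
      have a6 : 0 < q * Y * Y * (s ^ 3 * d) := by positivity
      linarith)
  refine ⟨_, _, _, _, _, _, _, _, hch.mul_trace ((σ : ℝ) ^ 2) (riccati Rx Ru θ).trace,
    hch'.mul_trace ((σ : ℝ) ^ 2) (riccati Rx Ru θ').trace, ?_, ?_, ?_⟩
  · filter_upwards [eventually_stable_line hst δ] with t ht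
    rw [hp.toReal_lqrRisk_eq_sub hσ h.state_cost h.input_cost ht, closedLoop_line, costMatrix,
      conj_line, costMatrix]
    simp only [add_assoc]
  · filter_upwards [eventually_stable_line hst' δ] with t ht
    rw [hp'.toReal_lqrRisk_eq_sub hσ h.state_cost h.input_cost ht, closedLoop_line, costMatrix,
      conj_line, costMatrix]
    simp only [add_assoc]
  · rw [← mul_sub, ← Matrix.trace_sub, norm_mul, Real.norm_of_nonneg (sq_nonneg _),
      Real.norm_eq_abs]
    exact mul_le_mul_of_nonneg_left (hL.abs_trace_le key) (sq_nonneg _)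

end HessianLipschitz

/-! ### Smooth decision making for the linear quadratic regulator -/

section Main

variable {dx du : ℕ}

theorem one_le_opNorm_of_qf_ge {n : ℕ} [NeZero n] {M : Matrix (Fin n) (Fin n) ℝ}
    (h : ∀ x, x ⬝ᵥ x ≤ qf M x) : 1 ≤ opNorm M := by
  have h1 := (h (Pi.single 0 1)).trans ((le_abs_self _).trans (abs_qf_le M (Pi.single 0 1)))
  simpa using h1

theorem exists_localRegion {Rx : Matrix (Fin dx) (Fin dx) ℝ} {Ru : Matrix (Fin du) (Fin du) ℝ}
    (hRx : (Rx - 1).PosSemidef) (hRu : (Ru - 1).PosSemidef) {θs : LinSystem dx du}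
    (hstab : Stabilizable θs) (hB : LinSystem.B θs ≠ 0) {Ψ β r : ℝ}
    (hΨ : Ψ = opNorm (riccati Rx Ru θs)) (hβ : β = opNorm (LinSystem.B θs))
    (hr : r = min (1 / (150 * Ψ ^ 5)) (min (1 / (240 * β * Ψ ^ 5)) (β / 2))) :
    1 ≤ Ψ ∧ ∃ K, LocalRegion Rx Ru θs K (riccati Rx Ru θs) √Ψ β r := by
  obtain ⟨L, hL⟩ := exists_stable_of_stabilizable hstab
  obtain ⟨K, hp⟩ := riccatiPair_of_stable hRx hRu hL
  -- A nonzero input matrix needs a row. Positive dimension is what turns P ⪰ I into 1 ≤ Ψ.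
  have hdx : dx ≠ 0 := by
    rintro rfl
    exact hB (Matrix.ext fun i => i.elim0)
  have : NeZero dx := ⟨hdx⟩
  have h1 : 1 ≤ Ψ := hΨ ▸ one_le_opNorm_of_qf_ge (hp.qf_ge hRx hRu)
  have h0 : 0 < Ψ := by linarith
  have hβ0 : 0 < β := hβ ▸ opNorm_pos_of_ne_zero hB
  have hsq : √Ψ ^ 2 = Ψ := Real.sq_sqrt h0.le
  have hs10 : √Ψ ^ 10 = Ψ ^ 5 := by rw [← hsq, ← pow_mul]; simp [Real.sqrt_sq]
  refine ⟨h1, K, hRx, hRu, hp, Real.one_le_sqrt.2 h1, fun x => ?_, hβ ▸ le_rfl, ?_, ?_, ?_, ?_⟩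
  · rw [hsq, hΨ]; exact (le_abs_self _).trans (abs_qf_le _ x)
  · rw [hr]; positivity
  · rw [hs10]
    have : r ≤ 1 / (150 * Ψ ^ 5) := hr ▸ min_le_left _ _
    rwa [le_div_iff₀' (by positivity)] at this
  · rw [hs10]
    have : r ≤ 1 / (240 * β * Ψ ^ 5) := hr ▸ (min_le_right _ _).trans (min_le_left _ _)
    rwa [le_div_iff₀' (by positivity)] at this
  · exact hr ▸ (min_le_right _ _).trans (min_le_right _ _)

theorem rpow_half_eq_sqrt_pow {x : ℝ} (hx : 0 ≤ x) (k : ℕ) : x ^ ((k : ℝ) / 2) = √x ^ k := by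
  rw [Real.sqrt_eq_rpow, ← Real.rpow_natCast, ← Real.rpow_mul hx]
  congr 1
  ring

end Main

theorem mainTheorem4 :
    ∃ (c₁ c₂ c₃ c₄ : ℝ) (p₂ : Polynomial ℝ) (p₃ : MvPolynomial (Fin 2) ℝ)
      (ph : MvPolynomial (Fin 4) ℝ),
      0 < c₁ ∧ 0 < c₂ ∧ 0 < c₃ ∧ 0 < c₄ ∧
      ∀ (dx du : ℕ) (σ : ℝ≥0) (Rx : Matrix (Fin dx) (Fin dx) ℝ)
        (Ru : Matrix (Fin du) (Fin du) ℝ) (θs : LinSystem dx du) (ΨP ΨB ΨR : ℝ),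
        0 < σ → (Rx - 1).PosSemidef → (Ru - 1).PosSemidef → Stabilizable θs →
        LinSystem.B θs ≠ 0 →
        ΨP = opNorm (riccati Rx Ru θs) → ΨB = opNorm (LinSystem.B θs) → ΨR = opNorm Ru →
        SmoothDecisionMaking (lqrRisk σ Rx Ru) θs
          (r := min (1 / (150 * ΨP ^ 5)) (min (1 / (240 * ΨB * ΨP ^ 5)) (ΨB / 2)))
          (μ := (σ : ℝ) ^ 2 * 2)
          (LR1 := (σ : ℝ) ^ 2 * (c₁ * dx * ΨB * √ΨP + c₂ * dx * ΨR * (1 + 1 / ΨB) / √ΨP))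
          (LR2 := (σ : ℝ) ^ 2 * (c₃ * dx * (ΨB ^ 2 * ΨP ^ 2 + ΨR * (1 + ΨB) * ΨP)))
          (LR3 := (σ : ℝ) ^ 2 * (c₄ * dx *
            (ΨB ^ 3 * ΨP ^ (7 / 2 : ℝ) + ΨR * ΨB * (1 + ΨB) * ΨP ^ (5 / 2 : ℝ))))
          (La1 := 8 * ΨP ^ (7 / 2 : ℝ))
          (La2 := p₂.eval ΨP)
          (La3 := MvPolynomial.eval ![ΨP, ΨB] p₃)
          (Lhess := (σ : ℝ) ^ 2 * (dx * MvPolynomial.eval ![ΨP, ΨR, ΨB, 1 / ΨB] ph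
            + (dx : ℝ) ^ 2 * (ΨB ^ 2 * ΨP ^ 4 + (1 + ΨB) * ΨR * ΨP ^ 3 + ΨR * ΨP / ΨB))) := by
  -- Polarization factor times line bound: 25 = 2·5·5/2, 750 = 5·60·5/2, 200 = 2·100 and 6360 =
  -- 2·1060·3. The cubic gain bound is only claimed on the diagonal, so 4600 needs no factor.
  refine ⟨1, 1, 25, 750, Polynomial.C 200 * Polynomial.X ^ 6,
    MvPolynomial.C 4600 * MvPolynomial.X 0 ^ 9,
    MvPolynomial.C 6360 * (1 + MvPolynomial.X 1) * MvPolynomial.X 0 ^ 4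
      * (1 + MvPolynomial.C (3 / 2) * MvPolynomial.X 0 * MvPolynomial.X 2) ^ 2,
    one_pos, one_pos, by norm_num, by norm_num, ?_⟩
  intro dx du σ Rx Ru θs Ψ β ρ hσ hRx hRu hstab hB hΨ hβ hρ
  set r := min (1 / (150 * Ψ ^ 5)) (min (1 / (240 * β * Ψ ^ 5)) (β / 2)) with hr
  obtain ⟨h1, Ks, h⟩ := exists_localRegion hRx hRu hstab hB hΨ hβ hr
  have h0 : 0 ≤ Ψ := by linarith
  have e7 : Ψ ^ (7 / 2 : ℝ) = √Ψ ^ 7 := by exact_mod_cast rpow_half_eq_sqrt_pow h0 7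
  have e5 : Ψ ^ (5 / 2 : ℝ) = √Ψ ^ 5 := by exact_mod_cast rpow_half_eq_sqrt_pow h0 5
  have e2 : Ψ = √Ψ ^ 2 := (Real.sq_sqrt h0).symm
  have eK : optDecision (lqrRisk σ Rx Ru) θs = Ks := h.pair.optDecision_eq hσ hRx hRu
  rw [e7, e5]
  clear_value r
  -- In terms of s the half-integer powers of Ψ are natural powers, and the remaining estimates are
  -- polynomial in s.
  set s := √Ψ with hsd
  clear_value s
  subst e2
  have hs := h.one_le
  have hs0 : 0 < s := by linarith
  have hr0 := h.radius_pos
  have hβ0 := h.input_pos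
  have hρ0 : 0 ≤ ρ := hρ ▸ opNorm_nonneg Ru
  have hdx : (0 : ℝ) ≤ dx := Nat.cast_nonneg dx
  have hσ0 : (0 : ℝ) < (σ : ℝ) ^ 2 := by positivity
  have jopt := fun {θ} (hθ : ‖θ - θs‖ ≤ r) => h.jetBound_optDecision hσ hθ
  have jrisk := fun {θ} (hθ : ‖θ - θs‖ ≤ r) {a} (ha : ‖a - Ks‖ ≤ 8 * s ^ 7 * r) =>
    h.jetBound_risk hσ hρ.ge hθ ha
  rw [← eK] at jrisk
  constructor
  · exact hr0
  · positivity
  · intro θ hθ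
    exact (h.pair_at hσ hθ).isMinOn hσ hRx hRu
  · intro θ hθ a ha
    exact (h.pair_at hσ hθ).eq_of_isMinOn hσ hRx hRu ha
  · intro θ hθ a
    have := (h.pair_at hσ hθ).quadratic_growth hσ hRx hRu a
    rwa [mul_div_assoc, div_self two_ne_zero, mul_one]
  · intro θ a hθ ha
    rw [eK] at ha
    filter_upwards [eventually_stable_gain (h.stable hθ ha)] with L hL
    rw [(h.pair_at hσ hθ).lqrRisk_of_stable hσ hRx hRu hL]
    exact ENNReal.ofReal_ne_top
  · intro θ a hθ ha
    exact (jrisk hθ ha).contDiffAt.of_le le_top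
  · intro θ a hθ ha
    refine (jrisk hθ ha).one.trans (mul_le_mul_of_nonneg_left ?_ hσ0.le)
    -- The gradient carries 3·16 s⁹ r; the radius condition 150 s¹⁰ r ≤ 1 turns it into 1/s, the
    -- factor 1/√Ψ of the bound.
    have k2 : dx * ρ * (48 * (s ^ 9 * r)) ≤ 1 * dx * ρ * (1 + 1 / β) / s := by
      have : 48 * (s ^ 9 * r) ≤ 1 / s := by
        rw [le_div_iff₀ hs0]; linarith [h.radius_le, mul_pos (pow_pos hs0 10) hr0]
      calc dx * ρ * (48 * (s ^ 9 * r)) ≤ dx * ρ * (1 / s) := by gcongr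
        _ = 1 * dx * ρ * (1 + 0) / s := by ring
        _ ≤ _ := by gcongr; positivity
    -- The remaining part has 120 = 3·16·5/2, absorbed by 240 β s¹⁰ r ≤ 1.
    have k3 : dx * (β * s) * (120 * (β * s ^ 10 * r)) ≤ dx * (β * s) * 1 := by
      gcongr; linarith [h.radius_mul_le, mul_pos (mul_pos hβ0 (pow_pos hs0 10)) hr0]
    linarith
  · intro θ a hθ ha
    refine (jrisk hθ ha).two.trans ?_
    rw [mul_left_comm]
    refine mul_le_mul_of_nonneg_left ?_ hσ0.le
    have k1 : 0 ≤ dx * (ρ * s ^ 2) := by positivity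
    have k2 : 0 ≤ dx * (ρ * β * s ^ 2) := by positivity
    linarith
  · intro θ a hθ ha
    refine (jrisk hθ ha).three.trans ?_
    rw [mul_left_comm]
    refine mul_le_mul_of_nonneg_left ?_ hσ0.le
    have k1 : dx * (ρ * β) * s ^ 4 ≤ dx * (ρ * β) * s ^ 5 := by
      gcongr
      norm_num
    have k2 : dx * β ^ 3 * s ^ 6 ≤ dx * β ^ 3 * s ^ 7 := by
      gcongr
      norm_num
    have k3 : 0 ≤ dx * (ρ * β * β) * s ^ 5 := by positivity
    have k4 : 0 ≤ dx * (ρ * β) * s ^ 5 := by positivity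
    linarith
  · intro θ hθ
    exact (jopt hθ).contDiffAt.of_le le_top
  · intro θ hθ
    exact (jopt hθ).one
  · intro θ hθ
    refine (jopt hθ).two.trans (le_of_eq ?_)
    simp only [Polynomial.eval_mul, Polynomial.eval_C, Polynomial.eval_pow, Polynomial.eval_X]
    ring
  · intro θ hθ δ hδ
    refine ((jopt hθ).three_diag δ hδ).trans (le_of_eq ?_)
    simp only [map_mul, map_pow, MvPolynomial.eval_C, MvPolynomial.eval_X, Matrix.cons_val_zero]
    ring
  · intro θ θ' a hθ hθ' ha
    rw [eK] at ha
    rcases eq_or_ne θ θ' with rfl | hne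
    · simp
    · have k := norm_iteratedFDeriv_two_sub_le
        ((h.pair_at hσ hθ).contDiffAt_lqrRisk hσ hRx hRu (h.stable hθ ha))
        ((h.pair_at hσ hθ').contDiffAt_lqrRisk hσ hRx hRu (h.stable hθ' ha)) (by positivity)
        fun δ hδ => h.hessian_lipschitz hσ hρ.ge hθ hθ' hne ha hδ
      refine k.trans ?_
      simp only [map_mul, map_pow, map_add, map_one, MvPolynomial.eval_C, MvPolynomial.eval_X,
        Matrix.cons_val_zero, Matrix.cons_val_one, Matrix.cons_val]
      rw [mul_left_comm, mul_assoc ((σ : ℝ) ^ 2) _ ‖θ - θ'‖]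
      refine mul_le_mul_of_nonneg_left ?_ hσ0.le
      have k1 : dx * (6360 * (1 + ρ) * (1 + s ^ 2 * (3 / 2 * β)) ^ 2) * s ^ 7 * ‖θ - θ'‖
          ≤ dx * (6360 * (1 + ρ) * (1 + s ^ 2 * (3 / 2 * β)) ^ 2) * s ^ 8 * ‖θ - θ'‖ := by
        gcongr
        norm_num
      -- The estimate needs only the part linear in dx; the quadratic part of the stated constant is
      -- nonnegative and is simply added.
      have k2 : 0 ≤ (dx : ℝ) ^ 2 * (β ^ 2 * (s ^ 2) ^ 4 + (1 + β) * ρ * (s ^ 2) ^ 3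
          + ρ * s ^ 2 / β) * ‖θ - θ'‖ := by positivity
      calc _ = dx * (6360 * (1 + ρ) * (1 + s ^ 2 * (3 / 2 * β)) ^ 2) * s ^ 7 * ‖θ - θ'‖ := by ring
        _ ≤ _ := k1
        _ ≤ dx * (6360 * (1 + ρ) * (1 + s ^ 2 * (3 / 2 * β)) ^ 2) * s ^ 8 * ‖θ - θ'‖
            + (dx : ℝ) ^ 2 * (β ^ 2 * (s ^ 2) ^ 4 + (1 + β) * ρ * (s ^ 2) ^ 3
              + ρ * s ^ 2 / β) * ‖θ - θ'‖ := le_add_of_nonneg_right k2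
        _ = _ := by ring
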